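/- Let $m,k\ge 1$ be integers and write $T(\varphi)=(\cos\varphi,\sin\varphi)$, $N(\varphi)=(-\sin\varphi,\cos\varphi)$. A smooth closed plane curve is locally convex if it is immersed with relative curvature $\kappa>0$ everywhere. For a smooth closed locally convex curve $Y(\varphi)$ of winding number $m$, parametrized by its tangent angle $\varphi\in\mathbb R/2m\pi\mathbb Z$ (so that $Y'=|Y'|\,T$), put $p(\varphi)=-\langle Y(\varphi),N(\varphi)\rangle$, $\rho=1/\kappa$, $$w_k(\varphi)=\sum_{i=0}^{k-1}p\Big(\varphi+\frac{2im\pi}{k}\Big),\qquad \rho_k(\varphi)=\sum_{i=0}^{k-1}\rho\Big(\varphi+\frac{2im\pi}{k}\Big),\qquad f=\frac{\int_0^{2m\pi}\kappa^2\,\partial_\varphi^2\rho_k\,d\varphi-\int_0^{2m\pi}\kappa^2\rho_k\,d\varphi}{\int_0^{2m\pi}\kappa^2\,d\varphi}.$$ The curve has constant $k$-order width if $w_k$ is constant, and is $k$-symmetric if there is a centre $c$ such that, for every $\varphi$, the rotation about $c$ by the angle $2m\pi/k$ carries $Y(\varphi)$ to $Y(\varphi+2m\pi/k)$. Let $X_0$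 be a smooth closed locally convex plane curve of winding number $m$, parametrized by its tangent angle $u\in\mathbb R/2m\pi\mathbb Z$, and consider the flow $$\frac{\partial X}{\partial t}(u,t)=\big(2w_k-\rho_k+f(t)\big)N,\qquad X(u,0)=X_0(u),$$ where $w_k,\rho_k,N$ are those of the curve $X(\cdot,t)$ at its point $X(u,t)$, that is, at the tangent angle $\theta(u,t)$ of $X(\cdot,t)$ there ($\theta$ continuous, $\theta(u,0)=u$), and $f(t)$ is that of $X(\cdot,t)$. A solution on a time interval is smooth in $(u,t)$ up to $t=0$, and its curves are closed, of period $2m\pi$ in $u$, and immersed with nowhere vanishing curvature. Then: 1. The flow has a solution on $[0,\infty)$, and for every $T>0$ any solution on $[0,T)$ agrees with it there. 2. For every $t\ge 0$ the curve $X(\cdot,t)$ is locally convex, has $\theta(\cdot,t):\mathbb R\to\mathbb R$ bijective, and has the same elastic energy $\int\kappa^2\,ds$ as $X_0$; its reparametrization $Y(\cdot,t)$ by the tangent angle, $Y(\theta(u,t),t)=X(u,t)$, is again a smooth closed locally convex curve of period $2m\pi$. 3. As $t\to\infty$, $Y(\cdot,t)$ converges, uniformly together with all derivatives in $\varphi$,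 to a smooth closed locally convex curve $X_\infty$ of winding number $m$, parametrized by its tangent angle, and $X_\infty$ has constant $k$-order width. 4. $X_\infty$ is an $m$-fold circle (about some centre) if and only if $X_0$ is $k$-symmetric. -/

import Mathlib

open scoped ContDiff

namespace KWidthFlow

noncomputable section

/-- The Euclidean plane. -/
abbrev Plane : Type := EuclideanSpace ℝ (Fin 2)

/-- The unit tangent at tangent angle `φ`. -/
def tangentAt (φ : ℝ) : Plane := !₂[Real.cos φ, Real.sin φ]

/-- The unit normal at tangent angle `φ` (the tangent turned by a right angle counterclockwise). -/
def normalAt (φ : ℝ) : Plane := !₂[-Real.sin φ, Real.cos φ]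

/-- Rotation of the plane about the origin by the angle `a`. -/
def rotation (a : ℝ) (v : Plane) : Plane :=
  !₂[Real.cos a * v 0 - Real.sin a * v 1, Real.sin a * v 0 + Real.cos a * v 1]

/-- The relative (signed) curvature of a regular plane curve in an arbitrary parametrization. -/
def curvature (γ : ℝ → Plane) (u : ℝ) : ℝ :=
  (deriv γ u 0 * iteratedDeriv 2 γ u 1 - deriv γ u 1 * iteratedDeriv 2 γ u 0) / ‖deriv γ u‖ ^ 3

/-- The elastic energy `∫ κ² ds` of a closed curve whose parameter has period `2mπ`. -/
def elasticEnergy (m : ℕ) (γ : ℝ → Plane) : ℝ :=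
  ∫ u in (0 : ℝ)..(2 * m * Real.pi), curvature γ u ^ 2 * ‖deriv γ u‖

/-- A smooth, closed, immersed plane curve (as a map of period `2mπ`) with positive
relative curvature. -/
structure IsLocallyConvex (m : ℕ) (γ : ℝ → Plane) : Prop where
  smooth : ContDiff ℝ ∞ γ
  closed : ∀ u, γ (u + 2 * m * Real.pi) = γ u
  immersed : ∀ u, deriv γ u ≠ 0
  curvature_pos : ∀ u, 0 < curvature γ u

/-- A smooth closed locally convex curve whose parameter is its tangent angle;
as the parameter has period `2mπ`, the winding number is `m`. -/
structure IsLocallyConvexByAngle (m : ℕ) (γ : ℝ → Plane) : Prop extends IsLocallyConvex m γ where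
  angle : ∀ φ, deriv γ φ = ‖deriv γ φ‖ • tangentAt φ

/-! In the following definitions `γ` is a curve parametrized by its tangent angle. -/

/-- The support function `p = -⟨γ, N⟩`. -/
def support (γ : ℝ → Plane) (φ : ℝ) : ℝ := -inner ℝ (γ φ) (normalAt φ)

/-- The radius of curvature `ρ = 1 / κ`. -/
def radius (γ : ℝ → Plane) (φ : ℝ) : ℝ := 1 / curvature γ φ

/-- The `k`-order width `w_k(φ) = ∑_{i < k} p(φ + 2imπ/k)`. -/
def kWidth (m k : ℕ) (γ : ℝ → Plane) (φ : ℝ) : ℝ :=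
  ∑ i ∈ Finset.range k, support γ (φ + 2 * i * m * Real.pi / k)

/-- The sum `ρ_k(φ) = ∑_{i < k} ρ(φ + 2imπ/k)`. -/
def kRadius (m k : ℕ) (γ : ℝ → Plane) (φ : ℝ) : ℝ :=
  ∑ i ∈ Finset.range k, radius γ (φ + 2 * i * m * Real.pi / k)

/-- The nonlocal term `f = (∫ κ² ∂²ρ_k/∂φ² dφ - ∫ κ² ρ_k dφ) / ∫ κ² dφ`. -/
def nonlocalTerm (m k : ℕ) (γ : ℝ → Plane) : ℝ :=
  ((∫ φ in (0 : ℝ)..(2 * m * Real.pi), curvature γ φ ^ 2 * iteratedDeriv 2 (kRadius m k γ) φ) -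
      ∫ φ in (0 : ℝ)..(2 * m * Real.pi), curvature γ φ ^ 2 * kRadius m k γ φ) /
    ∫ φ in (0 : ℝ)..(2 * m * Real.pi), curvature γ φ ^ 2

/-- The normal speed `2 w_k - ρ_k + f` at the point of tangent angle `φ`. -/
def speed (m k : ℕ) (γ : ℝ → Plane) (φ : ℝ) : ℝ :=
  2 * kWidth m k γ φ - kRadius m k γ φ + nonlocalTerm m k γ

/-- The `k`-order width is constant. -/
def HasConstantKWidth (m k : ℕ) (γ : ℝ → Plane) : Prop := ∃ c : ℝ, ∀ φ, kWidth m k γ φ = c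

/-- `γ` is invariant under a rotation by `2mπ/k` about some centre; the rotation carries the point
of tangent angle `φ` to the point of tangent angle `φ + 2mπ/k`. -/
def IsKSymmetric (m k : ℕ) (γ : ℝ → Plane) : Prop :=
  ∃ c : Plane, ∀ φ, γ (φ + 2 * m * Real.pi / k) - c = rotation (2 * m * Real.pi / k) (γ φ - c)

/-- `γ` runs on a circle. For a closed locally convex curve with winding number `m` this says that
it is an `m`-fold circle. -/
def IsMultipleCircle (γ : ℝ → Plane) : Prop :=
  ∃ (c : Plane) (r : ℝ), 0 < r ∧ ∀ φ, dist (γ φ) c = r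

/-- The curve at time `t`, reparametrized by its tangent angle, when `θ u t` is the tangent angle
of `X · t` at the parameter `u`. -/
def byAngle (X : ℝ → ℝ → Plane) (θ : ℝ → ℝ → ℝ) (t φ : ℝ) : Plane :=
  X (Function.invFun (fun u => θ u t) φ) t

/-- `X u t`, for `t` in the time interval `I` (with `0 ∈ I`), is a smooth solution of
`∂X/∂t = (2 w_k - ρ_k + f) N` with initial curve `X₀`, and `θ u t` is the tangent angle of
`X · t` at `u`, which varies in time. The label `u` of a point is its tangent angle at time `0`.
The curvature is only asked to be nonzero, so that the radius of curvature in the equation is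
defined. -/
structure IsFlow (m k : ℕ) (X₀ : ℝ → Plane) (I : Set ℝ)
    (X : ℝ → ℝ → Plane) (θ : ℝ → ℝ → ℝ) : Prop where
  smooth : ContDiffOn ℝ ∞ (fun q : ℝ × ℝ => X q.1 q.2) (Set.univ ×ˢ I)
  closed : ∀ t ∈ I, ∀ u, X (u + 2 * m * Real.pi) t = X u t
  initial : ∀ u, X u 0 = X₀ u
  immersed : ∀ t ∈ I, ∀ u, deriv (fun v => X v t) u ≠ 0
  curvature_ne_zero : ∀ t ∈ I, ∀ u, curvature (fun v => X v t) u ≠ 0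
  angle_continuous : ContinuousOn (fun q : ℝ × ℝ => θ q.1 q.2) (Set.univ ×ˢ I)
  angle_initial : ∀ u, θ u 0 = u
  angle : ∀ t ∈ I, ∀ u,
    deriv (fun v => X v t) u = ‖deriv (fun v => X v t) u‖ • tangentAt (θ u t)
  equation : ∀ t ∈ I, ∀ u,
    HasDerivWithinAt (fun τ => X u τ)
      (speed m k (byAngle X θ t) (θ u t) • normalAt (θ u t)) I t

end

end KWidthFlow

namespace KWidthFlow

noncomputable section

open Set Filter Topology MeasureTheory

/-! At a fixed tangent angle the support function sees only the normal velocity, so `p_t = -(2 w_k -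
ρ_k + f)`. Since `ρ_k = w_k'' + w_k`, this reads `p_t = w_k'' - w_k - f` (`speed_curveOf`,
`hasDerivAt_support_byAngle`), which is linear up to the spatial constant `f`. The right side has
period `2mπ/k`, so summing over the `k` shifts gives `(w_k)_t = k (w_k'' - w_k - f)`. Hence `w_k = V
- k c(t)`, where `V` solves the damped heat equation `V_t = k (V'' - V)` with the initial width as
data, `c' + k c = f`, and `p = p₀ + (V - w_k(0)) / k - c(t)`.

The constant `c` is found from the energy rather than from `f`. In the tangent angle the elastic
energy is `∫ 1/ρ dφ`, and `f` is exactly the number that makes it stationary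
(`energy_stationary_iff`). With `u` the radius belonging to `p + c`, the condition is `∫ 1/(u - c) =
E` with `c < min u`. The integral increases strictly in `c` and diverges logarithmically at `min u`,
because `u` is Lipschitz; so the level exists (`exists_level`), is unique, and is smooth in time by
the inverse function theorem (`exists_smooth_level`). Then `ρ = u - c > 0` for all time, and no
curvature estimate is needed (`exists_support_flow`).

All derivatives of `V` decay like `e^{-kt}` (`exists_heat_solution`), and levels are stable under
uniform perturbation (`abs_level_sub_le`), so `p` converges to `p₀` minus its mean over the shifts
minus a constant. This limit has constant width. Its radius is constant exactly if the initial
radius has period `2mπ/k` (`exists_rad_sub_mean_eq_iff`), which is `k`-symmetry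
(`isKSymmetric_curveOf_iff`).

A point moving normally changes its tangent angle by `θ_t = -∂_φ p_t / ρ`; this periodic scalar
equation has a smooth global flow (`exists_smooth_flow`), which gives the solution `X`
(`isFlow_curveOf`). Conversely, the angle of any solution is an increasing bijection, so the
solution yields a flow of support functions. For two such flows the spatial differences of the
difference of widths solve the damped heat equation with zero data and vanish; the support functions
then differ by a function of time, which equality of energies forces to be zero
(`support_flow_unique`). The angles agree by uniqueness for the scalar equation
(`IsFlow.eq_curveOf`). -/

/-! ### Calculus for functions of position and time -/

/-- `F x t` is jointly smooth at every `(x, t)` with `t ∈ J`. -/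
def SmoothAlong {E : Type*} [NormedAddCommGroup E] [NormedSpace ℝ E] (J : Set ℝ)
    (F : ℝ → ℝ → E) : Prop :=
  ∀ x, ∀ t ∈ J, ContDiffAt ℝ ∞ (fun q : ℝ × ℝ => F q.1 q.2) (x, t)

/-- The partial derivative in the first variable. -/
def dx {E : Type*} [NormedAddCommGroup E] [NormedSpace ℝ E] (F : ℝ → ℝ → E) (x t : ℝ) : E :=
  deriv (fun y => F y t) x

/-- The partial derivative in the second variable. -/
def dt {E : Type*} [NormedAddCommGroup E] [NormedSpace ℝ E] (F : ℝ → ℝ → E) (x t : ℝ) : E :=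
  deriv (fun s => F x s) t

section SmoothAlong

variable {E : Type*} [NormedAddCommGroup E] [NormedSpace ℝ E] {J : Set ℝ} {F G : ℝ → ℝ → E}

lemma hasDerivAt_slice_fst {F : ℝ → ℝ → E} {x t : ℝ}
    (h : DifferentiableAt ℝ (fun q : ℝ × ℝ => F q.1 q.2) (x, t)) :
    HasDerivAt (fun y => F y t) (fderiv ℝ (fun q : ℝ × ℝ => F q.1 q.2) (x, t) (1, 0)) x :=
  h.hasFDerivAt.comp_hasDerivAt (f := fun y => (y, t)) x
    ((hasDerivAt_id' x).prodMk (hasDerivAt_const x t))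

lemma hasDerivAt_slice_snd {F : ℝ → ℝ → E} {x t : ℝ}
    (h : DifferentiableAt ℝ (fun q : ℝ × ℝ => F q.1 q.2) (x, t)) :
    HasDerivAt (fun s => F x s) (fderiv ℝ (fun q : ℝ × ℝ => F q.1 q.2) (x, t) (0, 1)) t :=
  h.hasFDerivAt.comp_hasDerivAt (f := fun s => (x, s)) t
    ((hasDerivAt_const t x).prodMk (hasDerivAt_id' t))

lemma SmoothAlong.differentiableAt (h : SmoothAlong J F) {x t : ℝ} (ht : t ∈ J) :
    DifferentiableAt ℝ (fun q : ℝ × ℝ => F q.1 q.2) (x, t) :=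
  (h x t ht).differentiableAt (by simp)

lemma SmoothAlong.hasDerivAt_dx (h : SmoothAlong J F) {x t : ℝ} (ht : t ∈ J) :
    HasDerivAt (fun y => F y t) (dx F x t) x :=
  (hasDerivAt_slice_fst (h.differentiableAt ht)).differentiableAt.hasDerivAt

lemma SmoothAlong.hasDerivAt_dt (h : SmoothAlong J F) {x t : ℝ} (ht : t ∈ J) :
    HasDerivAt (fun s => F x s) (dt F x t) t :=
  (hasDerivAt_slice_snd (h.differentiableAt ht)).differentiableAt.hasDerivAt

lemma SmoothAlong.dx_eq (h : SmoothAlong J F) {x t : ℝ} (ht : t ∈ J) :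
    dx F x t = fderiv ℝ (fun q : ℝ × ℝ => F q.1 q.2) (x, t) (1, 0) :=
  (hasDerivAt_slice_fst (h.differentiableAt ht)).deriv

lemma SmoothAlong.dt_eq (h : SmoothAlong J F) {x t : ℝ} (ht : t ∈ J) :
    dt F x t = fderiv ℝ (fun q : ℝ × ℝ => F q.1 q.2) (x, t) (0, 1) :=
  (hasDerivAt_slice_snd (h.differentiableAt ht)).deriv

lemma SmoothAlong.fderiv_apply (h : SmoothAlong J F) {x t : ℝ} (ht : t ∈ J) (a b : ℝ) :
    fderiv ℝ (fun q : ℝ × ℝ => F q.1 q.2) (x, t) (a, b) = a • dx F x t + b • dt F x t := by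
  rw [h.dx_eq ht, h.dt_eq ht, ← map_smul, ← map_smul, ← map_add]
  simp

lemma eventually_snd_mem (hJ : IsOpen J) {x t : ℝ} (ht : t ∈ J) :
    ∀ᶠ q : ℝ × ℝ in 𝓝 (x, t), q.2 ∈ J :=
  (continuous_snd.continuousAt (x := (x, t))).eventually (hJ.mem_nhds ht)

lemma SmoothAlong.dx (hJ : IsOpen J) (h : SmoothAlong J F) : SmoothAlong J (dx F) := by
  intro x t ht
  have h1 : ContDiffAt ℝ ∞ (fun q => fderiv ℝ (fun q : ℝ × ℝ => F q.1 q.2) q (1, 0)) (x, t) :=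
    ((h x t ht).fderiv_right (m := ∞) (by simp)).clm_apply contDiffAt_const
  refine h1.congr_of_eventuallyEq ?_
  filter_upwards [eventually_snd_mem hJ (x := x) ht] with q hq
  exact h.dx_eq hq

lemma SmoothAlong.dt (hJ : IsOpen J) (h : SmoothAlong J F) : SmoothAlong J (dt F) := by
  intro x t ht
  have h1 : ContDiffAt ℝ ∞ (fun q => fderiv ℝ (fun q : ℝ × ℝ => F q.1 q.2) q (0, 1)) (x, t) :=
    ((h x t ht).fderiv_right (m := ∞) (by simp)).clm_apply contDiffAt_const
  refine h1.congr_of_eventuallyEq ?_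
  filter_upwards [eventually_snd_mem hJ (x := x) ht] with q hq
  exact h.dt_eq hq

lemma SmoothAlong.dt_dx (hJ : IsOpen J) (h : SmoothAlong J F) {x t : ℝ} (ht : t ∈ J) :
    KWidthFlow.dt (KWidthFlow.dx F) x t = KWidthFlow.dx (KWidthFlow.dt F) x t := by
  set f := fun q : ℝ × ℝ => F q.1 q.2 with hf
  have hsym : IsSymmSndFDerivAt ℝ f (x, t) := (h x t ht).isSymmSndFDerivAt (by
    simp only [minSmoothness_of_isRCLikeNormedField]; exact WithTop.coe_le_coe.2 (le_top : (2 : ℕ∞) ≤ ⊤))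
  have hd : DifferentiableAt ℝ (fderiv ℝ f) (x, t) :=
    ((h x t ht).fderiv_right (m := ∞) (by simp)).differentiableAt (by simp)
  have e1 : KWidthFlow.dt (KWidthFlow.dx F) x t = fderiv ℝ (fderiv ℝ f) (x, t) (0, 1) (1, 0) := by
    rw [(h.dx hJ).dt_eq ht]
    have : (fun q : ℝ × ℝ => KWidthFlow.dx F q.1 q.2) =ᶠ[𝓝 (x, t)] fun q => fderiv ℝ f q (1, 0) := by
      filter_upwards [eventually_snd_mem hJ (x := x) ht] with q hq using h.dx_eq hq
    rw [this.fderiv_eq, fderiv_clm_apply hd (differentiableAt_const _)]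
    simp
  have e2 : KWidthFlow.dx (KWidthFlow.dt F) x t = fderiv ℝ (fderiv ℝ f) (x, t) (1, 0) (0, 1) := by
    rw [(h.dt hJ).dx_eq ht]
    have : (fun q : ℝ × ℝ => KWidthFlow.dt F q.1 q.2) =ᶠ[𝓝 (x, t)] fun q => fderiv ℝ f q (0, 1) := by
      filter_upwards [eventually_snd_mem hJ (x := x) ht] with q hq using h.dt_eq hq
    rw [this.fderiv_eq, fderiv_clm_apply hd (differentiableAt_const _)]
    simp
  rw [e1, e2]
  exact hsym.eq _ _

lemma SmoothAlong.contDiff_slice (h : SmoothAlong J F) {t : ℝ} (ht : t ∈ J) :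
    ContDiff ℝ ∞ (fun x => F x t) :=
  contDiff_iff_contDiffAt.2 fun x =>
    (h x t ht).comp x (contDiffAt_id.prodMk contDiffAt_const)

lemma SmoothAlong.continuousOn (h : SmoothAlong J F) :
    ContinuousOn (fun q : ℝ × ℝ => F q.1 q.2) (univ ×ˢ J) :=
  fun q hq => (h q.1 q.2 hq.2).continuousAt.continuousWithinAt

lemma SmoothAlong.of_space {g : ℝ → E} (hg : ContDiff ℝ ∞ g) : SmoothAlong J fun x _ => g x :=
  fun _ _ _ => (hg.comp contDiff_fst).contDiffAt

lemma SmoothAlong.of_time {g : ℝ → E} (hg : ∀ t ∈ J, ContDiffAt ℝ ∞ g t) :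
    SmoothAlong J fun _ t => g t :=
  fun x t ht => (hg t ht).comp (x, t) contDiffAt_snd

lemma SmoothAlong.add (hF : SmoothAlong J F) (hG : SmoothAlong J G) :
    SmoothAlong J fun x t => F x t + G x t := fun x t ht => (hF x t ht).add (hG x t ht)

lemma SmoothAlong.sub (hF : SmoothAlong J F) (hG : SmoothAlong J G) :
    SmoothAlong J fun x t => F x t - G x t := fun x t ht => (hF x t ht).sub (hG x t ht)

lemma SmoothAlong.smul {f : ℝ → ℝ → ℝ} (hf : SmoothAlong J f) (hF : SmoothAlong J F) :
    SmoothAlong J fun x t => f x t • F x t := fun x t ht => (hf x t ht).smul (hF x t ht)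

lemma SmoothAlong.mul {f g : ℝ → ℝ → ℝ} (hf : SmoothAlong J f) (hg : SmoothAlong J g) :
    SmoothAlong J fun x t => f x t * g x t := fun x t ht => (hf x t ht).mul (hg x t ht)

lemma SmoothAlong.neg (hF : SmoothAlong J F) :
    SmoothAlong J fun x t => - F x t := fun x t ht => (hF x t ht).neg

lemma SmoothAlong.div {f g : ℝ → ℝ → ℝ} (hf : SmoothAlong J f) (hg : SmoothAlong J g)
    (h0 : ∀ x, ∀ t ∈ J, g x t ≠ 0) :
    SmoothAlong J fun x t => f x t / g x t := fun x t ht => (hf x t ht).div (hg x t ht) (h0 x t ht)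

lemma SmoothAlong.sum {ι : Type*} {s : Finset ι} {f : ι → ℝ → ℝ → E}
    (hf : ∀ i ∈ s, SmoothAlong J (f i)) :
    SmoothAlong J fun x t => ∑ i ∈ s, f i x t :=
  fun x t ht => ContDiffAt.sum fun i hi => hf i hi x t ht

lemma SmoothAlong.shift (hF : SmoothAlong J F) (a : ℝ) :
    SmoothAlong J fun x t => F (x + a) t := fun x t ht =>
  (hF (x + a) t ht).comp (f := fun q : ℝ × ℝ => (q.1 + a, q.2)) (x, t)
    ((contDiffAt_fst.add contDiffAt_const).prodMk contDiffAt_snd)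

/-- Substitution of a moving point into a jointly smooth function. -/
lemma SmoothAlong.comp (hF : SmoothAlong J F) {u : ℝ → ℝ → ℝ} (hu : SmoothAlong J u) :
    SmoothAlong J fun x t => F (u x t) t := fun x t ht =>
  (hF (u x t) t ht).comp (f := fun q : ℝ × ℝ => (u q.1 q.2, q.2)) (x, t)
    ((hu x t ht).prodMk contDiffAt_snd)

lemma SmoothAlong.mono {J' : Set ℝ} (hF : SmoothAlong J F) (h : J' ⊆ J) : SmoothAlong J' F :=
  fun x t ht => hF x t (h ht)

lemma SmoothAlong.contDiff (hF : SmoothAlong univ F) : ContDiff ℝ ∞ fun q : ℝ × ℝ => F q.1 q.2 :=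
  contDiff_iff_contDiffAt.2 fun q => hF q.1 q.2 trivial

lemma smoothAlong_univ_iff : SmoothAlong univ F ↔ ContDiff ℝ ∞ fun q : ℝ × ℝ => F q.1 q.2 :=
  ⟨fun h => h.contDiff, fun h _ _ _ => h.contDiffAt⟩

/-- Chain rule along a moving point. -/
lemma SmoothAlong.hasDerivAt_comp (hF : SmoothAlong J F) {u : ℝ → ℝ} {u' t : ℝ} (ht : t ∈ J)
    (hu : HasDerivAt u u' t) :
    HasDerivAt (fun s => F (u s) s) (u' • KWidthFlow.dx F (u t) t + KWidthFlow.dt F (u t) t) t := by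
  have := (hF.differentiableAt (x := u t) ht).hasFDerivAt.comp_hasDerivAt
    (f := fun s => (u s, s)) t (hu.prodMk (hasDerivAt_id' t))
  rw [hF.fderiv_apply ht, one_smul] at this
  exact this

end SmoothAlong

/-! ### Parametric integrals -/

/-- A parametric integral over a fixed interval is as smooth as its integrand. -/
lemma contDiffOn_parametric_integral {P : Type*} [NormedAddCommGroup P] [NormedSpace ℝ P]
    {n : ℕ∞} {s : Set P} (hs : IsOpen s) {a b : ℝ} (hab : a ≤ b) {F : P → ℝ → ℝ}
    (hF : ContDiffOn ℝ n (fun q : P × ℝ => F q.1 q.2) (s ×ˢ univ)) :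
    ContDiffOn ℝ n (fun p => ∫ x in a..b, F p x) s := by
  -- The integral is the value at `0` of the convolution of the indicator of `(a, b]` with `y ↦ ψ
  -- (-y) * F p (-y)`. The bump `ψ` is `1` on `[a, b]` and makes the second factor compactly
  -- supported uniformly in `p`.
  let R : ℝ := |a| + |b| + 1
  have hR : 0 < R := by positivity
  let ψ : ContDiffBump (0 : ℝ) := ⟨R, R + 1, hR, by linarith⟩
  let g : P → ℝ → ℝ := fun p y => ψ (-y) * F p (-y)
  have hg : ContDiffOn ℝ n ↿g (s ×ˢ univ) := by
    have h1 : ContDiffOn ℝ n (fun q : P × ℝ => ψ (-q.2)) (s ×ˢ univ) :=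
      (ψ.contDiff.comp (contDiff_snd.neg)).contDiffOn
    have h2 : ContDiffOn ℝ n (fun q : P × ℝ => F q.1 (-q.2)) (s ×ˢ univ) :=
      hF.comp (f := fun q : P × ℝ => (q.1, -q.2))
        ((contDiff_fst.prodMk contDiff_snd.neg).contDiffOn) (fun q hq => ⟨hq.1, trivial⟩)
    exact h1.mul h2
  have hgs : ∀ p, ∀ x, p ∈ s → x ∉ Metric.closedBall (0 : ℝ) (R + 1) → g p x = 0 := by
    intro p x _ hx
    have : ψ (-x) = 0 := ψ.zero_of_le_dist (by
      simp only [Metric.mem_closedBall, dist_zero_right, not_le] at hx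
      simpa [ψ] using hx.le)
    simp [g, this]
  have hloc : LocallyIntegrable ((Ioc a b).indicator fun _ : ℝ => (1 : ℝ)) volume := by
    apply Integrable.locallyIntegrable
    rw [integrable_indicator_iff measurableSet_Ioc]
    simp
  have := contDiffOn_convolution_right_with_param_comp (μ := volume) (ContinuousLinearMap.mul ℝ ℝ)
    (v := fun _ : P => (0 : ℝ)) contDiffOn_const hs (isCompact_closedBall (0 : ℝ) (R + 1)) hgs
    hloc hg
  refine this.congr fun p _ => ?_
  rw [intervalIntegral.integral_of_le hab, ← integral_indicator measurableSet_Ioc]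
  simp only [convolution, ContinuousLinearMap.mul_apply']
  congr 1
  ext x
  by_cases hx : x ∈ Ioc a b
  · have : ψ x = 1 := ψ.one_of_mem_closedBall (by
      simp only [Metric.mem_closedBall, dist_zero_right, Real.norm_eq_abs, ψ, R]
      rcases hx with ⟨h1, h2⟩
      rw [abs_le]
      constructor <;> cases abs_cases a <;> cases abs_cases b <;> linarith)
    simp [hx, g, this]
  · simp [hx]

/-- Differentiation under the integral sign. -/
lemma hasDerivAt_integral_of_smoothAlong {J : Set ℝ} (hJ : IsOpen J) {F : ℝ → ℝ → ℝ}
    (hF : SmoothAlong J F) (a b : ℝ) {t : ℝ} (ht : t ∈ J) :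
    HasDerivAt (fun s => ∫ x in a..b, F x s) (∫ x in a..b, dt F x t) t := by
  obtain ⟨ε, hε, hball⟩ := Metric.isOpen_iff.1 hJ t ht
  have hsub : Metric.closedBall t (ε / 2) ⊆ J :=
    (Metric.closedBall_subset_ball (by linarith)).trans hball
  have hc : ContinuousOn (fun q : ℝ × ℝ => dt F q.1 q.2)
      (uIcc a b ×ˢ Metric.closedBall t (ε / 2)) :=
    (hF.dt hJ).continuousOn.mono (prod_mono (subset_univ _) hsub)
  obtain ⟨C, hC⟩ := (isCompact_uIcc.prod (isCompact_closedBall t (ε / 2))).exists_bound_of_continuousOn hc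
  have hcont : ∀ s ∈ J, Continuous fun x => F x s := fun s hs => (hF.contDiff_slice hs).continuous
  refine (intervalIntegral.hasDerivAt_integral_of_dominated_loc_of_deriv_le
    (F := fun s x => F x s) (F' := fun s x => dt F x s) (bound := fun _ => C)
    (Metric.closedBall_mem_nhds t (half_pos hε)) ?_ ?_ ?_ ?_ ?_ ?_).2
  · filter_upwards [hJ.mem_nhds ht] with s hs
    exact (hcont s hs).aestronglyMeasurable
  · exact (hcont t ht).intervalIntegrable a b
  · exact ((hF.dt hJ).contDiff_slice ht).continuous.aestronglyMeasurable
  · exact .of_forall fun x hx s hs => hC (x, s) ⟨uIoc_subset_uIcc hx, hs⟩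
  · exact intervalIntegrable_const
  · exact .of_forall fun x _ s hs => hF.hasDerivAt_dt (hsub hs)

/-- An integral depends continuously on time. -/
lemma continuousOn_integral_of_continuousOn {K : Set ℝ} {F : ℝ → ℝ → ℝ}
    (hF : ContinuousOn (fun q : ℝ × ℝ => F q.1 q.2) (univ ×ˢ K)) (a b : ℝ) :
    ContinuousOn (fun s => ∫ x in a..b, F x s) K := by
  rw [continuousOn_iff_continuous_domRestrict]
  have : Continuous (Function.uncurry fun (s : K) (x : ℝ) => F x s) := by
    have h2 := hF.comp_continuous (f := fun q : K × ℝ => (q.2, (q.1 : ℝ))) (by fun_prop)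
      (fun q => ⟨trivial, q.1.2⟩)
    exact h2
  exact intervalIntegral.continuous_parametric_intervalIntegral_of_continuous' this a b

/-! ### Fibrewise inverses -/

/-- The fibrewise inverse of a family of functions with nonvanishing derivative is smooth. -/
lemma contDiffAt_fibrewise_inverse {f : ℝ × ℝ → ℝ} {g : ℝ × ℝ → ℝ} {Ω : Set (ℝ × ℝ)} {y t : ℝ}
    (hΩ : IsOpen Ω) (hf : ContDiffAt ℝ ∞ f (g (y, t), t)) {a : ℝ} (ha : a ≠ 0)
    (hfx : HasDerivAt (fun x => f (x, t)) a (g (y, t))) (hmem : (g (y, t), t) ∈ Ω)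
    (hinv : f (g (y, t), t) = y)
    (huniq : ∀ᶠ q : ℝ × ℝ in 𝓝 (y, t), ∀ x, (x, q.2) ∈ Ω → f (x, q.2) = q.1 → x = g q) :
    ContDiffAt ℝ ∞ g (y, t) := by
  set A := fderiv ℝ f (g (y, t), t) with hA
  have hAf : HasFDerivAt f A (g (y, t), t) := (hf.differentiableAt (by simp)).hasFDerivAt
  have hA1 : A (1, 0) = a :=
    (hAf.comp_hasDerivAt (g (y, t)) ((hasDerivAt_id _).prodMk (hasDerivAt_const _ t))).unique hfx
  set b := A (0, 1) with hb
  have hAab : ∀ h s, A (h, s) = a * h + b * s := by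
    intro h s
    have : (h, s) = h • ((1 : ℝ), (0 : ℝ)) + s • ((0 : ℝ), (1 : ℝ)) := by simp
    rw [this, map_add, map_smul, map_smul, hA1, ← hb]
    simp [mul_comm]
  -- The map `Θ (x, s) = (f (x, s), s)` has the triangular derivative `(h, s) ↦ (a h + b s, s)`,
  -- invertible because `a ≠ 0`; `L` is this map with its explicit inverse.
  let L : (ℝ × ℝ) ≃L[ℝ] (ℝ × ℝ) := ContinuousLinearEquiv.equivOfInverse
    (A.prod (ContinuousLinearMap.snd ℝ ℝ ℝ))
    ((a⁻¹ • ContinuousLinearMap.fst ℝ ℝ ℝ - (a⁻¹ * b) • ContinuousLinearMap.snd ℝ ℝ ℝ).prod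
      (ContinuousLinearMap.snd ℝ ℝ ℝ))
    (by rintro ⟨h, s⟩; simp [hAab]; field_simp; ring)
    (by rintro ⟨h, s⟩; simp [hAab]; field_simp; ring)
  let Θ : ℝ × ℝ → ℝ × ℝ := fun q => (f q, q.2)
  have hΘ : ContDiffAt ℝ ∞ Θ (g (y, t), t) := hf.prodMk contDiffAt_snd
  have hΘ' : HasFDerivAt Θ (L : ℝ × ℝ →L[ℝ] ℝ × ℝ) (g (y, t), t) :=
    hAf.prodMk hasFDerivAt_snd
  have hloc := hΘ.to_localInverse hΘ' (by simp)
  have hy : Θ (g (y, t), t) = (y, t) := by simp [Θ, hinv]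
  rw [hy] at hloc
  have hat : hΘ.localInverse hΘ' (by simp) (y, t) = (g (y, t), t) := by
    have := hΘ.localInverse_apply_image hΘ' (by simp)
    rwa [hy] at this
  have hright : ∀ᶠ q in 𝓝 (y, t), Θ (hΘ.localInverse hΘ' (by simp) q) = q := by
    have := (hΘ.hasStrictFDerivAt' hΘ' (by simp)).eventually_right_inverse
    rw [hy] at this
    exact this
  refine (contDiffAt_fst.comp (y, t) hloc).congr_of_eventuallyEq ?_
  have hin : ∀ᶠ q in 𝓝 (y, t), hΘ.localInverse hΘ' (by simp) q ∈ Ω := by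
    apply hloc.continuousAt.eventually
    rw [hat]
    exact hΩ.mem_nhds hmem
  -- The local inverse of `Θ` at `q` stays in `Ω` and solves the equation there, so the uniqueness
  -- hypothesis identifies its first component with `g q`.
  filter_upwards [hright, hin, huniq] with q h1 h2 h3
  have e2 : (hΘ.localInverse hΘ' (by simp) q).2 = q.2 := by
    simpa only [Θ] using congrArg Prod.snd h1
  have e1 : f (hΘ.localInverse hΘ' (by simp) q) = q.1 := by
    simpa only [Θ] using congrArg Prod.fst h1
  refine (h3 _ ?_ ?_).symm
  · rw [← e2]; exact h2
  · rw [← e2]; exact e1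

/-- A function with `C^n` partial derivatives is `C^{n+1}`. -/
lemma contDiff_succ_of_partials {E : Type*} [NormedAddCommGroup E] [NormedSpace ℝ E]
    {f A B : ℝ × ℝ → E} {n : ℕ}
    (hA : ContDiff ℝ n A) (hB : ContDiff ℝ n B)
    (hf : ∀ q, HasFDerivAt f ((ContinuousLinearMap.fst ℝ ℝ ℝ).smulRight (A q) +
      (ContinuousLinearMap.snd ℝ ℝ ℝ).smulRight (B q)) q) :
    ContDiff ℝ (n + 1) f := by
  rw [contDiff_succ_iff_fderiv]
  refine ⟨fun q => (hf q).differentiableAt, by simp, ?_⟩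
  have : fderiv ℝ f = fun q => (ContinuousLinearMap.fst ℝ ℝ ℝ).smulRight (A q) +
      (ContinuousLinearMap.snd ℝ ℝ ℝ).smulRight (B q) := funext fun q => (hf q).fderiv
  rw [this]
  exact (contDiff_const.smulRight hA).add (contDiff_const.smulRight hB)

/-! ### The moving frame -/

@[simp] lemma tangentAt_apply_zero (φ : ℝ) : tangentAt φ 0 = Real.cos φ := rfl
@[simp] lemma tangentAt_apply_one (φ : ℝ) : tangentAt φ 1 = Real.sin φ := rfl
@[simp] lemma normalAt_apply_zero (φ : ℝ) : normalAt φ 0 = -Real.sin φ := rfl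
@[simp] lemma normalAt_apply_one (φ : ℝ) : normalAt φ 1 = Real.cos φ := rfl

lemma inner_plane (v w : Plane) : inner ℝ v w = v 0 * w 0 + v 1 * w 1 := by
  simp [PiLp.inner_apply, Fin.sum_univ_two]; ring

lemma plane_ext {v w : Plane} (h0 : v 0 = w 0) (h1 : v 1 = w 1) : v = w := by
  ext i; fin_cases i <;> assumption

lemma hasDerivAt_plane {γ : ℝ → Plane} {γ' : Plane} {u : ℝ} :
    HasDerivAt γ γ' u ↔ HasDerivAt (fun s => γ s 0) (γ' 0) u ∧ HasDerivAt (fun s => γ s 1) (γ' 1) u := by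
  constructor
  · intro h
    exact ⟨(EuclideanSpace.proj (𝕜 := ℝ) (0 : Fin 2)).hasFDerivAt.comp_hasDerivAt u h,
      (EuclideanSpace.proj (𝕜 := ℝ) (1 : Fin 2)).hasFDerivAt.comp_hasDerivAt u h⟩
  · rintro ⟨h0, h1⟩
    rw [hasDerivAt_iff_hasFDerivAt, ← hasFDerivWithinAt_univ, hasFDerivWithinAt_euclidean]
    intro i
    fin_cases i
    · exact (h0.hasFDerivAt.congr_fderiv (by ext; simp)).hasFDerivWithinAt
    · exact (h1.hasFDerivAt.congr_fderiv (by ext; simp)).hasFDerivWithinAt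

lemma hasDerivAt_tangentAt (φ : ℝ) : HasDerivAt tangentAt (normalAt φ) φ :=
  hasDerivAt_plane.2 ⟨Real.hasDerivAt_cos φ, Real.hasDerivAt_sin φ⟩

lemma hasDerivAt_normalAt (φ : ℝ) : HasDerivAt normalAt (-tangentAt φ) φ :=
  hasDerivAt_plane.2 ⟨(Real.hasDerivAt_sin φ).neg, Real.hasDerivAt_cos φ⟩

lemma contDiff_tangentAt : ContDiff ℝ ∞ tangentAt := by
  rw [contDiff_euclidean]
  intro i
  fin_cases i
  · exact Real.contDiff_cos
  · exact Real.contDiff_sin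

lemma contDiff_normalAt : ContDiff ℝ ∞ normalAt := by
  rw [contDiff_euclidean]
  intro i
  fin_cases i
  · exact Real.contDiff_sin.neg
  · exact Real.contDiff_cos

@[simp] lemma inner_tangentAt_self (φ : ℝ) : inner ℝ (tangentAt φ) (tangentAt φ) = 1 := by
  simp only [inner_plane, tangentAt_apply_zero, tangentAt_apply_one]
  nlinarith [Real.sin_sq_add_cos_sq φ]

@[simp] lemma inner_normalAt_self (φ : ℝ) : inner ℝ (normalAt φ) (normalAt φ) = 1 := by
  simp only [inner_plane, normalAt_apply_zero, normalAt_apply_one]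
  nlinarith [Real.sin_sq_add_cos_sq φ]

@[simp] lemma inner_tangentAt_normalAt (φ : ℝ) : inner ℝ (tangentAt φ) (normalAt φ) = 0 := by
  simp only [inner_plane, tangentAt_apply_zero, tangentAt_apply_one, normalAt_apply_zero, normalAt_apply_one]
  ring

@[simp] lemma inner_normalAt_tangentAt (φ : ℝ) : inner ℝ (normalAt φ) (tangentAt φ) = 0 := by
  rw [real_inner_comm, inner_tangentAt_normalAt]

@[simp] lemma norm_tangentAt (φ : ℝ) : ‖tangentAt φ‖ = 1 := by
  have h := real_inner_self_eq_norm_sq (tangentAt φ)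
  rw [inner_tangentAt_self] at h
  nlinarith [norm_nonneg (tangentAt φ)]

@[simp] lemma norm_normalAt (φ : ℝ) : ‖normalAt φ‖ = 1 := by
  have h := real_inner_self_eq_norm_sq (normalAt φ)
  rw [inner_normalAt_self] at h
  nlinarith [norm_nonneg (normalAt φ)]

lemma eq_frame (v : Plane) (φ : ℝ) :
    v = inner ℝ v (tangentAt φ) • tangentAt φ + inner ℝ v (normalAt φ) • normalAt φ := by
  have h := Real.sin_sq_add_cos_sq φ
  apply plane_ext
  · simp only [inner_plane, PiLp.add_apply, PiLp.smul_apply, smul_eq_mul, tangentAt_apply_zero,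
      tangentAt_apply_one, normalAt_apply_zero, normalAt_apply_one]
    linear_combination (-v 0) * h
  · simp only [inner_plane, PiLp.add_apply, PiLp.smul_apply, smul_eq_mul, tangentAt_apply_zero,
      tangentAt_apply_one, normalAt_apply_zero, normalAt_apply_one]
    linear_combination (-v 1) * h

lemma tangentAt_periodic (m : ℕ) : Function.Periodic tangentAt (2 * m * Real.pi) := by
  intro φ
  have e : φ + 2 * m * Real.pi = φ + m * (2 * Real.pi) := by ring
  apply plane_ext <;> simp [e, Real.cos_add_nat_mul_two_pi, Real.sin_add_nat_mul_two_pi]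

lemma normalAt_periodic (m : ℕ) : Function.Periodic normalAt (2 * m * Real.pi) := by
  intro φ
  have e : φ + 2 * m * Real.pi = φ + m * (2 * Real.pi) := by ring
  apply plane_ext <;> simp [e, Real.cos_add_nat_mul_two_pi, Real.sin_add_nat_mul_two_pi]

lemma exists_int_of_tangentAt_eq {a b : ℝ} (h : tangentAt a = tangentAt b) :
    ∃ n : ℤ, a - b = n * (2 * Real.pi) := by
  have h0 : Real.cos a = Real.cos b := congrArg (fun v : Plane => v 0) h
  have h1 : Real.sin a = Real.sin b := congrArg (fun v : Plane => v 1) h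
  have : Real.cos (a - b) = 1 := by
    rw [Real.cos_sub, h0, h1]; nlinarith [Real.sin_sq_add_cos_sq b]
  obtain ⟨n, hn⟩ := (Real.cos_eq_one_iff _).1 this
  exact ⟨n, hn.symm⟩

/-- The curvature of a curve given by its speed and its tangent angle. -/
lemma curvature_eq_of_polar {γ : ℝ → Plane} {g θ : ℝ → ℝ} {g' θ' u : ℝ}
    (hγ : ∀ v, HasDerivAt γ (g v • tangentAt (θ v)) v) (hg : HasDerivAt g g' u)
    (hθ : HasDerivAt θ θ' u) (hpos : 0 < g u) : curvature γ u = θ' / g u := by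
  have h1 : deriv γ = fun v => g v • tangentAt (θ v) := funext fun v => (hγ v).deriv
  have h2 : iteratedDeriv 2 γ u = g u • (θ' • normalAt (θ u)) + g' • tangentAt (θ u) := by
    rw [iteratedDeriv_succ, iteratedDeriv_one, h1]
    exact (hg.smul ((hasDerivAt_tangentAt (θ u)).scomp u hθ)).deriv
  have h3 : ‖deriv γ u‖ = g u := by
    rw [h1]; simp [norm_smul, abs_of_pos hpos]
  rw [curvature, h2, h3, h1]
  simp only [PiLp.add_apply, PiLp.smul_apply, smul_eq_mul, tangentAt_apply_zero,
      tangentAt_apply_one, normalAt_apply_zero, normalAt_apply_one]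
  field_simp
  linear_combination (g u * θ') * Real.sin_sq_add_cos_sq (θ u)

/-! ### Curves and their support functions -/

/-- The curve with support function `p`, parametrized by its tangent angle. -/
def curveOf (p : ℝ → ℝ) (φ : ℝ) : Plane := deriv p φ • tangentAt φ - p φ • normalAt φ

/-- The radius of curvature in terms of the support function. -/
def rad (p : ℝ → ℝ) (φ : ℝ) : ℝ := deriv (deriv p) φ + p φ

lemma contDiff_deriv {E : Type*} [NormedAddCommGroup E] [NormedSpace ℝ E] {p : ℝ → E}
    (hp : ContDiff ℝ ∞ p) : ContDiff ℝ ∞ (deriv p) :=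
  (contDiff_infty_iff_deriv.1 hp).2

lemma hasDerivAt_of_contDiff {E : Type*} [NormedAddCommGroup E] [NormedSpace ℝ E] {p : ℝ → E}
    (hp : ContDiff ℝ ∞ p) (x : ℝ) : HasDerivAt p (deriv p x) x :=
  ((contDiff_infty_iff_deriv.1 hp).1 x).hasDerivAt

lemma periodic_deriv {E : Type*} [NormedAddCommGroup E] [NormedSpace ℝ E] {p : ℝ → E} {L : ℝ}
    (hp : Function.Periodic p L) : Function.Periodic (deriv p) L := by
  intro x
  rw [← deriv_comp_add_const]
  congr 1
  exact funext hp

lemma contDiff_rad {p : ℝ → ℝ} (hp : ContDiff ℝ ∞ p) : ContDiff ℝ ∞ (rad p) :=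
  (contDiff_deriv (contDiff_deriv hp)).add hp

lemma periodic_rad {p : ℝ → ℝ} {L : ℝ} (hp : Function.Periodic p L) :
    Function.Periodic (rad p) L := fun x => by
  simp only [rad, periodic_deriv (periodic_deriv hp) x, hp x]

lemma contDiff_curveOf {p : ℝ → ℝ} (hp : ContDiff ℝ ∞ p) : ContDiff ℝ ∞ (curveOf p) :=
  ((contDiff_deriv hp).smul contDiff_tangentAt).sub (hp.smul contDiff_normalAt)

/-- By `T' = N` and `N' = -T` the two terms `p' N` cancel and only a tangential term is left. So the
parameter is the tangent angle and `p'' + p` is the speed, that is, the radius of curvature. -/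
lemma hasDerivAt_curveOf {p : ℝ → ℝ} (hp : ContDiff ℝ ∞ p) (φ : ℝ) :
    HasDerivAt (curveOf p) (rad p φ • tangentAt φ) φ := by
  have h1 := (hasDerivAt_of_contDiff (contDiff_deriv hp) φ).smul (hasDerivAt_tangentAt φ)
  have h2 := (hasDerivAt_of_contDiff hp φ).smul (hasDerivAt_normalAt φ)
  refine (h1.sub h2).congr_deriv ?_
  simp only [rad, add_smul, smul_neg]
  abel

lemma support_curveOf (p : ℝ → ℝ) : support (curveOf p) = p := by
  funext φ
  simp [support, curveOf, inner_sub_left, inner_smul_left]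

lemma curvature_curveOf {p : ℝ → ℝ} (hp : ContDiff ℝ ∞ p) (h : ∀ φ, 0 < rad p φ) (φ : ℝ) :
    curvature (curveOf p) φ = 1 / rad p φ :=
  curvature_eq_of_polar (θ := id) (hasDerivAt_curveOf hp)
    (hasDerivAt_of_contDiff (contDiff_rad hp) φ) (hasDerivAt_id φ) (h φ)

lemma radius_curveOf {p : ℝ → ℝ} (hp : ContDiff ℝ ∞ p) (h : ∀ φ, 0 < rad p φ) :
    radius (curveOf p) = rad p := by
  funext φ
  rw [radius, curvature_curveOf hp h, one_div_one_div]

lemma isLocallyConvexByAngle_curveOf {m : ℕ} {p : ℝ → ℝ} (hp : ContDiff ℝ ∞ p)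
    (hper : Function.Periodic p (2 * m * Real.pi)) (h : ∀ φ, 0 < rad p φ) :
    IsLocallyConvexByAngle m (curveOf p) where
  smooth := contDiff_curveOf hp
  closed u := by
    simp only [curveOf, periodic_deriv hper u, hper u, tangentAt_periodic m u,
      normalAt_periodic m u]
  immersed u := by
    rw [(hasDerivAt_curveOf hp u).deriv]
    exact smul_ne_zero (h u).ne' (by simpa using norm_ne_zero_iff.1 (norm_tangentAt u ▸ one_ne_zero))
  curvature_pos u := by
    rw [curvature_curveOf hp h]
    exact one_div_pos.2 (h u)
  angle φ := by
    rw [(hasDerivAt_curveOf hp φ).deriv, norm_smul, norm_tangentAt, Real.norm_eq_abs,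
      abs_of_pos (h φ), mul_one]

section FromCurve

variable {m : ℕ} {γ : ℝ → Plane}

lemma contDiff_support (h : ContDiff ℝ ∞ γ) : ContDiff ℝ ∞ (support γ) :=
  (h.inner ℝ contDiff_normalAt).neg

lemma hasDerivAt_support (h : ContDiff ℝ ∞ γ)
    (hang : ∀ φ, deriv γ φ = ‖deriv γ φ‖ • tangentAt φ) (φ : ℝ) :
    HasDerivAt (support γ) (inner ℝ (γ φ) (tangentAt φ)) φ := by
  have := ((hasDerivAt_of_contDiff h φ).inner ℝ (hasDerivAt_normalAt φ)).neg
  refine this.congr_deriv ?_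
  rw [hang φ, inner_smul_left, inner_tangentAt_normalAt, inner_neg_right]
  simp

/-- Since `γ'` is tangential, `p' = ⟨γ, T⟩`, so `p' T - p N` is the expansion of `γ` in the moving
frame. This lets support functions replace curves throughout. -/
lemma curveOf_support (h : ContDiff ℝ ∞ γ)
    (hang : ∀ φ, deriv γ φ = ‖deriv γ φ‖ • tangentAt φ) : curveOf (support γ) = γ := by
  funext φ
  rw [curveOf, (hasDerivAt_support h hang φ).deriv, support, neg_smul, sub_neg_eq_add, ← eq_frame]

lemma rad_support (h : ContDiff ℝ ∞ γ)
    (hang : ∀ φ, deriv γ φ = ‖deriv γ φ‖ • tangentAt φ) (φ : ℝ) :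
    rad (support γ) φ = ‖deriv γ φ‖ := by
  have h1 := (hasDerivAt_curveOf (contDiff_support h) φ).deriv
  rw [curveOf_support h hang, hang φ] at h1
  have h2 := congrArg (fun v => inner ℝ v (tangentAt φ)) h1
  simpa [inner_smul_left] using h2.symm

lemma rad_support_pos (h : IsLocallyConvexByAngle m γ) (φ : ℝ) : 0 < rad (support γ) φ := by
  rw [rad_support h.smooth h.angle]
  exact norm_pos_iff.2 (h.immersed φ)

lemma periodic_support (h : Function.Periodic γ (2 * m * Real.pi)) :
    Function.Periodic (support γ) (2 * m * Real.pi) := fun φ => by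
  simp only [support, h φ, normalAt_periodic m φ]

end FromCurve

/-! ### Sums over shifts -/

/-- The sum of the shifts of `p` by the multiples of `2mπ/k`. -/
def shiftSum (m k : ℕ) (p : ℝ → ℝ) (φ : ℝ) : ℝ :=
  ∑ i ∈ Finset.range k, p (φ + 2 * i * m * Real.pi / k)

section ShiftSum

variable {m k : ℕ} {p : ℝ → ℝ}

/-- The shift moves each summand to the next one, and the last returns to the first because `p` has
period `2mπ`. -/
lemma shiftSum_periodic (hk : 0 < k) (hp : Function.Periodic p (2 * m * Real.pi)) :
    Function.Periodic (shiftSum m k p) (2 * m * Real.pi / k) := by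
  intro φ
  have hk' : (k : ℝ) ≠ 0 := by positivity
  have e1 : shiftSum m k p (φ + 2 * m * Real.pi / k) =
      ∑ i ∈ Finset.range k, p (φ + 2 * ((i + 1 : ℕ) : ℝ) * m * Real.pi / k) := by
    refine Finset.sum_congr rfl fun i _ => ?_
    congr 1; push_cast; ring
  have e2 := Finset.sum_range_succ (fun i : ℕ => p (φ + 2 * (i : ℝ) * m * Real.pi / k)) k
  have e3 := Finset.sum_range_succ' (fun i : ℕ => p (φ + 2 * (i : ℝ) * m * Real.pi / k)) k
  have e4 : p (φ + 2 * (k : ℝ) * m * Real.pi / k) = p (φ + 2 * ((0 : ℕ) : ℝ) * m * Real.pi / k) := by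
    have : φ + 2 * (k : ℝ) * m * Real.pi / k = φ + 2 * m * Real.pi := by field_simp
    rw [this, hp φ]; simp
  rw [e1, shiftSum]
  linarith

lemma periodic_of_periodic_div (hk : 0 < k) (hp : Function.Periodic p (2 * m * Real.pi / k)) :
    Function.Periodic p (2 * m * Real.pi) := by
  have := hp.nat_mul k
  have hk' : (k : ℝ) ≠ 0 := by positivity
  rwa [mul_div_cancel₀ _ hk'] at this

/-- This is the source of the factor `k` in the heat equation of the width: the time derivative of
`p` is already invariant under the shifts. -/
lemma shiftSum_of_periodic (hp : Function.Periodic p (2 * m * Real.pi / k)) :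
    shiftSum m k p = fun φ => k * p φ := by
  funext φ
  rw [shiftSum, Finset.sum_congr rfl (g := fun _ => p φ)]
  · simp
  · intro i _
    have := hp.nat_mul i φ
    rw [← this]; congr 1; ring

lemma contDiff_shiftSum (hp : ContDiff ℝ ∞ p) : ContDiff ℝ ∞ (shiftSum m k p) :=
  ContDiff.sum fun _ _ => hp.comp (contDiff_id.add contDiff_const)

lemma deriv_shiftSum (hp : ContDiff ℝ ∞ p) : deriv (shiftSum m k p) = shiftSum m k (deriv p) := by
  funext φ
  have : HasDerivAt (shiftSum m k p) (shiftSum m k (deriv p) φ) φ :=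
    HasDerivAt.fun_sum fun i _ => (hasDerivAt_of_contDiff hp _).comp_add_const φ _
  exact this.deriv

lemma shiftSum_add (p q : ℝ → ℝ) :
    shiftSum m k (fun x => p x + q x) = fun x => shiftSum m k p x + shiftSum m k q x := by
  funext x; simp [shiftSum, Finset.sum_add_distrib]

lemma shiftSum_sub (p q : ℝ → ℝ) :
    shiftSum m k (fun x => p x - q x) = fun x => shiftSum m k p x - shiftSum m k q x := by
  funext x; simp [shiftSum, Finset.sum_sub_distrib]

lemma shiftSum_const (c : ℝ) : shiftSum m k (fun _ => c) = fun _ => k * c := by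
  funext x; simp [shiftSum]

lemma shiftSum_rad (hp : ContDiff ℝ ∞ p) : shiftSum m k (rad p) = rad (shiftSum m k p) := by
  funext x
  have : rad p = fun x => deriv (deriv p) x + p x := rfl
  rw [this, shiftSum_add]
  simp only [rad, deriv_shiftSum hp, deriv_shiftSum (contDiff_deriv hp)]

end ShiftSum

/-! ### The speed in terms of the support function -/

section Speed

variable {m k : ℕ} {p : ℝ → ℝ}

lemma kWidth_curveOf (p : ℝ → ℝ) : kWidth m k (curveOf p) = shiftSum m k p := by
  funext φ; simp only [kWidth, support_curveOf, shiftSum]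

lemma kRadius_curveOf (hp : ContDiff ℝ ∞ p) (h : ∀ φ, 0 < rad p φ) :
    kRadius m k (curveOf p) = rad (shiftSum m k p) := by
  rw [← shiftSum_rad hp]
  funext φ; simp only [kRadius, radius_curveOf hp h, shiftSum]

/-- The coefficient `2` outweighs the zeroth order term of `ρ_k = w_k'' + w_k` and leaves `w_k -
w_k''`; with `p_t = -speed` the equation is a damped heat equation. -/
lemma speed_curveOf (hp : ContDiff ℝ ∞ p) (h : ∀ φ, 0 < rad p φ) (φ : ℝ) :
    speed m k (curveOf p) φ = shiftSum m k p φ - deriv (deriv (shiftSum m k p)) φ +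
      nonlocalTerm m k (curveOf p) := by
  rw [speed, kWidth_curveOf, kRadius_curveOf hp h, rad]; ring

/-- The nonlocal term is the constant that keeps the elastic energy constant. -/
lemma nonlocalTerm_curveOf_iff (hm : 0 < m) (hp : ContDiff ℝ ∞ p) (h : ∀ φ, 0 < rad p φ) (c : ℝ) :
    nonlocalTerm m k (curveOf p) = c ↔
      ∫ φ in (0 : ℝ)..(2 * m * Real.pi), (1 / rad p φ) ^ 2 *
        (deriv (deriv (rad (shiftSum m k p))) φ - rad (shiftSum m k p) φ - c) = 0 := by
  have hκ : Continuous fun φ => (1 / rad p φ) ^ 2 :=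
    (continuous_const.div (contDiff_rad hp).continuous fun φ => (h φ).ne').pow 2
  have hW : ContDiff ℝ ∞ (rad (shiftSum m k p)) := contDiff_rad (contDiff_shiftSum hp)
  have hW2 := (contDiff_deriv (contDiff_deriv hW)).continuous
  have hpos : 0 < ∫ φ in (0 : ℝ)..(2 * m * Real.pi), (1 / rad p φ) ^ 2 :=
    intervalIntegral.intervalIntegral_pos_of_pos (hκ.intervalIntegrable _ _)
      (fun φ => pow_pos (one_div_pos.2 (h φ)) 2) (by positivity)
  rw [nonlocalTerm, kRadius_curveOf hp h]
  simp only [curvature_curveOf hp h, iteratedDeriv_succ, iteratedDeriv_zero]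
  have e : ∀ φ, (1 / rad p φ) ^ 2 *
        (deriv (deriv (rad (shiftSum m k p))) φ - rad (shiftSum m k p) φ - c) =
      (1 / rad p φ) ^ 2 * deriv (deriv (rad (shiftSum m k p))) φ -
      (1 / rad p φ) ^ 2 * rad (shiftSum m k p) φ - c * (1 / rad p φ) ^ 2 := fun φ => by ring
  simp only [e]
  rw [intervalIntegral.integral_sub, intervalIntegral.integral_sub,
    intervalIntegral.integral_const_mul, div_eq_iff hpos.ne', sub_eq_zero (b := c * _)]
  · exact (hκ.mul hW2).intervalIntegrable _ _
  · exact (hκ.mul hW.continuous).intervalIntegrable _ _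
  · exact ((hκ.mul hW2).sub (hκ.mul hW.continuous)).intervalIntegrable _ _
  · exact (continuous_const.mul hκ).intervalIntegrable _ _

end Speed

/-! ### Fourier series solutions of the damped heat equation -/

/-- A smooth cut-off of the decaying exponential, up to a factor. -/
structure IsHeatProfile (ψ : ℝ → ℝ) : Prop where
  smooth : ContDiff ℝ ∞ ψ
  eq_zero : ∀ s < -2, ψ s = 0
  eq_exp : ∃ C, ∀ s > -1, ψ s = C * Real.exp (-s)

/-- Closure under differentiation is the reason for the free constant in `eq_exp`: differentiating
only changes its sign. The cut-off keeps a profile bounded on the whole line, so the series below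
converge for negative times as well and the solution is smooth across `t = 0`. -/
lemma IsHeatProfile.deriv {ψ : ℝ → ℝ} (h : IsHeatProfile ψ) : IsHeatProfile (deriv ψ) where
  smooth := contDiff_deriv h.smooth
  eq_zero s hs := by
    have : ψ =ᶠ[𝓝 s] fun _ => 0 := by
      filter_upwards [Iio_mem_nhds hs] with x hx using h.eq_zero x hx
    rw [this.deriv_eq]; simp
  eq_exp := by
    obtain ⟨C, hC⟩ := h.eq_exp
    refine ⟨-C, fun s hs => ?_⟩
    have : ψ =ᶠ[𝓝 s] fun x => C * Real.exp (-x) := by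
      filter_upwards [Ioi_mem_nhds hs] with x hx using hC x hx
    rw [this.deriv_eq, (((hasDerivAt_neg' s).exp).const_mul C).deriv]
    simp

lemma IsHeatProfile.bounded {ψ : ℝ → ℝ} (h : IsHeatProfile ψ) : ∃ B, ∀ s, |ψ s| ≤ B := by
  obtain ⟨C, hC⟩ := h.eq_exp
  obtain ⟨M, hM⟩ := (isCompact_Icc (a := (-2 : ℝ)) (b := 0)).exists_bound_of_continuousOn
    h.smooth.continuous.continuousOn
  refine ⟨max M |C|, fun s => ?_⟩
  rcases lt_or_ge s (-2) with h1 | h1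
  · rw [h.eq_zero s h1, abs_zero]
    exact le_max_of_le_right (abs_nonneg C)
  rcases le_or_gt s 0 with h2 | h2
  · exact le_max_of_le_left (hM s ⟨h1, h2⟩)
  · rw [hC s (by linarith), abs_mul, abs_of_pos (Real.exp_pos _)]
    refine le_max_of_le_right (mul_le_of_le_one_right (abs_nonneg C) ?_)
    exact Real.exp_le_one_iff.2 (by linarith)

/-- The standard profile, equal to `e⁻ˢ` for `s > -1`. -/
def heatProfile (s : ℝ) : ℝ := Real.exp (-s) * Real.smoothTransition (s + 2)

lemma heatProfile_eq {s : ℝ} (hs : -1 < s) : heatProfile s = Real.exp (-s) := by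
  rw [heatProfile, Real.smoothTransition.one_of_one_le (by linarith), mul_one]

lemma isHeatProfile_heatProfile : IsHeatProfile heatProfile where
  smooth := (Real.contDiff_exp.comp contDiff_neg).mul
    (Real.smoothTransition.contDiff.comp (contDiff_id.add contDiff_const))
  eq_zero s hs := by
    rw [heatProfile, Real.smoothTransition.zero_of_nonpos (by linarith), mul_zero]
  eq_exp := ⟨1, fun s hs => by rw [heatProfile_eq hs, one_mul]⟩

lemma deriv_heatProfile {s : ℝ} (hs : -1 < s) : deriv heatProfile s = -heatProfile s := by
  have : heatProfile =ᶠ[𝓝 s] fun x => Real.exp (-x) := by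
    filter_upwards [Ioi_mem_nhds hs] with x hx using heatProfile_eq hx
  rw [this.deriv_eq, ((hasDerivAt_neg' s).exp).deriv, heatProfile_eq hs]
  simp

/-- Coefficient sequences that decay faster than every power. -/
def RapidDecay (a : ℤ → ℂ) : Prop := ∀ j : ℕ, ∃ C, ∀ n : ℤ, ‖a n‖ * (1 + |(n : ℝ)|) ^ j ≤ C

lemma RapidDecay.summable {a : ℤ → ℂ} (h : RapidDecay a) (j : ℕ) :
    Summable fun n : ℤ => ‖a n‖ * (1 + |(n : ℝ)|) ^ j := by
  obtain ⟨C, hC⟩ := h (j + 2)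
  have hs : Summable fun n : ℤ => max C 0 * (1 / |(n : ℝ)| ^ 2) := by
    refine Summable.mul_left _ ?_
    simpa using Real.summable_one_div_int_pow.2 (show 1 < 2 by norm_num)
  -- The comparison term `1 / |n| ^ 2` is `0` at `n = 0` by the convention for division, so the
  -- zeroth coefficient is added by hand.
  have hs' : Summable fun n : ℤ => max C 0 * (1 / |(n : ℝ)| ^ 2) + (if n = 0 then ‖a 0‖ else 0) :=
    hs.add (summable_of_hasFiniteSupport (Set.Finite.subset (Set.finite_singleton 0) (by
      intro n; simp +contextual)))
  refine Summable.of_nonneg_of_le (fun n => by positivity) (fun n => ?_) hs'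
  by_cases hn : n = 0
  · subst hn; simp
  · have hn' : 0 < |(n : ℝ)| := by positivity
    simp only [hn, if_false, add_zero]
    rw [mul_one_div, le_div_iff₀ (by positivity)]
    calc ‖a n‖ * (1 + |(n : ℝ)|) ^ j * |(n : ℝ)| ^ 2
        ≤ ‖a n‖ * (1 + |(n : ℝ)|) ^ j * (1 + |(n : ℝ)|) ^ 2 := by
          gcongr; linarith
      _ = ‖a n‖ * (1 + |(n : ℝ)|) ^ (j + 2) := by ring
      _ ≤ C := hC n
      _ ≤ max C 0 := le_max_left _ _

lemma RapidDecay.summable_norm {a : ℤ → ℂ} (h : RapidDecay a) : Summable fun n => ‖a n‖ := by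
  simpa using h.summable 0

lemma RapidDecay.mul {a b : ℤ → ℂ} (h : RapidDecay a) {D : ℝ} {d : ℕ}
    (hb : ∀ n, ‖b n‖ ≤ D * (1 + |(n : ℝ)|) ^ d) : RapidDecay fun n => b n * a n := by
  intro j
  obtain ⟨C, hC⟩ := h (d + j)
  have hD : 0 ≤ D := by have := (norm_nonneg _).trans (hb 0); simpa using this
  refine ⟨D * C, fun n => ?_⟩
  calc ‖b n * a n‖ * (1 + |(n : ℝ)|) ^ j = ‖b n‖ * (‖a n‖ * (1 + |(n : ℝ)|) ^ j) := by
        rw [norm_mul]; ring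
    _ ≤ (D * (1 + |(n : ℝ)|) ^ d) * (‖a n‖ * (1 + |(n : ℝ)|) ^ j) := by gcongr; exact hb n
    _ = D * (‖a n‖ * (1 + |(n : ℝ)|) ^ (d + j)) := by ring
    _ ≤ D * C := by gcongr; exact hC n

/-- The oscillation `e^{inνx}`. -/
def wave (ν : ℝ) (n : ℤ) (x : ℝ) : ℂ := Complex.exp ((n * ν * x : ℝ) * Complex.I)

lemma norm_wave (ν : ℝ) (n : ℤ) (x : ℝ) : ‖wave ν n x‖ = 1 := Complex.norm_exp_ofReal_mul_I _

/-- The factor by which differentiation multiplies the `n`-th oscillation. -/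
def freq (ν : ℝ) (n : ℤ) : ℂ := (n * ν : ℝ) * Complex.I

lemma norm_freq (ν : ℝ) (n : ℤ) : ‖freq ν n‖ = |(n : ℝ)| * |ν| := by
  simp [freq]

lemma hasDerivAt_wave (ν : ℝ) (n : ℤ) (x : ℝ) :
    HasDerivAt (wave ν n) (freq ν n * wave ν n x) x := by
  have h1 : HasDerivAt (fun x : ℝ => ((n * ν * x : ℝ) : ℂ) * Complex.I) (freq ν n) x := by
    have := ((hasDerivAt_id x).const_mul ((n : ℝ) * ν)).ofReal_comp.mul_const Complex.I
    simpa [freq] using this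
  have := h1.cexp
  exact this.congr_deriv (mul_comm _ _)

lemma wave_periodic {ν L : ℝ} (hL : ν * L = 2 * Real.pi) (n : ℤ) :
    Function.Periodic (wave ν n) L := by
  intro x
  have : (((n * ν * (x + L) : ℝ) : ℂ)) * Complex.I =
      ((n * ν * x : ℝ) : ℂ) * Complex.I + n * (2 * Real.pi * Complex.I) := by
    have h2 : (n * ν * (x + L) : ℝ) = n * ν * x + n * (2 * Real.pi) := by rw [← hL]; ring
    rw [h2]; push_cast; ring
  rw [wave, this, Complex.exp_add, Complex.exp_int_mul_two_pi_mul_I, mul_one, wave]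

/-- The decay rate of the `n`-th oscillation. -/
def rate (k ν : ℝ) (n : ℤ) : ℝ := k * ((n * ν) ^ 2 + 1)

lemma rate_bound {k : ℝ} (hk : 0 < k) (ν : ℝ) (n : ℤ) :
    ‖((rate k ν n : ℝ) : ℂ)‖ ≤ k * (ν ^ 2 + 1) * (1 + |(n : ℝ)|) ^ 2 := by
  have h0 : 0 ≤ rate k ν n := by unfold rate; positivity
  rw [Complex.norm_real, Real.norm_eq_abs, abs_of_nonneg h0, rate, mul_assoc]
  gcongr
  have h1 : (n : ℝ) ^ 2 = |(n : ℝ)| ^ 2 := (sq_abs _).symm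
  rw [mul_pow, h1]
  have := abs_nonneg (n : ℝ)
  nlinarith [sq_nonneg ν, mul_nonneg (sq_nonneg ν) this]

lemma freq_bound (ν : ℝ) (n : ℤ) : ‖freq ν n‖ ≤ |ν| * (1 + |(n : ℝ)|) ^ 1 := by
  rw [norm_freq, pow_one]
  nlinarith [abs_nonneg ν]

/-- The series with coefficients `a` and time profile `ψ`. -/
def waveSeries (k ν : ℝ) (a : ℤ → ℂ) (ψ : ℝ → ℝ) (x t : ℝ) : ℂ :=
  ∑' n, a n * (ψ (rate k ν n * t) * wave ν n x)

section WaveSeries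

variable {k ν : ℝ} {a : ℤ → ℂ} {ψ : ℝ → ℝ}

lemma summable_waveSeries (ha : RapidDecay a) (hψ : IsHeatProfile ψ) (x t : ℝ) :
    Summable fun n => a n * (ψ (rate k ν n * t) * wave ν n x) := by
  obtain ⟨B, hB⟩ := hψ.bounded
  refine Summable.of_norm_bounded (ha.summable_norm.mul_right B) fun n => ?_
  rw [norm_mul, norm_mul, norm_wave, mul_one, Complex.norm_real]
  gcongr
  exact hB _

/-- Termwise differentiation is allowed because rapid decay absorbs the factors `freq` and `rate`,
and profiles are bounded with their derivatives. Both partial derivatives are again series of this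
type, so smoothness follows by induction. -/
lemma hasFDerivAt_waveSeries (hk : 0 < k) (ha : RapidDecay a) (hψ : IsHeatProfile ψ) (q : ℝ × ℝ) :
    HasFDerivAt (fun q : ℝ × ℝ => waveSeries k ν a ψ q.1 q.2)
      ((ContinuousLinearMap.fst ℝ ℝ ℝ).smulRight
          (waveSeries k ν (fun n => freq ν n * a n) ψ q.1 q.2) +
        (ContinuousLinearMap.snd ℝ ℝ ℝ).smulRight
          (waveSeries k ν (fun n => (rate k ν n : ℂ) * a n) (deriv ψ) q.1 q.2)) q := by
  have ha1 : RapidDecay fun n => freq ν n * a n := ha.mul (freq_bound ν)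
  have ha2 : RapidDecay fun n => (rate k ν n : ℂ) * a n := ha.mul (rate_bound hk ν)
  obtain ⟨B, hB⟩ := hψ.bounded
  obtain ⟨B', hB'⟩ := hψ.deriv.bounded
  let t1 : ℤ → ℝ × ℝ → ℂ := fun n q =>
    (freq ν n * a n) * (ψ (rate k ν n * q.2) * wave ν n q.1)
  let t2 : ℤ → ℝ × ℝ → ℂ := fun n q =>
    ((rate k ν n : ℂ) * a n) * (deriv ψ (rate k ν n * q.2) * wave ν n q.1)
  have hd : ∀ n q, HasFDerivAt
      (fun q : ℝ × ℝ => a n * (ψ (rate k ν n * q.2) * wave ν n q.1))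
      ((ContinuousLinearMap.fst ℝ ℝ ℝ).smulRight (t1 n q) +
        (ContinuousLinearMap.snd ℝ ℝ ℝ).smulRight (t2 n q)) q := by
    intro n q
    have h1 : HasFDerivAt (fun q : ℝ × ℝ => wave ν n q.1)
        ((ContinuousLinearMap.fst ℝ ℝ ℝ).smulRight (freq ν n * wave ν n q.1)) q :=
      ((hasDerivAt_wave ν n q.1).hasFDerivAt.comp q hasFDerivAt_fst).congr_fderiv (by ext <;> simp)
    have h2 : HasDerivAt (fun s : ℝ => ((ψ (rate k ν n * s) : ℝ) : ℂ))
        ((deriv ψ (rate k ν n * q.2) * rate k ν n : ℝ) : ℂ) q.2 := by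
      have h3 : HasDerivAt (fun s : ℝ => rate k ν n * s) (rate k ν n) q.2 := by
        simpa using (hasDerivAt_id q.2).const_mul (rate k ν n)
      exact ((hasDerivAt_of_contDiff hψ.smooth (rate k ν n * q.2)).comp q.2 h3).ofReal_comp
    have h4 : HasFDerivAt (fun q : ℝ × ℝ => ((ψ (rate k ν n * q.2) : ℝ) : ℂ))
        ((ContinuousLinearMap.snd ℝ ℝ ℝ).smulRight
          ((deriv ψ (rate k ν n * q.2) * rate k ν n : ℝ) : ℂ)) q :=
      (h2.hasFDerivAt.comp q hasFDerivAt_snd).congr_fderiv (by ext <;> simp)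
    refine ((h4.mul h1).const_mul (a n)).congr_fderiv ?_
    ext <;> simp [t1, t2] <;> ring
  have hbd : ∀ n q, ‖(ContinuousLinearMap.fst ℝ ℝ ℝ).smulRight (t1 n q) +
        (ContinuousLinearMap.snd ℝ ℝ ℝ).smulRight (t2 n q)‖ ≤
      ‖freq ν n * a n‖ * B + ‖(rate k ν n : ℂ) * a n‖ * B' := by
    intro n q
    refine (norm_add_le _ _).trans (add_le_add ?_ ?_)
    · rw [ContinuousLinearMap.norm_smulRight_apply]
      refine (mul_le_of_le_one_left (norm_nonneg _) (ContinuousLinearMap.norm_fst_le ..)).trans ?_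
      simp only [t1]
      rw [norm_mul, norm_mul (Complex.ofReal (ψ _)), norm_wave, mul_one, Complex.norm_real]
      gcongr
      exact hB _
    · rw [ContinuousLinearMap.norm_smulRight_apply]
      refine (mul_le_of_le_one_left (norm_nonneg _) (ContinuousLinearMap.norm_snd_le ..)).trans ?_
      simp only [t2]
      rw [norm_mul, norm_mul (Complex.ofReal (deriv ψ _)), norm_wave, mul_one, Complex.norm_real]
      gcongr
      exact hB' _
  have hsum := (ha1.summable_norm.mul_right B).add (ha2.summable_norm.mul_right B')
  have key := hasFDerivAt_tsum hsum hd hbd (x₀ := q)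
    (summable_waveSeries ha hψ q.1 q.2) q
  refine key.congr_fderiv ?_
  have s1 : HasSum (fun n => t1 n q) (waveSeries k ν (fun n => freq ν n * a n) ψ q.1 q.2) :=
    (summable_waveSeries ha1 hψ q.1 q.2).hasSum
  have s2 : HasSum (fun n => t2 n q)
      (waveSeries k ν (fun n => (rate k ν n : ℂ) * a n) (deriv ψ) q.1 q.2) :=
    (summable_waveSeries ha2 hψ.deriv q.1 q.2).hasSum
  have s1' := s1.mapL (ContinuousLinearMap.smulRightL ℝ (ℝ × ℝ) ℂ (ContinuousLinearMap.fst ℝ ℝ ℝ))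
  have s2' := s2.mapL (ContinuousLinearMap.smulRightL ℝ (ℝ × ℝ) ℂ (ContinuousLinearMap.snd ℝ ℝ ℝ))
  exact (s1'.add s2').tsum_eq

lemma contDiff_waveSeries (hk : 0 < k) (n : ℕ) : ∀ {a : ℤ → ℂ} {ψ : ℝ → ℝ}, RapidDecay a →
    IsHeatProfile ψ → ContDiff ℝ n fun q : ℝ × ℝ => waveSeries k ν a ψ q.1 q.2 := by
  induction n with
  | zero =>
    intro a ψ ha hψ
    exact contDiff_zero.2 (continuous_iff_continuousAt.2 fun q =>
      (hasFDerivAt_waveSeries hk ha hψ q).continuousAt)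
  | succ n ih =>
    intro a ψ ha hψ
    rw [Nat.cast_succ]
    exact contDiff_succ_of_partials (ih (ha.mul (freq_bound ν)) hψ)
      (ih (ha.mul (rate_bound hk ν)) hψ.deriv) (hasFDerivAt_waveSeries hk ha hψ)

lemma hasDerivAt_waveSeries_fst (hk : 0 < k) (ha : RapidDecay a) (hψ : IsHeatProfile ψ) (x t : ℝ) :
    HasDerivAt (fun y => waveSeries k ν a ψ y t)
      (waveSeries k ν (fun n => freq ν n * a n) ψ x t) x := by
  have := (hasFDerivAt_waveSeries (ν := ν) hk ha hψ (x, t)).comp_hasDerivAt (f := fun y => (y, t)) x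
    ((hasDerivAt_id' x).prodMk (hasDerivAt_const x t))
  simpa [Function.comp_def] using this

lemma hasDerivAt_waveSeries_snd (hk : 0 < k) (ha : RapidDecay a) (hψ : IsHeatProfile ψ) (x t : ℝ) :
    HasDerivAt (fun s => waveSeries k ν a ψ x s)
      (waveSeries k ν (fun n => (rate k ν n : ℂ) * a n) (deriv ψ) x t) t := by
  have := (hasFDerivAt_waveSeries (ν := ν) hk ha hψ (x, t)).comp_hasDerivAt (f := fun s => (x, s)) t
    ((hasDerivAt_const t x).prodMk (hasDerivAt_id' t))
  simpa [Function.comp_def] using this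

lemma rapidDecay_freq_pow (ha : RapidDecay a) (j : ℕ) : RapidDecay fun n => freq ν n ^ j * a n := by
  refine ha.mul (D := |ν| ^ j) (d := j) fun n => ?_
  rw [norm_pow, ← mul_pow]
  exact pow_le_pow_left₀ (norm_nonneg _) (by simpa using freq_bound ν n) j

lemma iteratedDeriv_re_waveSeries (hk : 0 < k) (ha : RapidDecay a) (hψ : IsHeatProfile ψ) (j : ℕ)
    (t : ℝ) : iteratedDeriv j (fun y => (waveSeries k ν a ψ y t).re) =
      fun x => (waveSeries k ν (fun n => freq ν n ^ j * a n) ψ x t).re := by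
  induction j with
  | zero => simp
  | succ j ih =>
    rw [iteratedDeriv_succ, ih]
    funext x
    have h := hasDerivAt_waveSeries_fst (ν := ν) hk (rapidDecay_freq_pow ha j (ν := ν)) hψ x t
    have h2 := Complex.reCLM.hasFDerivAt.comp_hasDerivAt x h
    rw [show (fun y => (waveSeries k ν (fun n => freq ν n ^ j * a n) ψ y t).re) =
      Complex.reCLM ∘ fun y => waveSeries k ν (fun n => freq ν n ^ j * a n) ψ y t from rfl, h2.deriv]
    simp only [Complex.reCLM_apply, pow_succ', mul_assoc]

/-- Every decay rate is at least `k`, the rate of the zeroth mode; the damping term makes even the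
constant mode decay. -/
lemma norm_waveSeries_le (hk : 0 < k) (ha : RapidDecay a) (x : ℝ) {t : ℝ} (ht : 0 ≤ t) :
    ‖waveSeries k ν a heatProfile x t‖ ≤ (∑' n, ‖a n‖) * Real.exp (-k * t) := by
  rw [← tsum_mul_right]
  refine tsum_of_norm_bounded (ha.summable_norm.mul_right _).hasSum fun n => ?_
  have hr : k ≤ rate k ν n := by unfold rate; nlinarith [sq_nonneg ((n : ℝ) * ν)]
  rw [norm_mul, norm_mul, norm_wave, mul_one, Complex.norm_real,
    heatProfile_eq (by nlinarith [mul_nonneg (hk.le.trans hr) ht]),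
    Real.norm_eq_abs, abs_of_pos (Real.exp_pos _)]
  gcongr
  nlinarith

/-- For `t ≥ 0` the profile is evaluated at nonnegative arguments, where it satisfies `ψ' = -ψ`, and
`-rate = k (freq² - 1)`. For `t < 0` the cut-off interferes. -/
lemma waveSeries_time (hk : 0 < k) (x : ℝ) {t : ℝ} (ht : 0 ≤ t) (ha : RapidDecay a) :
    waveSeries k ν (fun n => (rate k ν n : ℂ) * a n) (deriv heatProfile) x t =
      k * (waveSeries k ν (fun n => freq ν n ^ 2 * a n) heatProfile x t -
        waveSeries k ν a heatProfile x t) := by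
  have h1 := (summable_waveSeries (k := k) (ν := ν) (rapidDecay_freq_pow (ν := ν) ha 2)
    isHeatProfile_heatProfile x t)
  have h2 := (summable_waveSeries (k := k) (ν := ν) ha isHeatProfile_heatProfile x t)
  unfold waveSeries
  rw [← h1.tsum_sub h2, ← tsum_mul_left]
  congr 1
  funext n
  have hr : 0 ≤ rate k ν n * t := by unfold rate; positivity
  rw [deriv_heatProfile (by linarith)]
  have h3 : freq ν n ^ 2 = -((n : ℂ) * ν) ^ 2 := by
    rw [freq, mul_pow, Complex.I_sq]; push_cast; ring
  have h4 : ((rate k ν n : ℝ) : ℂ) = k * (((n : ℂ) * ν) ^ 2 + 1) := by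
    rw [rate]; push_cast; ring
  beta_reduce
  rw [h3, h4]
  push_cast
  ring

end WaveSeries

/-! ### Fourier coefficients of smooth periodic functions -/

lemma integral_wave_mul_deriv {ν L : ℝ} (hL : ν * L = 2 * Real.pi) {f : ℝ → ℂ}
    (hf : ContDiff ℝ ∞ f) (hper : Function.Periodic f L) (n : ℤ) :
    freq ν n * ∫ x in (0 : ℝ)..L, wave ν (-n) x * f x =
      ∫ x in (0 : ℝ)..L, wave ν (-n) x * deriv f x := by
  have hw : Continuous (wave ν (-n)) := continuous_iff_continuousAt.2 fun x =>
    (hasDerivAt_wave ν (-n) x).continuousAt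
  have := intervalIntegral.integral_mul_deriv_eq_deriv_mul (a := 0) (b := L)
    (fun x _ => hasDerivAt_wave ν (-n) x) (fun x _ => hasDerivAt_of_contDiff hf x)
    ((continuous_const.mul hw).intervalIntegrable _ _)
    ((contDiff_deriv hf).continuous.intervalIntegrable _ _)
  have e1 : f L = f 0 := by simpa using hper 0
  have e2 : wave ν (-n) L = wave ν (-n) 0 := by simpa using wave_periodic hL (-n) 0
  rw [this, e1, e2, sub_self, zero_sub, ← intervalIntegral.integral_neg,
    ← intervalIntegral.integral_const_mul]
  congr 1
  funext x
  simp [freq]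
  ring

/-- Each integration by parts trades a derivative of `f` for a factor `nν`; periodicity removes the
boundary terms. -/
lemma rapidDecay_integral_wave {ν L : ℝ} (hν : 0 < ν) (hL : ν * L = 2 * Real.pi)
    {f : ℝ → ℂ} (hf : ContDiff ℝ ∞ f) (hper : Function.Periodic f L) :
    RapidDecay fun n => ∫ x in (0 : ℝ)..L, wave ν (-n) x * f x := by
  have step : ∀ j : ℕ, ∀ f : ℝ → ℂ, ContDiff ℝ ∞ f → Function.Periodic f L →
      ∃ C, ∀ n : ℤ, ‖∫ x in (0 : ℝ)..L, wave ν (-n) x * f x‖ * |(n : ℝ)| ^ j ≤ C := by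
    intro j
    induction j with
    | zero =>
      intro f hf _
      obtain ⟨M, hM⟩ := (isCompact_uIcc (a := 0) (b := L)).exists_bound_of_continuousOn
        hf.continuous.continuousOn
      refine ⟨M * |L - 0|, fun n => ?_⟩
      rw [pow_zero, mul_one]
      refine intervalIntegral.norm_integral_le_of_norm_le_const fun x hx => ?_
      rw [norm_mul, norm_wave, one_mul]
      exact hM x (uIoc_subset_uIcc hx)
    | succ j ih =>
      intro f hf hp
      obtain ⟨C, hC⟩ := ih (deriv f) (contDiff_deriv hf) (periodic_deriv hp)
      refine ⟨C / ν, fun n => ?_⟩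
      rw [le_div_iff₀ hν]
      have := hC n
      rw [← integral_wave_mul_deriv hL hf hp n, norm_mul, norm_freq, abs_of_pos hν] at this
      calc _ = |(n : ℝ)| * ν * ‖∫ x in (0 : ℝ)..L, wave ν (-n) x * f x‖ * |(n : ℝ)| ^ j := by ring
        _ ≤ C := this
  intro j
  obtain ⟨C0, hC0⟩ := step 0 f hf hper
  obtain ⟨C, hC⟩ := step j f hf hper
  refine ⟨2 ^ j * (C0 + C), fun n => ?_⟩
  have h0 := hC0 n
  rw [pow_zero, mul_one] at h0
  have h1 := hC n
  have hb : (1 + |(n : ℝ)|) ^ j ≤ 2 ^ j * (1 + |(n : ℝ)| ^ j) := by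
    rcases le_total 1 |(n : ℝ)| with h | h
    · calc (1 + |(n : ℝ)|) ^ j ≤ (2 * |(n : ℝ)|) ^ j := by gcongr; linarith
        _ = 2 ^ j * |(n : ℝ)| ^ j := mul_pow _ _ _
        _ ≤ _ := by gcongr; linarith
    · calc (1 + |(n : ℝ)|) ^ j ≤ 2 ^ j := by gcongr; linarith
        _ ≤ _ := le_mul_of_one_le_right (by positivity) (by linarith [pow_nonneg (abs_nonneg (n : ℝ)) j])
  calc _ ≤ ‖∫ x in (0 : ℝ)..L, wave ν (-n) x * f x‖ * (2 ^ j * (1 + |(n : ℝ)| ^ j)) := by gcongr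
    _ = 2 ^ j * (‖∫ x in (0 : ℝ)..L, wave ν (-n) x * f x‖ +
        ‖∫ x in (0 : ℝ)..L, wave ν (-n) x * f x‖ * |(n : ℝ)| ^ j) := by ring
    _ ≤ _ := by gcongr

/-- A smooth periodic function is the sum of a rapidly converging Fourier series. -/
lemma exists_fourier_series {ν L : ℝ} (hν : 0 < ν) (hL0 : 0 < L) (hL : ν * L = 2 * Real.pi)
    {f : ℝ → ℂ} (hf : ContDiff ℝ ∞ f) (hper : Function.Periodic f L) :
    ∃ a : ℤ → ℂ, RapidDecay a ∧ ∀ x, HasSum (fun n => a n * wave ν n x) (f x) := by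
  have : Fact (0 < L) := ⟨hL0⟩
  have hLc : (L : ℂ) ≠ 0 := by exact_mod_cast hL0.ne'
  have hνc : (ν : ℂ) * L = 2 * Real.pi := by exact_mod_cast hL
  have hwave : ∀ (n : ℤ) (x : ℝ), fourier n (x : AddCircle L) = wave ν n x := by
    intro n x
    rw [fourier_coe_apply, wave]
    congr 1
    rw [← hνc]; push_cast; field_simp
  let F : C(AddCircle L, ℂ) := ⟨hper.lift, by
    apply continuous_coinduced_dom.2
    exact hf.continuous⟩
  let a : ℤ → ℂ := fun n => ((1 / L : ℝ) : ℂ) * ∫ x in (0 : ℝ)..L, wave ν (-n) x * f x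
  have hcoeff : fourierCoeff F = a := by
    funext n
    rw [fourierCoeff_eq_intervalIntegral F n 0, zero_add, Complex.real_smul]
    simp only [a]
    congr 1
    refine intervalIntegral.integral_congr fun x _ => ?_
    simp only [hwave, smul_eq_mul]
    rfl
  have ha : RapidDecay a := (rapidDecay_integral_wave hν hL hf hper).mul
    (b := fun _ => ((1 / L : ℝ) : ℂ)) (D := ‖((1 / L : ℝ) : ℂ)‖) (d := 0) (by simp)
  refine ⟨a, ha, fun x => ?_⟩
  have hs : Summable (fourierCoeff F) := by
    rw [hcoeff]; exact ha.summable_norm.of_norm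
  have := has_pointwise_sum_fourier_series_of_summable hs (x : AddCircle L)
  simp only [hcoeff, hwave, smul_eq_mul] at this
  exact this

/-- Smooth solution of the damped heat equation on the circle, smooth also across `t = 0`. -/
theorem exists_heat_solution {k L : ℝ} (hk : 0 < k) (hL0 : 0 < L) {v : ℝ → ℝ}
    (hv : ContDiff ℝ ∞ v) (hper : Function.Periodic v L) :
    ∃ V : ℝ → ℝ → ℝ, SmoothAlong univ V ∧ (∀ t, Function.Periodic (fun x => V x t) L) ∧
      (∀ x, V x 0 = v x) ∧
      (∀ x t, 0 ≤ t → dt V x t = k * (dx (dx V) x t - V x t)) ∧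
      ∀ j : ℕ, ∃ C, ∀ x t, 0 ≤ t →
        |iteratedDeriv j (fun y => V y t) x| ≤ C * Real.exp (-k * t) := by
  set ν : ℝ := 2 * Real.pi / L with hν
  have hν0 : 0 < ν := by positivity
  have hL : ν * L = 2 * Real.pi := by rw [hν]; field_simp
  obtain ⟨a, ha, hsum⟩ := exists_fourier_series (f := fun x => (v x : ℂ)) hν0 hL0 hL
    (Complex.ofRealCLM.contDiff.comp hv) (fun x => by simp [hper x])
  have hψ := isHeatProfile_heatProfile
  have hdx : ∀ x t, dx (dx fun x t => (waveSeries k ν a heatProfile x t).re) x t =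
      (waveSeries k ν (fun n => freq ν n ^ 2 * a n) heatProfile x t).re := by
    intro x t
    have := congrFun (iteratedDeriv_re_waveSeries (ν := ν) hk ha hψ 2 t) x
    rw [iteratedDeriv_succ, iteratedDeriv_one] at this
    exact this
  refine ⟨fun x t => (waveSeries k ν a heatProfile x t).re, ?_, ?_, ?_, ?_, ?_⟩
  · rw [smoothAlong_univ_iff]
    exact Complex.reCLM.contDiff.comp
      (contDiff_infty.2 fun n => contDiff_waveSeries (ν := ν) hk n ha hψ)
  · intro t x
    simp only [waveSeries, wave_periodic hL _ x]
  · intro x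
    have : waveSeries k ν a heatProfile x 0 = v x := by
      rw [← (hsum x).tsum_eq]
      simp [waveSeries, heatProfile_eq]
    simp [this]
  · intro x t ht
    rw [hdx]
    have h := hasDerivAt_waveSeries_snd (ν := ν) hk ha hψ x t
    have h2 := (Complex.reCLM.hasFDerivAt.comp_hasDerivAt t h).deriv
    rw [waveSeries_time hk x ht ha] at h2
    change deriv (Complex.reCLM ∘ fun s => waveSeries k ν a heatProfile x s) t = _
    rw [h2]
    simp
  · intro j
    refine ⟨∑' n, ‖freq ν n ^ j * a n‖, fun x t ht => ?_⟩
    rw [iteratedDeriv_re_waveSeries hk ha hψ]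
    exact (Complex.abs_re_le_norm _).trans
      (norm_waveSeries_le hk (rapidDecay_freq_pow ha j) x ht)

/-! ### Fixing the elastic energy by a constant -/

/-- Strict monotonicity of the energy in the radius of curvature is behind the uniqueness of levels,
their stability, and the last step of the uniqueness of the flow. -/
lemma integral_one_div_lt {L : ℝ} (hL : 0 < L) {f g : ℝ → ℝ} (hf : Continuous f)
    (hg : Continuous g) (hf0 : ∀ x, 0 < f x) (hfg : ∀ x, f x < g x) :
    ∫ x in (0 : ℝ)..L, 1 / g x < ∫ x in (0 : ℝ)..L, 1 / f x := by
  have hg0 : ∀ x, 0 < g x := fun x => (hf0 x).trans (hfg x)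
  have h : ∀ x, 1 / g x < 1 / f x := fun x => one_div_lt_one_div_of_lt (hf0 x) (hfg x)
  refine intervalIntegral.integral_lt_integral_of_continuousOn_of_le_of_exists_lt hL
    (continuous_const.div hg fun x => (hg0 x).ne').continuousOn
    (continuous_const.div hf fun x => (hf0 x).ne').continuousOn (fun x _ => (h x).le)
    ⟨0, ⟨le_rfl, hL.le⟩, h 0⟩

lemma exists_min_of_periodic {L : ℝ} (hL : 0 < L) {g : ℝ → ℝ} (hg : Continuous g)
    (hper : Function.Periodic g L) : ∃ x₀, ∀ x, g x₀ ≤ g x := by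
  obtain ⟨x₀, _, hx₀⟩ := isCompact_Icc.exists_isMinOn (nonempty_Icc.2 hL.le) hg.continuousOn
  refine ⟨x₀, fun x => ?_⟩
  obtain ⟨y, hy, hxy⟩ := hper.exists_mem_Ico₀ hL x
  rw [hxy]
  exact hx₀ (Ico_subset_Icc_self hy)

lemma exists_bound_of_periodic {L : ℝ} (hL : 0 < L) {g : ℝ → ℝ} (hg : Continuous g)
    (hper : Function.Periodic g L) : ∃ K, 0 < K ∧ ∀ x, |g x| ≤ K := by
  obtain ⟨K, hK⟩ := (isCompact_Icc (a := (0 : ℝ)) (b := L)).exists_bound_of_continuousOn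
    hg.continuousOn
  refine ⟨|K| + 1, by positivity, fun x => ?_⟩
  obtain ⟨y, hy, hxy⟩ := hper.exists_mem_Ico₀ hL x
  rw [hxy]
  exact (hK y (Ico_subset_Icc_self hy)).trans ((le_abs_self K).trans (by linarith))

/-- The comparison integral for `exists_level`: it tends to infinity as `ε → 0`, so the energy
becomes arbitrarily large as the level approaches the minimum. -/
lemma integral_one_div_linear {K ε L : ℝ} (hK : 0 < K) (hε : 0 < ε) (hL : 0 < L) (a : ℝ) :
    ∫ x in a..(a + L), 1 / (K * (x - a) + ε) = Real.log ((K * L + ε) / ε) / K := by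
  have hd : ∀ x ∈ uIcc a (a + L), HasDerivAt (fun x => Real.log (K * (x - a) + ε) / K)
      (1 / (K * (x - a) + ε)) x := by
    intro x hx
    rw [uIcc_of_le (by linarith)] at hx
    have hpos : 0 < K * (x - a) + ε := by nlinarith [hx.1]
    have h1 : HasDerivAt (fun x => K * (x - a) + ε) K x := by
      simpa using (((hasDerivAt_id x).sub_const a).const_mul K).add_const ε
    refine ((h1.log hpos.ne').div_const K).congr_deriv ?_
    field_simp
  have hc : ContinuousOn (fun x => 1 / (K * (x - a) + ε)) (uIcc a (a + L)) := by
    refine continuousOn_const.div (by fun_prop) fun x hx => ?_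
    rw [uIcc_of_le (by linarith)] at hx
    have : 0 < K * (x - a) + ε := by nlinarith [hx.1]
    exact this.ne'
  rw [intervalIntegral.integral_eq_sub_of_hasDerivAt hd hc.intervalIntegrable]
  rw [Real.log_div (by positivity) hε.ne']
  simp only [add_sub_cancel_left, sub_self, mul_zero, zero_add]
  ring

/-- There is a constant `c < g` with `∫ 1 / (g - c)` prescribed. -/
lemma exists_level {L E : ℝ} (hL : 0 < L) (hE : 0 < E) {g : ℝ → ℝ} (hg : ContDiff ℝ ∞ g)
    (hper : Function.Periodic g L) :
    ∃ c, (∀ x, c < g x) ∧ ∫ x in (0 : ℝ)..L, 1 / (g x - c) = E := by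
  obtain ⟨x₀, hx₀⟩ := exists_min_of_periodic hL hg.continuous hper
  obtain ⟨K, hK, hgK⟩ := exists_bound_of_periodic hL (contDiff_deriv hg).continuous
    (periodic_deriv hper)
  have hlip : ∀ x, x₀ ≤ x → g x - g x₀ ≤ K * (x - x₀) := by
    intro x hx
    have := Convex.norm_image_sub_le_of_norm_deriv_le (f := g) (C := K) (s := univ)
      (fun y _ => (hasDerivAt_of_contDiff hg y).differentiableAt) (fun y _ => hgK y) convex_univ
      (mem_univ x₀) (mem_univ x)
    rw [Real.norm_eq_abs, Real.norm_eq_abs, abs_of_nonneg (sub_nonneg.2 hx)] at this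
    exact (le_abs_self _).trans this
  -- The second bound makes `log ((K L + ε) / ε) / K ≥ E`; the first orders the two trial levels `g
  -- x₀ - L / E` and `g x₀ - ε`.
  set ε : ℝ := min (L / E) (K * L * Real.exp (-(K * E))) with hεdef
  have hε : 0 < ε := lt_min (by positivity) (by positivity)
  have hcont : ∀ c, c < g x₀ → Continuous fun x => 1 / (g x - c) := fun c hc =>
    continuous_const.div (hg.continuous.sub continuous_const) fun x => by linarith [hx₀ x]
  -- At distance `L / E` below the minimum the integrand is at most `E / L`.
  have hlow : ∫ x in (0 : ℝ)..L, 1 / (g x - (g x₀ - L / E)) ≤ E := by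
    have hpos : 0 < L / E := by positivity
    calc ∫ x in (0 : ℝ)..L, 1 / (g x - (g x₀ - L / E)) ≤ ∫ _ in (0 : ℝ)..L, E / L := by
          refine intervalIntegral.integral_mono_on hL.le
            ((hcont _ (by linarith)).intervalIntegrable _ _) intervalIntegrable_const fun x _ => ?_
          rw [← one_div_div L E]
          exact one_div_le_one_div_of_le hpos (by linarith [hx₀ x])
      _ = E := by simp; field_simp
  -- By periodicity the integral may start at the minimum point `x₀`, where `g` grows at most
  -- linearly with slope `K`.
  have hhigh : E ≤ ∫ x in (0 : ℝ)..L, 1 / (g x - (g x₀ - ε)) := by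
    have hp : Function.Periodic (fun x => 1 / (g x - (g x₀ - ε))) L := fun x => by
      simp only [hper x]
    have e := hp.intervalIntegral_add_eq 0 x₀
    rw [zero_add] at e
    rw [e]
    calc E ≤ Real.log ((K * L + ε) / ε) / K := by
          rw [le_div_iff₀ hK, Real.le_log_iff_exp_le (by positivity), le_div_iff₀ hε]
          have h1 : ε ≤ K * L * Real.exp (-(K * E)) := min_le_right _ _
          have h2 : Real.exp (E * K) * ε ≤ Real.exp (E * K) * (K * L * Real.exp (-(K * E))) := by
            gcongr
          have h3 : Real.exp (E * K) * (K * L * Real.exp (-(K * E))) = K * L := by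
            rw [Real.exp_neg, mul_comm E K]; field_simp
          linarith
      _ = ∫ x in x₀..(x₀ + L), 1 / (K * (x - x₀) + ε) := (integral_one_div_linear hK hε hL x₀).symm
      _ ≤ _ := by
          refine intervalIntegral.integral_mono_on (by linarith) ?_
            ((hcont _ (by linarith)).intervalIntegrable _ _) fun x hx => ?_
          · refine ContinuousOn.intervalIntegrable ?_
            refine continuousOn_const.div (by fun_prop) fun x hx => ?_
            rw [uIcc_of_le (by linarith)] at hx
            have : 0 < K * (x - x₀) + ε := by nlinarith [hx.1]
            exact this.ne'
          · exact one_div_le_one_div_of_le (by linarith [hx₀ x]) (by linarith [hlip x hx.1])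
  have hle : g x₀ - L / E ≤ g x₀ - ε := by linarith [min_le_left (L / E) (K * L * Real.exp (-(K * E)))]
  have hF : ContinuousOn (fun c => ∫ x in (0 : ℝ)..L, 1 / (g x - c))
      (Icc (g x₀ - L / E) (g x₀ - ε)) := by
    refine continuousOn_integral_of_continuousOn (F := fun x c => 1 / (g x - c)) ?_ 0 L
    refine continuousOn_const.div ?_ fun q hq => ?_
    · exact ((hg.continuous.comp continuous_fst).sub continuous_snd).continuousOn
    · have := hq.2.2; have := hx₀ q.1; exact (by linarith : 0 < g q.1 - q.2).ne'
  obtain ⟨c, hc, hcE⟩ := intermediate_value_Icc hle hF ⟨hlow, hhigh⟩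
  exact ⟨c, fun x => by linarith [hc.2, hx₀ x], hcE⟩

/-- Compactness of one period turns the pointwise open condition into a uniform one; it gives the
openness of the set of admissible pairs of level and time. -/
lemma eventually_forall_lt_of_periodic {L : ℝ} (hL : 0 < L) {u : ℝ → ℝ → ℝ}
    (hu : SmoothAlong univ u) (hper : ∀ t, Function.Periodic (fun x => u x t) L) {c t : ℝ}
    (h : ∀ x, c < u x t) : ∀ᶠ q : ℝ × ℝ in 𝓝 (c, t), ∀ x, q.1 < u x q.2 := by
  have h1 : ∀ᶠ q : ℝ × ℝ in 𝓝 (c, t), ∀ x ∈ Icc 0 L, q.1 < u x q.2 := by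
    refine isCompact_Icc.eventually_forall_of_forall_eventually fun x _ => ?_
    have hc : Continuous fun z : (ℝ × ℝ) × ℝ => u z.2 z.1.2 :=
      hu.contDiff.continuous.comp (continuous_snd.prodMk (continuous_snd.comp continuous_fst))
    exact (continuous_fst.comp continuous_fst).continuousAt.eventually_lt
      hc.continuousAt (h x)
  filter_upwards [h1] with q hq x
  obtain ⟨y, hy, hxy⟩ := (hper q.2).exists_mem_Ico₀ hL x
  rw [hxy]
  exact hq y (Ico_subset_Icc_self hy)

/-- The level with prescribed energy depends smoothly on time. -/
theorem exists_smooth_level {L E : ℝ} (hL : 0 < L) (hE : 0 < E) {u : ℝ → ℝ → ℝ}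
    (hu : SmoothAlong univ u) (hper : ∀ t, Function.Periodic (fun x => u x t) L) :
    ∃ c : ℝ → ℝ, ContDiff ℝ ∞ c ∧
      ∀ t, (∀ x, c t < u x t) ∧ ∫ x in (0 : ℝ)..L, 1 / (u x t - c t) = E := by
  -- The level is taken as a function of energy and time, although only the energy `E` is needed,
  -- because the inverse function theorem inverts level to energy on a neighbourhood. Its value at
  -- nonpositive energies is irrelevant.
  have hex : ∀ q : ℝ × ℝ, ∃ c, 0 < q.1 →
      (∀ x, c < u x q.2) ∧ ∫ x in (0 : ℝ)..L, 1 / (u x q.2 - c) = q.1 := by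
    intro q
    by_cases hq : 0 < q.1
    · obtain ⟨c, hc⟩ := exists_level hL hq (hu.contDiff_slice (mem_univ q.2)) (hper q.2)
      exact ⟨c, fun _ => hc⟩
    · exact ⟨0, fun h => absurd h hq⟩
  choose g hg using hex
  refine ⟨fun t => g (E, t), ?_, fun t => hg (E, t) hE⟩
  set Ω : Set (ℝ × ℝ) := {q | ∀ x, q.1 < u x q.2} with hΩdef
  have hΩ : IsOpen Ω := isOpen_iff_mem_nhds.2 fun q hq =>
    eventually_forall_lt_of_periodic hL hu hper hq
  have huc : ∀ t, Continuous fun x => u x t := fun t =>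
    (hu.contDiff_slice (mem_univ t)).continuous
  have hΦ : ContDiffOn ℝ ∞ (fun q : ℝ × ℝ => ∫ x in (0 : ℝ)..L, 1 / (u x q.2 - q.1)) Ω := by
    refine contDiffOn_parametric_integral (n := ⊤) (F := fun q x => 1 / (u x q.2 - q.1)) hΩ hL.le ?_
    refine contDiffOn_const.div ?_ fun z hz => ?_
    · refine ContDiff.contDiffOn ?_
      exact (hu.contDiff.comp (contDiff_snd.prodMk (contDiff_snd.comp contDiff_fst))).sub
        (contDiff_fst.comp contDiff_fst)
    · exact (sub_pos.2 (hz.1 z.2)).ne'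
  refine contDiff_iff_contDiffAt.2 fun t => ?_
  have hgE := hg (E, t) hE
  have hmem : (g (E, t), t) ∈ Ω := hgE.1
  set J : Set ℝ := {c | (c, t) ∈ Ω} with hJdef
  have hJ : IsOpen J := hΩ.preimage (continuous_id.prodMk continuous_const)
  have hF : SmoothAlong J fun x c => 1 / (u x t - c) := by
    refine SmoothAlong.div (f := fun _ _ => 1) (fun _ _ _ => contDiffAt_const) ?_ fun x c hc =>
      (sub_pos.2 (hc x)).ne'
    exact (SmoothAlong.of_space (hu.contDiff_slice (mem_univ t))).sub
      (SmoothAlong.of_time (g := id) fun _ _ => contDiffAt_id)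
  have hder := hasDerivAt_integral_of_smoothAlong hJ hF 0 L (t := g (E, t)) hmem
  have hdt : ∀ x, dt (fun x c => 1 / (u x t - c)) x (g (E, t)) = 1 / (u x t - g (E, t)) ^ 2 := by
    intro x
    have h1 : HasDerivAt (fun c => u x t - c) (-1) (g (E, t)) := by
      simpa using (hasDerivAt_id (g (E, t))).const_sub (u x t)
    have h2 := (h1.inv (sub_pos.2 (hgE.1 x)).ne').deriv
    rw [dt]
    simp only [one_div]
    exact h2.trans (by rw [neg_neg, one_div])
  -- Here `dt` differentiates in the level `c`, and `∂_c (1 / (u - c)) = 1 / (u - c)²`.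
  have hpos : 0 < ∫ x in (0 : ℝ)..L, dt (fun x c => 1 / (u x t - c)) x (g (E, t)) := by
    simp only [hdt]
    refine intervalIntegral.intervalIntegral_pos_of_pos (Continuous.intervalIntegrable ?_ _ _)
      (fun x => one_div_pos.2 (pow_pos (sub_pos.2 (hgE.1 x)) 2)) hL
    exact continuous_const.div (((huc t).sub continuous_const).pow 2) fun x =>
      (pow_pos (sub_pos.2 (hgE.1 x)) 2).ne'
  have key := contDiffAt_fibrewise_inverse (g := g) (y := E) (t := t) hΩ
    (hΦ.contDiffAt (hΩ.mem_nhds hmem)) hpos.ne' hder hmem hgE.2 ?_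
  · exact key.comp t (contDiffAt_const.prodMk contDiffAt_id)
  · have hE' : ∀ᶠ q : ℝ × ℝ in 𝓝 (E, t), 0 < q.1 :=
      (continuous_fst.continuousAt (x := (E, t))).eventually (lt_mem_nhds hE)
    filter_upwards [hE'] with q hq x hx hxq
    obtain ⟨h1, h2⟩ := hg q hq
    have hxq' : ∫ y in (0 : ℝ)..L, 1 / (u y q.2 - x) = q.1 := hxq
    have mono : ∀ a b : ℝ, a < b → (∀ y, b < u y q.2) →
        ∫ y in (0 : ℝ)..L, 1 / (u y q.2 - a) < ∫ y in (0 : ℝ)..L, 1 / (u y q.2 - b) :=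
      fun a b hab hb => integral_one_div_lt hL ((huc q.2).sub continuous_const)
        ((huc q.2).sub continuous_const) (fun y => sub_pos.2 (hb y))
        (fun y => sub_lt_sub_left hab (u y q.2))
    rcases lt_trichotomy x (g q) with h | h | h
    · exact absurd (mono _ _ h h1) (by rw [hxq', h2]; exact lt_irrefl _)
    · exact h
    · exact absurd (mono _ _ h hx) (by rw [hxq', h2]; exact lt_irrefl _)

/-! ### The energy along a family of support functions -/

lemma SmoothAlong.rad {J : Set ℝ} (hJ : IsOpen J) {p : ℝ → ℝ → ℝ} (hp : SmoothAlong J p) :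
    SmoothAlong J fun x t => rad (fun y => p y t) x :=
  ((hp.dx hJ).dx hJ).add hp

lemma dt_rad {J : Set ℝ} (hJ : IsOpen J) {p : ℝ → ℝ → ℝ} (hp : SmoothAlong J p) {x t : ℝ}
    (ht : t ∈ J) :
    dt (fun x t => rad (fun y => p y t) x) x t = rad (fun y => dt p y t) x := by
  have h1 := ((hp.dx hJ).dx hJ).hasDerivAt_dt ht (x := x)
  have h2 := hp.hasDerivAt_dt ht (x := x)
  have e : (fun y => dt (dx p) y t) = fun y => dx (dt p) y t := by
    funext y; exact hp.dt_dx hJ ht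
  have e1 : dt (dx (dx p)) x t = dx (dx (dt p)) x t := by
    rw [(hp.dx hJ).dt_dx hJ ht]
    change deriv (fun y => dt (dx p) y t) x = _
    rw [e]; rfl
  rw [e1] at h1
  exact (h1.add h2).deriv

/-- Differentiating `1 / ρ` gives `-κ² ρ_t`, and `ρ_t` is the radius expression of `p_t` because
space and time derivatives commute. -/
lemma hasDerivAt_energy {J : Set ℝ} (hJ : IsOpen J) {p : ℝ → ℝ → ℝ} (hp : SmoothAlong J p)
    (hpos : ∀ x, ∀ t ∈ J, 0 < rad (fun y => p y t) x) (L : ℝ) {t : ℝ} (ht : t ∈ J) :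
    HasDerivAt (fun s => ∫ x in (0 : ℝ)..L, 1 / rad (fun y => p y s) x)
      (-∫ x in (0 : ℝ)..L, (1 / rad (fun y => p y t) x) ^ 2 * rad (fun y => dt p y t) x) t := by
  have hF : SmoothAlong J fun x s => 1 / rad (fun y => p y s) x :=
    SmoothAlong.div (f := fun _ _ => 1) (fun _ _ _ => contDiffAt_const) (hp.rad hJ)
      fun x s hs => (hpos x s hs).ne'
  refine (hasDerivAt_integral_of_smoothAlong hJ hF 0 L ht).congr_deriv ?_
  rw [← intervalIntegral.integral_neg]
  congr 1
  funext x
  have h1 := (hp.rad hJ).hasDerivAt_dt ht (x := x)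
  have h2 := (h1.inv (hpos x t ht).ne').deriv
  rw [dt_rad hJ hp ht] at h2
  rw [dt]
  simp only [one_div]
  refine h2.trans ?_
  field_simp

lemma rad_heat {w : ℝ → ℝ} (hw : ContDiff ℝ ∞ w) (b x : ℝ) :
    rad (fun y => deriv (deriv w) y - w y - b) x =
      deriv (deriv (rad w)) x - rad w x - b := by
  have d := fun {f : ℝ → ℝ} (hf : ContDiff ℝ ∞ f) => hasDerivAt_of_contDiff hf
  have h1 := contDiff_deriv hw
  have h2 := contDiff_deriv h1
  have h3 := contDiff_deriv h2
  have e1 : deriv (fun y => deriv (deriv w) y - w y - b) =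
      fun y => deriv (deriv (deriv w)) y - deriv w y :=
    funext fun y => (((d h2 y).sub (d hw y)).sub_const b).deriv
  have e2 : deriv (fun y => deriv (deriv (deriv w)) y - deriv w y) =
      fun y => deriv (deriv (deriv (deriv w))) y - deriv (deriv w) y :=
    funext fun y => ((d h3 y).sub (d h1 y)).deriv
  have e3 : deriv (rad w) = fun y => deriv (deriv (deriv w)) y + deriv w y :=
    funext fun y => ((d h2 y).add (d hw y)).deriv
  have e4 : deriv (fun y => deriv (deriv (deriv w)) y + deriv w y) =
      fun y => deriv (deriv (deriv (deriv w))) y + deriv (deriv w) y :=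
    funext fun y => ((d h3 y).add (d h1 y)).deriv
  rw [e3, e4]
  simp only [rad, e1, e2]
  ring

/-- For a flow of support functions `p_t = w'' - w - b`, with `w` the width, the energy is
stationary exactly if `b` is the nonlocal term. -/
lemma energy_stationary_iff {m k : ℕ} (hm : 0 < m) {p : ℝ → ℝ → ℝ} {t b : ℝ}
    (hp : ContDiff ℝ ∞ fun y => p y t) (hpos : ∀ x, 0 < rad (fun y => p y t) x)
    (heq : ∀ x, dt p x t = deriv (deriv (shiftSum m k fun y => p y t)) x -
      shiftSum m k (fun y => p y t) x - b) :
    (-∫ x in (0 : ℝ)..(2 * m * Real.pi),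
      (1 / rad (fun y => p y t) x) ^ 2 * rad (fun y => dt p y t) x) = 0 ↔
      nonlocalTerm m k (curveOf fun y => p y t) = b := by
  rw [nonlocalTerm_curveOf_iff hm hp hpos, neg_eq_zero]
  have : (fun y => dt p y t) = fun y => deriv (deriv (shiftSum m k fun y => p y t)) y -
      shiftSum m k (fun y => p y t) y - b := funext heq
  simp only [this, rad_heat (contDiff_shiftSum hp)]

/-! ### The flow of support functions -/

/-- If `a` exceeded `b` by more than the distance of `f` and `g`, then `f - a < g - b` everywhere
and the integrals could not agree. With `ε = 0` this is uniqueness of the level; with an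
exponentially small `ε` it gives convergence. -/
lemma abs_level_sub_le {L : ℝ} (hL : 0 < L) {f g : ℝ → ℝ} (hf : Continuous f) (hg : Continuous g)
    {a b ε : ℝ} (hfa : ∀ x, a < f x) (hgb : ∀ x, b < g x)
    (heq : ∫ x in (0 : ℝ)..L, 1 / (f x - a) = ∫ x in (0 : ℝ)..L, 1 / (g x - b))
    (hfg : ∀ x, |f x - g x| ≤ ε) : |a - b| ≤ ε := by
  by_contra! h
  rcases lt_abs.1 h with h | h
  · have := integral_one_div_lt hL (hf.sub continuous_const) (hg.sub continuous_const)
      (fun x => sub_pos.2 (hfa x)) (fun x => by linarith [(abs_le.1 (hfg x)).2] :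
        ∀ x, f x - a < g x - b)
    exact this.ne heq.symm
  · have := integral_one_div_lt hL (hg.sub continuous_const) (hf.sub continuous_const)
      (fun x => sub_pos.2 (hgb x)) (fun x => by linarith [(abs_le.1 (hfg x)).1] :
        ∀ x, g x - b < f x - a)
    exact this.ne heq

lemma rad_affine {p V w : ℝ → ℝ} (hp : ContDiff ℝ ∞ p) (hV : ContDiff ℝ ∞ V)
    (hw : ContDiff ℝ ∞ w) (k c x : ℝ) :
    rad (fun y => p y + (V y - w y) / k - c) x = rad p x + (rad V x - rad w x) / k - c := by
  have d := fun {f : ℝ → ℝ} (hf : ContDiff ℝ ∞ f) => hasDerivAt_of_contDiff hf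
  have e1 : deriv (fun y => p y + (V y - w y) / k - c) =
      fun y => deriv p y + (deriv V y - deriv w y) / k :=
    funext fun y => (((d hp y).add (((d hV y).sub (d hw y)).div_const k)).sub_const c).deriv
  have e2 : deriv (fun y => deriv p y + (deriv V y - deriv w y) / k) =
      fun y => deriv (deriv p) y + (deriv (deriv V) y - deriv (deriv w) y) / k :=
    funext fun y => ((d (contDiff_deriv hp) y).add
      (((d (contDiff_deriv hV) y).sub (d (contDiff_deriv hw) y)).div_const k)).deriv
  simp only [rad, e1, e2]
  ring

/-- Long-time existence and exponential convergence for the support functions. -/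
theorem exists_support_flow {m k : ℕ} (hm : 0 < m) (hk : 0 < k) {p₀ : ℝ → ℝ}
    (hp₀ : ContDiff ℝ ∞ p₀) (hper₀ : Function.Periodic p₀ (2 * m * Real.pi))
    (hpos₀ : ∀ x, 0 < rad p₀ x) :
    ∃ (p : ℝ → ℝ → ℝ) (c : ℝ), SmoothAlong univ p ∧
      (∀ t, Function.Periodic (fun x => p x t) (2 * m * Real.pi)) ∧
      (∀ x t, 0 < rad (fun y => p y t) x) ∧
      (∀ x, p x 0 = p₀ x) ∧
      (∀ t, ∫ x in (0 : ℝ)..(2 * m * Real.pi), 1 / rad (fun y => p y t) x =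
        ∫ x in (0 : ℝ)..(2 * m * Real.pi), 1 / rad p₀ x) ∧
      (∀ x t, 0 ≤ t → dt p x t = -speed m k (curveOf fun y => p y t) x) ∧
      (∀ x, 0 < rad (fun y => p₀ y - shiftSum m k p₀ y / k - c) x) ∧
      ∀ j : ℕ, ∃ D, ∀ x t, 0 ≤ t →
        |iteratedDeriv j (fun y => p y t - (p₀ y - shiftSum m k p₀ y / k - c)) x| ≤
          D * Real.exp (-k * t) := by
  have hk' : (0 : ℝ) < k := by exact_mod_cast hk
  have hL : (0 : ℝ) < 2 * m * Real.pi := by positivity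
  set w := shiftSum m k p₀ with hwdef
  have hw : ContDiff ℝ ∞ w := contDiff_shiftSum hp₀
  have hwper : Function.Periodic w (2 * m * Real.pi / k) := shiftSum_periodic hk hper₀
  have hwper' : Function.Periodic w (2 * m * Real.pi) := periodic_of_periodic_div hk hwper
  -- `V` is the width up to the spatial constant `k c(t)`, which carries the whole effect of the
  -- nonlocal term.
  obtain ⟨V, hV, hVper, hV0, hVt, hVj⟩ := exists_heat_solution hk'
    (show (0 : ℝ) < 2 * m * Real.pi / k by positivity) hw hwper
  have hVs : ∀ t, ContDiff ℝ ∞ fun x => V x t := fun t => hV.contDiff_slice (mem_univ t)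
  have hVper' : ∀ t, Function.Periodic (fun x => V x t) (2 * m * Real.pi) := fun t =>
    periodic_of_periodic_div hk (hVper t)
  set E := ∫ x in (0 : ℝ)..(2 * m * Real.pi), 1 / rad p₀ x with hEdef
  have hρ₀ := (contDiff_rad hp₀).continuous
  have hE : 0 < E := intervalIntegral.intervalIntegral_pos_of_pos
    ((continuous_const.div hρ₀ fun x => (hpos₀ x).ne').intervalIntegrable _ _)
    (fun x => one_div_pos.2 (hpos₀ x)) hL
  set u : ℝ → ℝ → ℝ := fun x t => rad p₀ x + (rad (fun y => V y t) x - rad w x) / k with hudef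
  have hu : SmoothAlong univ u := by
    have h1 : SmoothAlong univ fun x t => (rad (fun y => V y t) x - rad w x) / k :=
      ((hV.rad isOpen_univ).sub (SmoothAlong.of_space (contDiff_rad hw))).div
        (g := fun _ _ => (k : ℝ)) (fun _ _ _ => contDiffAt_const) fun _ _ _ => hk'.ne'
    exact (SmoothAlong.of_space (contDiff_rad hp₀)).add h1
  have huper : ∀ t, Function.Periodic (fun x => u x t) (2 * m * Real.pi) := fun t x => by
    simp only [hudef, periodic_rad hper₀ x, periodic_rad (hVper' t) x, periodic_rad hwper' x]
  -- The radius will be `u - c`; the choice of `c` keeps the energy at its initial value `E` and the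
  -- radius positive.
  obtain ⟨c, hc, hcu⟩ := exists_smooth_level hL hE hu huper
  have huinf : ContDiff ℝ ∞ fun x => rad p₀ x - rad w x / k :=
    (contDiff_rad hp₀).sub ((contDiff_rad hw).div_const _)
  -- The level of the limit: `V` tends to zero, so `u` tends to `rad p₀ - rad w / k`.
  obtain ⟨c', hc', hc'E⟩ := exists_level hL hE huinf (fun x => by
    simp only [periodic_rad hper₀ x, periodic_rad hwper' x])
  set p : ℝ → ℝ → ℝ := fun x t => p₀ x + (V x t - w x) / k - c t with hpdef
  have hp : SmoothAlong univ p := by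
    have h1 : SmoothAlong univ fun x t => (V x t - w x) / k :=
      (hV.sub (SmoothAlong.of_space hw)).div
        (g := fun _ _ => (k : ℝ)) (fun _ _ _ => contDiffAt_const) fun _ _ _ => hk'.ne'
    exact ((SmoothAlong.of_space hp₀).add h1).sub (SmoothAlong.of_time fun t _ => hc.contDiffAt)
  have hrad : ∀ x t, rad (fun y => p y t) x = u x t - c t := fun x t =>
    rad_affine hp₀ (hVs t) hw k (c t) x
  have hpos : ∀ x t, 0 < rad (fun y => p y t) x := fun x t => by
    rw [hrad]; exact sub_pos.2 ((hcu t).1 x)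
  have hps : ∀ t, ContDiff ℝ ∞ fun y => p y t := fun t => hp.contDiff_slice (mem_univ t)
  have hener : ∀ t, ∫ x in (0 : ℝ)..(2 * m * Real.pi), 1 / rad (fun y => p y t) x = E := fun t => by
    simp only [hrad]; exact (hcu t).2
  have huc : ∀ t, Continuous fun x => u x t := fun t => (hu.contDiff_slice (mem_univ t)).continuous
  have hVfun0 : (fun y => V y 0) = w := funext hV0
  -- At time zero `u` is the initial radius, for which the level `0` already has energy `E`.
  have hc0 : c 0 = 0 := by
    have := abs_level_sub_le (ε := 0) hL (huc 0) hρ₀ (hcu 0).1 hpos₀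
      (by rw [(hcu 0).2]; simp only [sub_zero]; exact hEdef)
      (fun x => by simp [hudef, hVfun0])
    simpa using abs_nonpos_iff.1 this
  have hradinf : ∀ x, rad (fun y => p₀ y - w y / k - c') x = rad p₀ x - rad w x / k - c' := by
    intro x
    have h0 : ContDiff ℝ ∞ fun _ : ℝ => (0 : ℝ) := contDiff_const
    have := rad_affine hp₀ h0 hw k c' x
    have e : rad (fun _ : ℝ => (0 : ℝ)) x = 0 := by simp [rad]
    rw [e] at this
    rw [show (fun y => p₀ y - w y / k - c') = fun y => p₀ y + (0 - w y) / k - c' by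
      funext y; ring, this]
    ring
  refine ⟨p, c', hp, ?_, hpos, ?_, hener, ?_, ?_, ?_⟩
  · intro t x
    simp only [hpdef, hper₀ x, hVper' t x, hwper' x]
  · intro x
    simp [hpdef, hV0, hc0]
  · intro x t ht
    have hwid : shiftSum m k (fun y => p y t) = fun y => V y t - k * c t := by
      have e1 : (fun y => p y t) = fun y => (p₀ y + (V y t - w y) / k) - c t := rfl
      have hper2 : Function.Periodic (fun y => (V y t - w y) / k) (2 * m * Real.pi / k) :=
        fun y => by simp only [hVper t y, hwper y]
      rw [e1, shiftSum_sub, shiftSum_add, shiftSum_const, shiftSum_of_periodic hper2]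
      funext y
      rw [← hwdef]
      field_simp
      ring
    have hwid2 : deriv (deriv (shiftSum m k fun y => p y t)) = fun y => dx (dx V) y t := by
      rw [hwid]
      have : deriv (fun y => V y t - k * c t) = fun y => dx V y t :=
        funext fun y => deriv_sub_const _
      rw [this]
      rfl
    -- The width is `V - k c`, so `p_t = V'' - V - c'` equals `w'' - w - (c' + k c)`.
    have hdt : ∀ x, dt p x t = deriv (deriv (shiftSum m k fun y => p y t)) x -
        shiftSum m k (fun y => p y t) x - (deriv c t + k * c t) := by
      intro x
      have h1 := (((hV.hasDerivAt_dt (mem_univ t) (x := x)).sub_const (w x)).div_const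
        (k : ℝ)).const_add (p₀ x)
      have h2 := (h1.sub (hasDerivAt_of_contDiff hc t)).deriv
      rw [dt, hwid2, hwid]
      refine h2.trans ?_
      rw [hVt x t ht]
      field_simp
      ring
    -- The energy is constant by the choice of `c`; its vanishing derivative then identifies `c' + k
    -- c` with the nonlocal term.
    have h3 : (-∫ x in (0 : ℝ)..(2 * m * Real.pi),
        (1 / rad (fun y => p y t) x) ^ 2 * rad (fun y => dt p y t) x) = 0 := by
      refine (hasDerivAt_energy isOpen_univ hp (fun x t _ => hpos x t) (2 * m * Real.pi)
        (mem_univ t)).unique ?_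
      simp only [hener]
      exact hasDerivAt_const t E
    have h4 := (energy_stationary_iff (m := m) (k := k) hm (hps t) (fun x => hpos x t) hdt).1 h3
    rw [speed_curveOf (hps t) (fun x => hpos x t), h4, hdt x]
    ring
  · intro x
    rw [hradinf]
    exact sub_pos.2 (hc' x)
  · obtain ⟨C₀, hC₀⟩ := hVj 0
    obtain ⟨C₂, hC₂⟩ := hVj 2
    have hcc : ∀ t, 0 ≤ t → |c t - c'| ≤ (C₂ + C₀) / k * Real.exp (-k * t) := by
      intro t ht
      refine abs_level_sub_le hL (huc t) huinf.continuous (hcu t).1 hc'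
        ((hcu t).2.trans hc'E.symm) fun x => ?_
      have e : u x t - (rad p₀ x - rad w x / k) = rad (fun y => V y t) x / k := by
        simp only [hudef]; ring
      have h0 := hC₀ x t ht
      have h2 := hC₂ x t ht
      rw [iteratedDeriv_zero] at h0
      rw [iteratedDeriv_succ, iteratedDeriv_one] at h2
      rw [e, abs_div, abs_of_pos hk', div_mul_eq_mul_div]
      gcongr
      rw [rad, add_mul]
      exact (abs_add_le _ _).trans (add_le_add h2 h0)
    have hdiff : ∀ t, (fun y => p y t - (p₀ y - w y / k - c')) =
        fun y => (k : ℝ)⁻¹ * V y t - (c t - c') := by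
      intro t; funext y; simp only [hpdef]; field_simp; ring
    intro j
    -- The difference of levels `c t - c'` enters only at order zero; every derivative removes it.
    rcases j with _ | j
    · refine ⟨C₀ / k + (C₂ + C₀) / k, fun x t ht => ?_⟩
      rw [hdiff, iteratedDeriv_zero, add_mul]
      have h0 := hC₀ x t ht
      rw [iteratedDeriv_zero] at h0
      refine (abs_sub _ _).trans (add_le_add ?_ (hcc t ht))
      rw [abs_mul, abs_inv, abs_of_pos hk', div_mul_eq_mul_div, ← div_eq_inv_mul]
      gcongr
    · obtain ⟨C, hC⟩ := hVj (j + 1)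
      refine ⟨C / k, fun x t ht => ?_⟩
      have e : deriv (fun y => (k : ℝ)⁻¹ * V y t - (c t - c')) =
          fun y => (k : ℝ)⁻¹ * deriv (fun y => V y t) y :=
        funext fun y => (((hasDerivAt_of_contDiff (hVs t) y).const_mul _).sub_const _).deriv
      have h1 := hC x t ht
      rw [iteratedDeriv_succ'] at h1
      rw [hdiff, iteratedDeriv_succ', e, iteratedDeriv_const_mul_field, abs_mul, abs_inv,
        abs_of_pos hk', div_mul_eq_mul_div, ← div_eq_inv_mul]
      gcongr

/-! ### Periodic scalar differential equations -/

lemma exists_bound_on_Icc {L : ℝ} (hL : 0 < L) {F : ℝ → ℝ → ℝ}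
    (hF : Continuous fun q : ℝ × ℝ => F q.1 q.2)
    (hper : ∀ t, Function.Periodic (fun x => F x t) L) (T : ℝ) :
    ∃ B : ℝ, 0 ≤ B ∧ ∀ t ∈ Icc (-T) T, ∀ x, |F x t| ≤ B := by
  obtain ⟨B, hB⟩ := ((isCompact_Icc (a := (0 : ℝ)) (b := L)).prod
    (isCompact_Icc (a := -T) (b := T))).exists_bound_of_continuousOn hF.continuousOn
  refine ⟨|B|, abs_nonneg B, fun t ht x => ?_⟩
  obtain ⟨y, hy, hxy⟩ := (hper t).exists_mem_Ico₀ hL x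
  rw [hxy]
  exact (hB (y, t) ⟨Ico_subset_Icc_self hy, ht⟩).trans (le_abs_self B)

section ODE

variable {L : ℝ} {v : ℝ → ℝ → ℝ}

lemma exists_lipschitz_on_Icc (hL : 0 < L) (hv : SmoothAlong univ v)
    (hper : ∀ t, Function.Periodic (fun x => v x t) L) (T : ℝ) :
    ∃ K : NNReal, ∀ t ∈ Icc (-T) T, LipschitzWith K fun x => v x t := by
  obtain ⟨K, hK0, hK⟩ := exists_bound_on_Icc hL (hv.dx isOpen_univ).contDiff.continuous
    (fun t => periodic_deriv (hper t)) T
  refine ⟨⟨K, hK0⟩, fun t ht => lipschitzWith_of_nnnorm_deriv_le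
    (fun x => (hv.hasDerivAt_dx (mem_univ t)).differentiableAt) fun x => ?_⟩
  exact hK t ht x

lemma exists_solution_on_Icc (hL : 0 < L) (hv : SmoothAlong univ v)
    (hper : ∀ t, Function.Periodic (fun x => v x t) L) (u : ℝ) {T : ℝ} (hT : 0 ≤ T) :
    ∃ y : ℝ → ℝ, y 0 = u ∧ ∀ t ∈ Ioo (-T) T, HasDerivAt y (v (y t) t) t := by
  obtain ⟨B, hB0, hB⟩ := exists_bound_on_Icc hL hv.contDiff.continuous hper T
  obtain ⟨K, hK⟩ := exists_lipschitz_on_Icc hL hv hper T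
  -- A field bounded by `B` moves a point by at most `B * T` in time `T`, so a ball of this radius
  -- confines the solution on the whole interval.
  have hPL : IsPicardLindelof (fun t x => v x t) (tmin := -T) (tmax := T)
      ⟨0, by constructor <;> linarith⟩ u ⟨B * T, by positivity⟩ 0 ⟨B, hB0⟩ K :=
    { lipschitzOnWith := fun t ht => (hK t ht).lipschitzOnWith
      continuousOn := fun x _ => (hv.contDiff.continuous.comp
        (continuous_const.prodMk continuous_id)).continuousOn
      norm_le := fun t ht x _ => hB t ht x
      mul_max_le := by simp; exact le_rfl }
  obtain ⟨y, hy0, hy⟩ := hPL.exists_eq_forall_mem_Icc_hasDerivWithinAt₀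
  exact ⟨y, hy0, fun t ht => (hy t (Ioo_subset_Icc_self ht)).hasDerivAt (Icc_mem_nhds ht.1 ht.2)⟩

lemma exists_global_solution (hL : 0 < L) (hv : SmoothAlong univ v)
    (hper : ∀ t, Function.Periodic (fun x => v x t) L) (u : ℝ) :
    ∃ y : ℝ → ℝ, y 0 = u ∧ ∀ t, HasDerivAt y (v (y t) t) t := by
  have hex : ∀ n : ℕ, ∃ y : ℝ → ℝ, y 0 = u ∧
      ∀ t ∈ Ioo (-(n + 1 : ℝ)) (n + 1), HasDerivAt y (v (y t) t) t :=
    fun n => exists_solution_on_Icc hL hv hper u (by positivity)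
  choose y hy0 hy using hex
  have heq : ∀ n n' : ℕ, n ≤ n' → EqOn (y n) (y n') (Ioo (-(n + 1 : ℝ)) (n + 1)) := by
    intro n n' hn
    have hn' : (n : ℝ) ≤ n' := by exact_mod_cast hn
    obtain ⟨K, hK⟩ := exists_lipschitz_on_Icc hL hv hper (n + 1)
    refine ODE_solution_unique_of_mem_Ioo (v := fun t x => v x t) (s := fun _ => univ) (K := K)
      (t₀ := 0) (fun t ht => (hK t (Ioo_subset_Icc_self ht)).lipschitzOnWith)
      ⟨by linarith [(Nat.cast_nonneg n : (0 : ℝ) ≤ n)], by positivity⟩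
      (fun t ht => ⟨hy n t ht, trivial⟩)
      (fun t ht => ⟨hy n' t ⟨by linarith [ht.1], by linarith [ht.2]⟩, trivial⟩) ?_
    rw [hy0, hy0]
  have hloc : ∀ n : ℕ, ∀ t ∈ Ioo (-(n + 1 : ℝ)) (n + 1), y ⌈|t|⌉₊ t = y n t := by
    intro n t ht
    have h1 : t ∈ Ioo (-((⌈|t|⌉₊ : ℝ) + 1)) (⌈|t|⌉₊ + 1) := by
      have := Nat.le_ceil |t|
      rw [mem_Ioo, ← abs_lt]; linarith
    rcases le_total ⌈|t|⌉₊ n with h | h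
    · exact heq _ _ h h1
    · exact (heq _ _ h ht).symm
  -- The solution with index `⌈|t|⌉₊` lives on an interval larger by one on each side, hence on a
  -- neighbourhood of `t`.
  refine ⟨fun t => y ⌈|t|⌉₊ t, by simp [hy0], fun t => ?_⟩
  have hmem : t ∈ Ioo (-((⌈|t|⌉₊ : ℝ) + 1)) (⌈|t|⌉₊ + 1) := by
    have := Nat.le_ceil |t|
    rw [mem_Ioo, ← abs_lt]; linarith
  refine (hy _ t hmem).congr_of_eventuallyEq ?_
  filter_upwards [Ioo_mem_nhds hmem.1 hmem.2] with s hs using hloc _ s hs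

/-- The difference quotient of `v` in its first variable. -/
def diffQuot (v : ℝ → ℝ → ℝ) (x y t : ℝ) : ℝ := ∫ r in (0 : ℝ)..1, dx v (y + r * (x - y)) t

lemma continuous_diffQuot (hv : SmoothAlong univ v) :
    Continuous fun q : ℝ × ℝ × ℝ => diffQuot v q.1 q.2.1 q.2.2 := by
  have h : Continuous (Function.uncurry fun (q : ℝ × ℝ × ℝ) (r : ℝ) =>
      dx v (q.2.1 + r * (q.1 - q.2.1)) q.2.2) :=
    (hv.dx isOpen_univ).contDiff.continuous.comp (by fun_prop :
      Continuous fun z : (ℝ × ℝ × ℝ) × ℝ => (z.1.2.1 + z.2 * (z.1.1 - z.1.2.1), z.1.2.2))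
  exact intervalIntegral.continuous_parametric_intervalIntegral_of_continuous' h 0 1

lemma diffQuot_mul (hv : SmoothAlong univ v) (x y t : ℝ) :
    v x t - v y t = diffQuot v x y t * (x - y) := by
  have hd : ∀ r ∈ uIcc (0 : ℝ) 1, HasDerivAt (fun r => v (y + r * (x - y)) t)
      (dx v (y + r * (x - y)) t * (x - y)) r := by
    intro r _
    have h1 : HasDerivAt (fun r => y + r * (x - y)) (x - y) r := by
      simpa using ((hasDerivAt_id r).mul_const (x - y)).const_add y
    exact (hv.hasDerivAt_dx (mem_univ t)).comp r h1
  have hc : Continuous fun r => dx v (y + r * (x - y)) t * (x - y) := by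
    refine Continuous.mul ?_ continuous_const
    exact (hv.dx isOpen_univ).contDiff.continuous.comp (by fun_prop :
      Continuous fun r : ℝ => (y + r * (x - y), t))
  have := intervalIntegral.integral_eq_sub_of_hasDerivAt hd (hc.intervalIntegrable _ _)
  rw [intervalIntegral.integral_mul_const] at this
  rw [diffQuot, this]
  simp

lemma diffQuot_self (v : ℝ → ℝ → ℝ) (x t : ℝ) : diffQuot v x x t = dx v x t := by
  simp [diffQuot]

/-- The difference of two solutions of a scalar differential equation. -/
lemma sub_eq_mul_exp (hv : SmoothAlong univ v) {y z : ℝ → ℝ}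
    (hy : ∀ t, HasDerivAt y (v (y t) t) t) (hz : ∀ t, HasDerivAt z (v (z t) t) t) (t : ℝ) :
    y t - z t = (y 0 - z 0) * Real.exp (∫ s in (0 : ℝ)..t, diffQuot v (y s) (z s) s) := by
  have hyc : Continuous y := continuous_iff_continuousAt.2 fun t => (hy t).continuousAt
  have hzc : Continuous z := continuous_iff_continuousAt.2 fun t => (hz t).continuousAt
  have hq : Continuous fun s => diffQuot v (y s) (z s) s :=
    (continuous_diffQuot hv).comp (hyc.prodMk (hzc.prodMk continuous_id))
  set I : ℝ → ℝ := fun t => ∫ s in (0 : ℝ)..t, diffQuot v (y s) (z s) s with hI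
  have hId : ∀ t, HasDerivAt I (diffQuot v (y t) (z t) t) t := fun t =>
    intervalIntegral.integral_hasDerivAt_right (hq.intervalIntegrable _ _)
      (hq.stronglyMeasurableAtFilter _ _) hq.continuousAt
  have hd : ∀ t, HasDerivAt (fun t => (y t - z t) * Real.exp (-I t)) 0 t := by
    intro t
    refine (((hy t).sub (hz t)).mul (hId t).neg.exp).congr_deriv ?_
    rw [diffQuot_mul hv]
    simp only [Pi.sub_apply, Pi.neg_apply]
    ring
  have hconst := is_const_of_deriv_eq_zero (fun t => (hd t).differentiableAt)
    (fun t => (hd t).deriv) t 0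
  have hI0 : I 0 = 0 := by simp [hI]
  simp only [hI0, neg_zero, Real.exp_zero, mul_one] at hconst
  rw [← hconst, mul_assoc, ← Real.exp_add]
  simp [hI]

lemma abs_diffQuot_le {K : ℝ} {t : ℝ} (hK : ∀ x, |dx v x t| ≤ K) (x y : ℝ) :
    |diffQuot v x y t| ≤ K := by
  have := intervalIntegral.norm_integral_le_of_norm_le_const (a := 0) (b := 1) (C := K)
    (f := fun r => dx v (y + r * (x - y)) t) (fun r _ => hK _)
  rw [sub_zero, abs_one, mul_one] at this
  exact this

/-- The flow of a smooth periodic vector field on the line is smooth. -/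
theorem exists_smooth_flow (hL : 0 < L) (hv : SmoothAlong univ v)
    (hper : ∀ t, Function.Periodic (fun x => v x t) L) :
    ∃ θ : ℝ → ℝ → ℝ, SmoothAlong univ θ ∧ (∀ u, θ u 0 = u) ∧
      (∀ u t, HasDerivAt (fun s => θ u s) (v (θ u t) t) t) ∧ (∀ u t, 0 < dx θ u t) ∧
      ∀ u t, θ (u + L) t = θ u t + L := by
  choose θ hθ0 hθ using exists_global_solution hL hv hper
  -- This exact formula gives Lipschitz dependence on the initial point, the derivative in `u` as a
  -- limit of slopes, and its positivity.
  have hsub : ∀ u u' t, θ u t - θ u' t =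
      (u - u') * Real.exp (∫ s in (0 : ℝ)..t, diffQuot v (θ u s) (θ u' s) s) := fun u u' t => by
    have := sub_eq_mul_exp hv (hθ u) (hθ u') t
    rwa [hθ0, hθ0] at this
  have hlip : ∀ T : ℝ, 0 ≤ T → ∃ C : ℝ, 0 ≤ C ∧
      ∀ t ∈ Icc (-T) T, ∀ u u', |θ u t - θ u' t| ≤ C * |u - u'| := by
    intro T hT
    obtain ⟨K, hK0, hK⟩ := exists_bound_on_Icc hL (hv.dx isOpen_univ).contDiff.continuous
      (fun t => periodic_deriv (hper t)) T
    refine ⟨Real.exp (K * T), (Real.exp_pos _).le, fun t ht u u' => ?_⟩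
    rw [hsub, abs_mul, mul_comm, abs_of_pos (Real.exp_pos _)]
    gcongr
    have htT : |t - 0| ≤ T := by rw [sub_zero]; exact abs_le.2 ht
    have := intervalIntegral.norm_integral_le_of_norm_le_const (a := 0) (b := t) (C := K)
      (f := fun s => diffQuot v (θ u s) (θ u' s) s) (fun s hs => abs_diffQuot_le (hK s (by
        have := uIoc_subset_uIcc hs
        rw [mem_Icc, ← abs_le]
        have h2 := abs_sub_left_of_mem_uIcc this
        rw [sub_zero] at h2
        exact h2.trans htT)) _ _)
    calc _ ≤ |∫ s in (0 : ℝ)..t, diffQuot v (θ u s) (θ u' s) s| := le_abs_self _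
      _ ≤ K * |t - 0| := this
      _ ≤ K * T := by gcongr
  have hcont : Continuous fun q : ℝ × ℝ => θ q.1 q.2 := by
    refine continuous_iff_continuousAt.2 fun ⟨u, t⟩ => ?_
    obtain ⟨C, hC0, hC⟩ := hlip (|t| + 1) (by positivity)
    rw [ContinuousAt, tendsto_iff_norm_sub_tendsto_zero]
    have hb : Tendsto (fun q : ℝ × ℝ => C * |q.1 - u| + |θ u q.2 - θ u t|) (𝓝 (u, t)) (𝓝 0) := by
      have h1 : Continuous fun q : ℝ × ℝ => C * |q.1 - u| := by fun_prop
      have h2 : ContinuousAt (fun q : ℝ × ℝ => |θ u q.2 - θ u t|) (u, t) := by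
        have : ContinuousAt (fun q : ℝ × ℝ => θ u q.2) (u, t) :=
          ContinuousAt.comp (f := Prod.snd) (hθ u t).continuousAt continuousAt_snd
        exact (this.sub continuousAt_const).abs
      have := (h1.continuousAt (x := (u, t))).add h2
      rw [ContinuousAt] at this
      simp only [Pi.add_apply, sub_self, abs_zero, mul_zero, add_zero] at this
      exact this
    refine squeeze_zero' (.of_forall fun _ => norm_nonneg _) ?_ hb
    have hnear : ∀ᶠ q : ℝ × ℝ in 𝓝 (u, t), q.2 ∈ Icc (-(|t| + 1)) (|t| + 1) := by
      refine continuousAt_snd.eventually (Icc_mem_nhds ?_ ?_)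
      · linarith [neg_abs_le t]
      · linarith [le_abs_self t]
    filter_upwards [hnear] with q hq
    calc ‖θ q.1 q.2 - θ u t‖ = |(θ q.1 q.2 - θ u q.2) + (θ u q.2 - θ u t)| := by
          rw [Real.norm_eq_abs]; congr 1; ring
      _ ≤ |θ q.1 q.2 - θ u q.2| + |θ u q.2 - θ u t| := abs_add_le _ _
      _ ≤ _ := by gcongr; exact hC _ hq _ _
  have hdxv := (hv.dx isOpen_univ).contDiff
  set A : ℝ → ℝ → ℝ := fun u t => Real.exp (∫ s in (0 : ℝ)..t, dx v (θ u s) s) with hA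
  have hdu : ∀ u t, HasDerivAt (fun u => θ u t) (A u t) u := by
    intro u t
    rw [hasDerivAt_iff_tendsto_slope]
    have hc : Continuous fun u' => Real.exp (∫ s in (0 : ℝ)..t, diffQuot v (θ u' s) (θ u s) s) := by
      refine Real.continuous_exp.comp ?_
      refine intervalIntegral.continuous_parametric_intervalIntegral_of_continuous'
        (f := fun u' s => diffQuot v (θ u' s) (θ u s) s) ?_ 0 t
      refine (continuous_diffQuot hv).comp (g := fun q : ℝ × ℝ × ℝ => diffQuot v q.1 q.2.1 q.2.2)
        (f := fun z : ℝ × ℝ => (θ z.1 z.2, θ u z.2, z.2)) ?_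
      exact hcont.prodMk ((hcont.comp (continuous_const.prodMk continuous_snd)).prodMk
        continuous_snd)
    have h1 := (hc.tendsto u).mono_left (nhdsWithin_le_nhds (s := {u}ᶜ))
    have hAu : Real.exp (∫ s in (0 : ℝ)..t, diffQuot v (θ u s) (θ u s) s) = A u t := by
      simp only [diffQuot_self, hA]
    rw [hAu] at h1
    refine h1.congr' ?_
    filter_upwards [self_mem_nhdsWithin] with u' hu'
    rw [slope_def_field, hsub, mul_div_cancel_left₀ _ (sub_ne_zero.2 hu')]
  -- Rescaling to the fixed interval `[0, 1]` makes the result on parametric integrals applicable.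
  have hAscale : ∀ u t, A u t = Real.exp (t * ∫ r in (0 : ℝ)..1, dx v (θ u (t * r)) (t * r)) := by
    intro u t
    have := intervalIntegral.mul_integral_comp_mul_left (a := 0) (b := 1)
      (f := fun s => dx v (θ u s) s) t
    simp only [hA]
    rw [this]
    simp
  -- Bootstrap: both partial derivatives of `θ` are as smooth as `θ` itself, so `θ` gains one
  -- derivative at each round.
  have hAB : ∀ n : ℕ, ContDiff ℝ n (fun q : ℝ × ℝ => θ q.1 q.2) →
      ContDiff ℝ n (fun q : ℝ × ℝ => A q.1 q.2) ∧
        ContDiff ℝ n fun q : ℝ × ℝ => v (θ q.1 q.2) q.2 := by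
    intro n hn
    constructor
    · simp only [hAscale]
      refine (contDiff_snd.mul ?_).exp
      rw [← contDiffOn_univ]
      refine contDiffOn_parametric_integral (n := n) isOpen_univ zero_le_one
        (F := fun (q : ℝ × ℝ) r => dx v (θ q.1 (q.2 * r)) (q.2 * r)) (ContDiff.contDiffOn ?_)
      have h1 : ContDiff ℝ n fun z : (ℝ × ℝ) × ℝ => z.1.2 * z.2 :=
        (contDiff_snd.comp contDiff_fst).mul contDiff_snd
      have h2 : ContDiff ℝ n fun z : (ℝ × ℝ) × ℝ => θ z.1.1 (z.1.2 * z.2) :=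
        hn.comp (g := fun q : ℝ × ℝ => θ q.1 q.2) ((contDiff_fst.comp contDiff_fst).prodMk h1)
      exact (hdxv.of_le (by exact_mod_cast le_top)).comp (g := fun q : ℝ × ℝ => dx v q.1 q.2)
        (h2.prodMk h1)
    · exact (hv.contDiff.of_le (by exact_mod_cast le_top)).comp (g := fun q : ℝ × ℝ => v q.1 q.2)
        (hn.prodMk contDiff_snd)
  have hAB0 := hAB 0 (contDiff_zero.2 hcont)
  have hfd : ∀ q : ℝ × ℝ, HasFDerivAt (fun q : ℝ × ℝ => θ q.1 q.2)
      ((ContinuousLinearMap.fst ℝ ℝ ℝ).smulRight (A q.1 q.2) +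
      (ContinuousLinearMap.snd ℝ ℝ ℝ).smulRight (v (θ q.1 q.2) q.2)) q := by
    intro q
    have := (hasStrictFDerivAt_uncurry_coprod (𝕜 := ℝ) (u := q) (f := θ)
      (f₁ := fun u t => (ContinuousLinearMap.id ℝ ℝ).smulRight (A u t))
      (f₂ := fun u t => (ContinuousLinearMap.id ℝ ℝ).smulRight (v (θ u t) t))
      (.of_forall fun z => (hdu z.1 z.2).hasFDerivAt.congr_fderiv
        (by ext; simp [Function.HasUncurry.uncurry]))
      (.of_forall fun z => (hθ z.1 z.2).hasFDerivAt.congr_fderiv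
        (by ext; simp [Function.HasUncurry.uncurry]))
      (contDiff_const.smulRight hAB0.1).continuous.continuousAt
      (contDiff_const.smulRight hAB0.2).continuous.continuousAt).hasFDerivAt
    refine this.congr_fderiv ?_
    ext <;> simp [Function.HasUncurry.uncurry]
  have hsmooth : ∀ n : ℕ, ContDiff ℝ n fun q : ℝ × ℝ => θ q.1 q.2 := by
    intro n
    induction n with
    | zero => exact contDiff_zero.2 hcont
    | succ n ih =>
      rw [Nat.cast_succ]
      exact contDiff_succ_of_partials (hAB n ih).1 (hAB n ih).2 hfd
  refine ⟨θ, smoothAlong_univ_iff.2 (contDiff_infty.2 hsmooth), hθ0, hθ, fun u t => ?_,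
    fun u t => ?_⟩
  · rw [dx, (hdu u t).deriv]
    exact Real.exp_pos _
  · have h1 : ∀ s, HasDerivAt (fun s => θ u s + L) (v (θ u s + L) s) s := fun s => by
      have e : v (θ u s + L) s = v (θ u s) s := hper s (θ u s)
      rw [e]
      exact (hθ u s).add_const L
    have := sub_eq_mul_exp hv (hθ (u + L)) h1 t
    rw [hθ0, hθ0, sub_self, zero_mul, sub_eq_zero] at this
    exact this

end ODE

/-! ### Uniqueness for the support functions -/

lemma le_initial_of_deriv_nonpos {T : ℝ} {f f' : ℝ → ℝ} (hf : ContinuousOn f (Ico 0 T))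
    (hd : ∀ t ∈ Ioo 0 T, HasDerivAt f (f' t) t) (h0 : ∀ t ∈ Ioo 0 T, f' t ≤ 0) {t : ℝ}
    (ht : t ∈ Ico 0 T) : f t ≤ f 0 := by
  have hsub : Icc 0 t ⊆ Ico 0 T := fun s hs => ⟨hs.1, hs.2.trans_lt ht.2⟩
  have hsub' : interior (Icc 0 t) ⊆ Ioo 0 T := by
    rw [interior_Icc]; exact Ioo_subset_Ioo_right ht.2.le
  have := antitoneOn_of_deriv_nonpos (convex_Icc 0 t) (hf.mono hsub)
    (fun s hs => (hd s (hsub' hs)).differentiableAt.differentiableWithinAt)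
    (fun s hs => by rw [(hd s (hsub' hs)).deriv]; exact h0 s (hsub' hs))
  exact this ⟨le_rfl, ht.1⟩ ⟨ht.1, le_rfl⟩ ht.1

lemma eq_initial_of_deriv_zero {T : ℝ} {f : ℝ → ℝ} (hf : ContinuousOn f (Ico 0 T))
    (hd : ∀ t ∈ Ioo 0 T, HasDerivAt f 0 t) {t : ℝ} (ht : t ∈ Ico 0 T) : f t = f 0 := by
  refine le_antisymm (le_initial_of_deriv_nonpos hf hd (fun _ _ => le_rfl) ht) ?_
  have := le_initial_of_deriv_nonpos hf.neg (fun t ht => (hd t ht).neg)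
    (fun _ _ => by simp) ht
  simpa using this

/-- The damped heat equation on the circle has only the zero solution with zero initial value. -/
lemma heat_eq_zero {T L k : ℝ} (hL : 0 < L) (hk : 0 < k) {y : ℝ → ℝ → ℝ}
    (hy : SmoothAlong (Ioo 0 T) y)
    (hc : ContinuousOn (fun q : ℝ × ℝ => y q.1 q.2) (univ ×ˢ Ico 0 T))
    (hper : ∀ t ∈ Ico 0 T, Function.Periodic (fun x => y x t) L) (h0 : ∀ x, y x 0 = 0)
    (heq : ∀ x, ∀ t ∈ Ioo 0 T, dt y x t = k * (dx (dx y) x t - y x t)) {t : ℝ}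
    (ht : t ∈ Ico 0 T) (x : ℝ) : y x t = 0 := by
  have hcont : ContinuousOn (fun t => ∫ x in (0 : ℝ)..L, y x t * y x t) (Ico 0 T) :=
    continuousOn_integral_of_continuousOn (F := fun x t => y x t * y x t) (hc.mul hc) 0 L
  have hder : ∀ t ∈ Ioo 0 T, HasDerivAt (fun t => ∫ x in (0 : ℝ)..L, y x t * y x t)
      (∫ x in (0 : ℝ)..L, dt (fun x t => y x t * y x t) x t) t := fun t ht =>
    hasDerivAt_integral_of_smoothAlong isOpen_Ioo (hy.mul hy) 0 L ht
  -- Integration by parts over a period turns the derivative of `∫ y²` into `-2k ∫ (y_x² + y²)`.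
  have hneg : ∀ t ∈ Ioo 0 T, ∫ x in (0 : ℝ)..L, dt (fun x t => y x t * y x t) x t ≤ 0 := by
    intro t ht
    have hyx := hy.dx isOpen_Ioo
    have hyxx := hyx.dx isOpen_Ioo
    have c0 := (hy.contDiff_slice ht).continuous
    have c1 := (hyx.contDiff_slice ht).continuous
    have c2 := (hyxx.contDiff_slice ht).continuous
    have e : ∀ x, dt (fun x t => y x t * y x t) x t =
        2 * k * (y x t * dx (dx y) x t) - 2 * k * (y x t * y x t) := by
      intro x
      have := ((hy.hasDerivAt_dt ht (x := x)).mul (hy.hasDerivAt_dt ht (x := x))).deriv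
      rw [dt]
      refine this.trans ?_
      rw [heq x t ht]; ring
    have ibp := intervalIntegral.integral_mul_deriv_eq_deriv_mul (a := 0) (b := L)
      (fun x _ => hy.hasDerivAt_dx ht (x := x)) (fun x _ => hyx.hasDerivAt_dx ht (x := x))
      (c1.intervalIntegrable _ _) (c2.intervalIntegrable _ _)
    have p0 : y L t = y 0 t := by simpa using hper t (Ioo_subset_Ico_self ht) 0
    have p1 : dx y L t = dx y 0 t := by
      have h := periodic_deriv (hper t (Ioo_subset_Ico_self ht)) 0
      rw [zero_add] at h
      exact h
    rw [p0, p1, sub_self, zero_sub] at ibp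
    simp only [e]
    have i1 : IntervalIntegrable (fun x => 2 * k * (y x t * dx (dx y) x t)) volume 0 L :=
      (continuous_const.mul (c0.mul c2)).intervalIntegrable _ _
    have i2 : IntervalIntegrable (fun x => 2 * k * (y x t * y x t)) volume 0 L :=
      (continuous_const.mul (c0.mul c0)).intervalIntegrable _ _
    rw [intervalIntegral.integral_sub i1 i2,
      intervalIntegral.integral_const_mul, intervalIntegral.integral_const_mul, ibp]
    have n1 : 0 ≤ ∫ x in (0 : ℝ)..L, dx y x t * dx y x t :=
      intervalIntegral.integral_nonneg hL.le fun x _ => mul_self_nonneg _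
    have n2 : 0 ≤ ∫ x in (0 : ℝ)..L, y x t * y x t :=
      intervalIntegral.integral_nonneg hL.le fun x _ => mul_self_nonneg _
    nlinarith
  have hle := le_initial_of_deriv_nonpos hcont hder hneg ht
  simp only [h0, mul_zero, intervalIntegral.integral_zero] at hle
  by_contra hne
  obtain ⟨z, hz, hxz⟩ := (hper t ht).exists_mem_Ico₀ hL x
  have hyt : Continuous fun x => y x t := hc.comp_continuous (by fun_prop)
    (f := fun x : ℝ => (x, t)) fun x => ⟨trivial, ht⟩
  have := intervalIntegral.integral_pos hL (f := fun x => y x t * y x t)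
    (hyt.mul hyt).continuousOn (fun x _ => mul_self_nonneg _)
    ⟨z, Ico_subset_Icc_self hz, by
      rw [← show y x t = y z t from hxz]; exact mul_self_pos.2 hne⟩
  linarith

lemma SmoothAlong.shiftSum {J : Set ℝ} {m k : ℕ} {p : ℝ → ℝ → ℝ} (hp : SmoothAlong J p) :
    SmoothAlong J fun x t => shiftSum m k (fun y => p y t) x :=
  SmoothAlong.sum fun _ _ => hp.shift _

lemma dt_shiftSum {J : Set ℝ} {m k : ℕ} {p : ℝ → ℝ → ℝ} (hp : SmoothAlong J p) {t : ℝ}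
    (ht : t ∈ J) (x : ℝ) :
    dt (fun x t => shiftSum m k (fun y => p y t) x) x t = shiftSum m k (fun y => dt p y t) x :=
  (HasDerivAt.fun_sum fun _ _ => hp.hasDerivAt_dt ht).deriv

lemma continuousOn_shiftSum {K : Set ℝ} {m k : ℕ} {p : ℝ → ℝ → ℝ}
    (hp : ContinuousOn (fun q : ℝ × ℝ => p q.1 q.2) (univ ×ˢ K)) :
    ContinuousOn (fun q : ℝ × ℝ => shiftSum m k (fun y => p y q.2) q.1) (univ ×ˢ K) :=
  continuousOn_finsetSum _ fun _ _ =>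
    hp.comp (f := fun q : ℝ × ℝ => (q.1 + _, q.2)) (by fun_prop) fun _ hq => ⟨trivial, hq.2⟩

/-- Two solutions of the flow of support functions with the same initial value agree up to a
function of time. -/
lemma support_flow_unique_up_to_time {m k : ℕ} (hm : 0 < m) (hk : 0 < k) {T : ℝ}
    {d : ℝ → ℝ → ℝ} {b : ℝ → ℝ} (hd : SmoothAlong (Ioo 0 T) d)
    (hc : ContinuousOn (fun q : ℝ × ℝ => d q.1 q.2) (univ ×ˢ Ico 0 T))
    (hper : ∀ t ∈ Ico 0 T, Function.Periodic (fun x => d x t) (2 * m * Real.pi))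
    (h0 : ∀ x, d x 0 = 0)
    (heq : ∀ x, ∀ t ∈ Ioo 0 T, dt d x t = deriv (deriv (shiftSum m k fun y => d y t)) x -
      shiftSum m k (fun y => d y t) x - b t) {t : ℝ} (ht : t ∈ Ico 0 T) (x : ℝ) :
    d x t = d 0 t := by
  have hk' : (0 : ℝ) < k := by exact_mod_cast hk
  set A : ℝ → ℝ → ℝ := fun x t => shiftSum m k (fun y => d y t) x with hA
  have hAs : SmoothAlong (Ioo 0 T) A := hd.shiftSum
  have hAper : ∀ t ∈ Ico 0 T, Function.Periodic (fun x => A x t) (2 * m * Real.pi / k) :=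
    fun t ht => shiftSum_periodic hk (hper t ht)
  have hAt : ∀ x, ∀ t ∈ Ioo 0 T, dt A x t = k * (dx (dx A) x t - A x t - b t) := by
    intro x t ht
    have hp := hAper t (Ioo_subset_Ico_self ht)
    have hp2 : Function.Periodic (fun y => dt d y t) (2 * m * Real.pi / k) := by
      intro y
      simp only [heq _ t ht]
      have e1 := periodic_deriv (periodic_deriv hp) y
      have e2 := hp y
      simp only [hA] at e1 e2
      rw [e2]
      exact congrArg (fun z => z - _ - _) e1
    rw [hA, dt_shiftSum hd ht, shiftSum_of_periodic hp2]
    simp only [heq x t ht]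
    rfl
  -- A spatial difference eliminates the unknown `b t` and solves the damped heat equation with zero
  -- initial value.
  have hAconst : ∀ t ∈ Ico 0 T, ∀ x h, A (x + h) t - A x t = 0 := by
    intro t ht x h
    have hshift := hAs.shift h
    refine heat_eq_zero (y := fun x t => A (x + h) t - A x t)
      (show (0 : ℝ) < 2 * m * Real.pi / k by positivity) hk' (hshift.sub hAs) ?_ ?_ ?_ ?_ ht x
    · have h1 := continuousOn_shiftSum (m := m) (k := k) hc
      exact (h1.comp (f := fun q : ℝ × ℝ => (q.1 + h, q.2)) (by fun_prop)
        fun q hq => ⟨trivial, hq.2⟩).sub h1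
    · intro t ht x
      have := hAper t ht (x + h)
      have h2 := hAper t ht x
      simp only at this h2
      simp only [h2, ← this]
      congr 2; ring
    · intro x; simp [hA, h0, KWidthFlow.shiftSum]
    · intro x t ht
      have e1 : dt (fun x t => A (x + h) t - A x t) x t = dt A (x + h) t - dt A x t :=
        ((hAs.hasDerivAt_dt ht).sub (hAs.hasDerivAt_dt ht)).deriv
      have e2 : ∀ x, dx (fun x t => A (x + h) t - A x t) x t = dx A (x + h) t - dx A x t :=
        fun x => (((hAs.hasDerivAt_dx ht).comp_add_const x h).sub (hAs.hasDerivAt_dx ht)).deriv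
      have e3 : dx (dx (fun x t => A (x + h) t - A x t)) x t =
          dx (dx A) (x + h) t - dx (dx A) x t := by
        have hs := hAs.dx isOpen_Ioo
        have : deriv (fun y => dx A (y + h) t - dx A y t) x = _ :=
          (((hs.hasDerivAt_dx ht).comp_add_const x h).sub (hs.hasDerivAt_dx ht)).deriv
        rw [← this, dx]
        congr 1
        funext y
        exact e2 y
      rw [e1, e3, hAt _ _ ht, hAt _ _ ht]; ring
  have hAfun : ∀ t ∈ Ico 0 T, (fun x => A x t) = fun _ => A 0 t := by
    intro t ht; funext x
    have := hAconst t ht 0 x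
    rw [zero_add, sub_eq_zero] at this
    exact this
  have hdt : ∀ x, ∀ t ∈ Ioo 0 T, dt d x t = -A 0 t - b t := by
    intro x t ht
    have e := hAfun t (Ioo_subset_Ico_self ht)
    have e' : (KWidthFlow.shiftSum m k fun y => d y t) = fun _ => A 0 t := e
    rw [heq x t ht, e']
    simp
  have hslice : ∀ x, ContinuousOn (fun t => d x t) (Ico 0 T) := fun x =>
    hc.comp (f := fun t : ℝ => (x, t)) (by fun_prop) fun t ht => ⟨trivial, ht⟩
  have := eq_initial_of_deriv_zero (f := fun t => d x t - d 0 t) ((hslice x).sub (hslice 0))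
    (fun t ht => by
      have := (hd.hasDerivAt_dt ht (x := x)).sub (hd.hasDerivAt_dt ht (x := 0))
      rw [hdt x t ht, hdt 0 t ht, sub_self] at this
      exact this) ht
  simp only [h0, sub_self] at this
  linarith

/-- A solution of the flow of support functions is determined by its initial value. -/
theorem support_flow_unique {m k : ℕ} (hm : 0 < m) (hk : 0 < k) {T : ℝ} {p q : ℝ → ℝ → ℝ}
    (hp : SmoothAlong (Ioo 0 T) p) (hq : SmoothAlong univ q)
    (hpc : ContinuousOn (fun z : ℝ × ℝ => p z.1 z.2) (univ ×ˢ Ico 0 T))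
    (hpper : ∀ t ∈ Ico 0 T, Function.Periodic (fun x => p x t) (2 * m * Real.pi))
    (hqper : ∀ t, Function.Periodic (fun x => q x t) (2 * m * Real.pi))
    (hppos : ∀ x, ∀ t ∈ Ico 0 T, 0 < rad (fun y => p y t) x)
    (hqpos : ∀ x t, 0 < rad (fun y => q y t) x)
    (h0 : ∀ x, p x 0 = q x 0)
    (hpt : ∀ x, ∀ t ∈ Ioo 0 T, dt p x t = -speed m k (curveOf fun y => p y t) x)
    (hqt : ∀ x t, 0 ≤ t → dt q x t = -speed m k (curveOf fun y => q y t) x) {t : ℝ}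
    (ht : t ∈ Ico 0 T) (x : ℝ) : p x t = q x t := by
  have hL : (0 : ℝ) < 2 * m * Real.pi := by positivity
  have hqI : SmoothAlong (Ioo 0 T) q := hq.mono (subset_univ _)
  have hpt' : ∀ x, ∀ t ∈ Ioo 0 T, dt p x t = deriv (deriv (shiftSum m k fun y => p y t)) x -
      shiftSum m k (fun y => p y t) x - nonlocalTerm m k (curveOf fun y => p y t) := by
    intro x t ht
    rw [hpt x t ht, speed_curveOf (hp.contDiff_slice ht)
      fun x => hppos x t (Ioo_subset_Ico_self ht)]
    ring
  have hqt' : ∀ x, ∀ t ∈ Ioo 0 T, dt q x t = deriv (deriv (shiftSum m k fun y => q y t)) x -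
      shiftSum m k (fun y => q y t) x - nonlocalTerm m k (curveOf fun y => q y t) := by
    intro x t ht
    rw [hqt x t ht.1.le, speed_curveOf (hqI.contDiff_slice ht) fun x => hqpos x t]
    ring
  set d : ℝ → ℝ → ℝ := fun x t => p x t - q x t with hdd
  have hd0 : ∀ t ∈ Ico 0 T, ∀ x, d x t = d 0 t := by
    intro t ht x
    refine support_flow_unique_up_to_time hm hk (hp.sub hqI)
      (hpc.sub hq.contDiff.continuous.continuousOn) (fun t ht x => ?_) (fun x => ?_)
      (b := fun t => nonlocalTerm m k (curveOf fun y => p y t) -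
        nonlocalTerm m k (curveOf fun y => q y t)) (fun x t ht => ?_) ht x
    · have h1 := hpper t ht x
      have h2 := hqper t x
      simp only at h1 h2
      simp only [h1, h2]
    · simp [h0]
    · have e1 : dt (fun x t => p x t - q x t) x t = dt p x t - dt q x t :=
        ((hp.hasDerivAt_dt ht).sub (hqI.hasDerivAt_dt ht)).deriv
      have cp := contDiff_shiftSum (m := m) (k := k) (hp.contDiff_slice ht)
      have cq := contDiff_shiftSum (m := m) (k := k) (hqI.contDiff_slice ht)
      have e2 : deriv (fun x => shiftSum m k (fun y => p y t) x - shiftSum m k (fun y => q y t) x) =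
          fun x => deriv (shiftSum m k fun y => p y t) x - deriv (shiftSum m k fun y => q y t) x :=
        funext fun x => ((hasDerivAt_of_contDiff cp x).sub (hasDerivAt_of_contDiff cq x)).deriv
      have e3 : deriv (fun x => deriv (shiftSum m k fun y => p y t) x -
          deriv (shiftSum m k fun y => q y t) x) x = deriv (deriv (shiftSum m k fun y => p y t)) x -
          deriv (deriv (shiftSum m k fun y => q y t)) x :=
        ((hasDerivAt_of_contDiff (contDiff_deriv cp) x).sub
          (hasDerivAt_of_contDiff (contDiff_deriv cq) x)).deriv
      rw [e1, hpt' x t ht, hqt' x t ht, shiftSum_sub, e2, e3]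
      ring
  have hrad : ∀ t ∈ Ico 0 T, ∀ x, rad (fun y => p y t) x = rad (fun y => q y t) x + d 0 t := by
    intro t ht x
    have e : (fun y => p y t) = fun y => q y t + d 0 t := by
      funext y
      have := hd0 t ht y
      simp only [hdd] at this ⊢
      linarith
    have e2 : deriv (fun y => q y t + d 0 t) = deriv fun y => q y t :=
      funext fun y => deriv_add_const _
    rw [e]
    simp only [rad, e2]
    ring
  have hqrad : ContinuousOn (fun z : ℝ × ℝ => rad (fun y => q y z.2) z.1) (univ ×ˢ Ico 0 T) :=
    (hq.rad isOpen_univ).contDiff.continuous.continuousOn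
  have hdc : ContinuousOn (fun t => d 0 t) (Ico 0 T) :=
    (hpc.sub hq.contDiff.continuous.continuousOn).comp (f := fun t : ℝ => ((0 : ℝ), t))
      (by fun_prop) fun t ht => ⟨trivial, ht⟩
  -- Only `p` itself is assumed continuous at `t = 0`; its radius inherits continuity there from
  -- that of `q` and from `d 0`.
  have hprad : ContinuousOn (fun z : ℝ × ℝ => rad (fun y => p y z.2) z.1) (univ ×ˢ Ico 0 T) :=
    (hqrad.add (hdc.comp (f := Prod.snd) continuousOn_snd fun z hz => hz.2)).congr
      fun z hz => hrad z.2 hz.2 z.1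
  have hqE : ∀ t ∈ Ico 0 T, ∫ x in (0 : ℝ)..(2 * m * Real.pi), 1 / rad (fun y => q y t) x =
      ∫ x in (0 : ℝ)..(2 * m * Real.pi), 1 / rad (fun y => q y 0) x := by
    intro t ht
    refine eq_initial_of_deriv_zero (continuousOn_integral_of_continuousOn
      (F := fun x t => 1 / rad (fun y => q y t) x)
      (continuousOn_const.div hqrad fun z _ => (hqpos z.1 z.2).ne') _ _) (fun t ht => ?_) ht
    have := hasDerivAt_energy isOpen_Ioo hqI (fun x t _ => hqpos x t) (2 * m * Real.pi) ht
    rwa [(energy_stationary_iff (m := m) (k := k) hm (hqI.contDiff_slice ht) (fun x => hqpos x t)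
      (fun x => hqt' x t ht)).2 rfl] at this
  have hpE : ∀ t ∈ Ico 0 T, ∫ x in (0 : ℝ)..(2 * m * Real.pi), 1 / rad (fun y => p y t) x =
      ∫ x in (0 : ℝ)..(2 * m * Real.pi), 1 / rad (fun y => p y 0) x := by
    intro t ht
    refine eq_initial_of_deriv_zero (continuousOn_integral_of_continuousOn
      (F := fun x t => 1 / rad (fun y => p y t) x)
      (continuousOn_const.div hprad fun z hz => (hppos z.1 z.2 hz.2).ne') _ _)
      (fun t ht => ?_) ht
    have := hasDerivAt_energy isOpen_Ioo hp (fun x t ht => hppos x t (Ioo_subset_Ico_self ht))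
      (2 * m * Real.pi) ht
    rwa [(energy_stationary_iff (m := m) (k := k) hm (hp.contDiff_slice ht)
      (fun x => hppos x t (Ioo_subset_Ico_self ht)) (fun x => hpt' x t ht)).2 rfl] at this
  have hE := (hpE t ht).trans ((by simp only [h0] :
    ∫ x in (0 : ℝ)..(2 * m * Real.pi), 1 / rad (fun y => p y 0) x =
      ∫ x in (0 : ℝ)..(2 * m * Real.pi), 1 / rad (fun y => q y 0) x).trans (hqE t ht).symm)
  have hqrc : Continuous fun x => rad (fun y => q y t) x :=
    contDiff_rad (hq.contDiff_slice (mem_univ t)) |>.continuous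
  -- Both `-d 0 t` and `0` are levels of the radius of `q` with the same energy.
  have hd00 : d 0 t = 0 := by
    have h1 : ∀ x, -d 0 t < rad (fun y => q y t) x := fun x => by
      have := hppos x t ht; rw [hrad t ht] at this; linarith
    have := abs_level_sub_le (ε := 0) (a := -d 0 t) (b := 0) hL hqrc hqrc h1
      (fun x => hqpos x t) (by simpa only [sub_neg_eq_add, sub_zero, ← hrad t ht] using hE)
      (fun x => by simp)
    simpa using abs_nonpos_iff.1 this
  have := hd0 t ht x
  rw [hd00] at this
  exact sub_eq_zero.1 this

/-! ### The tangent angle of a solution -/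

/-- A continuous angle function is as smooth as the unit vector it determines. -/
lemma contDiffAt_of_tangentAt {E : Type*} [NormedAddCommGroup E] [NormedSpace ℝ E] {f : E → ℝ}
    {z : E} (hf : ContinuousAt f z) (h : ContDiffAt ℝ ∞ (fun x => tangentAt (f x)) z) :
    ContDiffAt ℝ ∞ f z := by
  rw [contDiffAt_euclidean] at h
  have hc : ContDiffAt ℝ ∞ (fun x => Real.cos (f x)) z := h 0
  have hs : ContDiffAt ℝ ∞ (fun x => Real.sin (f x)) z := h 1
  have hS : ContDiffAt ℝ ∞ (fun x => Real.sin (f x - f z)) z := by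
    simp only [Real.sin_sub]
    exact (hs.mul contDiffAt_const).sub (hc.mul contDiffAt_const)
  -- Continuity keeps `f x - f z` within `(-π/2, π/2)` near `z`, where `arcsin` undoes the sine; the
  -- sine of the difference is smooth by the addition formula.
  have ha : ContDiffAt ℝ ∞ (fun x => f z + Real.arcsin (Real.sin (f x - f z))) z := by
    refine contDiffAt_const.add ?_
    refine ContDiffAt.comp (g := Real.arcsin) z ?_ hS
    simp only [sub_self, Real.sin_zero]
    exact Real.contDiffAt_arcsin (by norm_num) (by norm_num)
  refine ha.congr_of_eventuallyEq ?_
  have := Metric.continuousAt_iff'.1 hf (Real.pi / 2) (by positivity)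
  filter_upwards [this] with x hx
  rw [Real.dist_eq, abs_lt] at hx
  rw [Real.arcsin_sin hx.1.le hx.2.le]
  ring

/-- A continuous function differing from a shift of itself by the shift is onto. -/
lemma surjective_of_quasiperiodic {L : ℝ} (hL : 0 < L) {f : ℝ → ℝ} (hf : Continuous f)
    (h : ∀ u, f (u + L) = f u + L) : Function.Surjective f := by
  obtain ⟨K, -, hK⟩ := exists_bound_of_periodic hL (hf.sub continuous_id) (fun u => by
    simp [h u])
  intro y
  refine mem_range_of_exists_le_of_exists_ge hf ⟨y - K, ?_⟩ ⟨y + K, ?_⟩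
  · have := (abs_le.1 (hK (y - K))).2
    simp only [Pi.sub_apply, id] at this
    linarith
  · have := (abs_le.1 (hK (y + K))).1
    simp only [Pi.sub_apply, id] at this
    linarith

/-- Strictly increasing bijections depending continuously on time have inverses with the same
property. -/
lemma continuousOn_fibrewise_inverse {K : Set ℝ} {θ U : ℝ → ℝ → ℝ}
    (hθ : ContinuousOn (fun q : ℝ × ℝ => θ q.1 q.2) (univ ×ˢ K))
    (hmono : ∀ t ∈ K, StrictMono fun u => θ u t) (hU : ∀ t ∈ K, ∀ φ, θ (U φ t) t = φ) :
    ContinuousOn (fun q : ℝ × ℝ => U q.1 q.2) (univ ×ˢ K) := by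
  rintro ⟨φ, t⟩ ⟨-, ht⟩
  have hslice : ∀ u, ContinuousWithinAt (fun q : ℝ × ℝ => θ u q.2) (univ ×ˢ K) (φ, t) := fun u =>
    ContinuousWithinAt.comp (f := fun q : ℝ × ℝ => (u, q.2)) (x := (φ, t))
      (hθ (u, t) ⟨trivial, ht⟩) (by fun_prop) fun q hq => ⟨trivial, hq.2⟩
  have hfst : ContinuousWithinAt (fun q : ℝ × ℝ => q.1) (univ ×ˢ K) (φ, t) :=
    continuousWithinAt_fst
  rw [Metric.continuousWithinAt_iff']
  intro ε hε
  have h1 : θ (U φ t - ε) t < φ := by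
    conv_rhs => rw [← hU t ht φ]
    exact hmono t ht (by linarith)
  have h2 : φ < θ (U φ t + ε) t := by
    conv_lhs => rw [← hU t ht φ]
    exact hmono t ht (by linarith)
  filter_upwards [(hslice _).eventually_lt hfst h1, hfst.eventually_lt (hslice _) h2,
    self_mem_nhdsWithin] with q hq1 hq2 hq
  rw [← hU q.2 hq.2 q.1] at hq1 hq2
  have g1 := (hmono q.2 hq.2).lt_iff_lt.1 hq1
  have g2 := (hmono q.2 hq.2).lt_iff_lt.1 hq2
  rw [Real.dist_eq, abs_lt]
  constructor <;> simp only at * <;> linarith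

namespace IsFlow

variable {m k : ℕ} {X₀ : ℝ → Plane} {T : ℝ} {X : ℝ → ℝ → Plane} {θ : ℝ → ℝ → ℝ}

lemma smoothAlong (h : IsFlow m k X₀ (Ico 0 T) X θ) : SmoothAlong (Ioo 0 T) X := fun _ _ ht =>
  h.smooth.contDiffAt (prod_mem_nhds univ_mem (Ico_mem_nhds ht.1 ht.2))

lemma dx_ne_zero (h : IsFlow m k X₀ (Ico 0 T) X θ) (u : ℝ) {t : ℝ} (ht : t ∈ Ioo 0 T) :
    dx X u t ≠ 0 := h.immersed t (Ioo_subset_Ico_self ht) u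

lemma tangentAt_angle (h : IsFlow m k X₀ (Ico 0 T) X θ) (u : ℝ) {t : ℝ} (ht : t ∈ Ico 0 T) :
    tangentAt (θ u t) = ‖dx X u t‖⁻¹ • dx X u t := by
  conv_rhs => rw [show dx X u t = ‖dx X u t‖ • tangentAt (θ u t) from h.angle t ht u]
  rw [norm_smul, norm_tangentAt, norm_norm, mul_one, inv_smul_smul₀]
  exact norm_ne_zero_iff.2 (h.immersed t ht u)

lemma smoothAlong_angle (h : IsFlow m k X₀ (Ico 0 T) X θ) : SmoothAlong (Ioo 0 T) θ := by
  intro u t ht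
  have hX := h.smoothAlong.dx isOpen_Ioo u t ht
  refine contDiffAt_of_tangentAt (h.angle_continuous.continuousAt
    (prod_mem_nhds univ_mem (Ico_mem_nhds ht.1 ht.2))) ?_
  refine (((hX.norm ℝ (h.dx_ne_zero u ht)).inv
    (norm_ne_zero_iff.2 (h.dx_ne_zero u ht))).smul hX).congr_of_eventuallyEq ?_
  filter_upwards [eventually_snd_mem isOpen_Ioo (x := u) ht] with q hq
  exact h.tangentAt_angle q.1 (Ioo_subset_Ico_self hq)

/-- The unit tangent is periodic in `u`, so the increment of the angle over a period is an integer
multiple of `2π`. It is continuous in time, hence constant, and equals `2mπ` at time zero. -/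
lemma angle_add (h : IsFlow m k X₀ (Ico 0 T) X θ) (u : ℝ) {t : ℝ} (ht : t ∈ Ico 0 T) :
    θ (u + 2 * m * Real.pi) t = θ u t + 2 * m * Real.pi := by
  set L := 2 * m * Real.pi with hL
  set g : ℝ → ℝ := fun t => (θ (u + L) t - θ u t) / (2 * Real.pi) with hg
  have hc : ∀ v, ContinuousOn (fun t => θ v t) (Ico 0 T) := fun v =>
    h.angle_continuous.comp (f := fun t : ℝ => (v, t)) (by fun_prop) fun t ht => ⟨trivial, ht⟩
  have hgc : ContinuousOn g (Ico 0 T) := ((hc _).sub (hc _)).div_const _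
  have hper : ∀ t ∈ Ico 0 T, dx X (u + L) t = dx X u t := fun t ht =>
    periodic_deriv (p := fun v => X v t) (fun v => h.closed t ht v) u
  have hmaps : MapsTo g (Ico 0 T) (range ((↑) : ℤ → ℝ)) := by
    intro t ht
    obtain ⟨n, hn⟩ := exists_int_of_tangentAt_eq
      (a := θ (u + L) t) (b := θ u t) (by
        rw [h.tangentAt_angle _ ht, h.tangentAt_angle _ ht, hper t ht])
    refine ⟨n, ?_⟩
    rw [hg]; simp only
    rw [hn]; field_simp
  have hdisc : DiscreteTopology (range ((↑) : ℤ → ℝ)) :=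
    (Int.isClosedEmbedding_coe_real.isEmbedding.toHomeomorph.symm).isEmbedding.discreteTopology
  have h0 : (0 : ℝ) ∈ Ico 0 T := ⟨le_rfl, ht.1.trans_lt ht.2⟩
  have := isPreconnected_Ico.constant_of_mapsTo ⟨hdisc⟩ hgc hmaps ht h0
  simp only [hg, h.angle_initial, add_sub_cancel_left] at this
  rw [div_left_inj' (by positivity)] at this
  linarith

/-- The curvature is `θ_u / |X_u|`, so `θ_u` never vanishes and, by Darboux, has one sign. A
negative sign would contradict the increment `+2mπ` over a period. Thus positivity of the curvature
follows from its being nonzero. -/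
lemma dx_angle_pos (h : IsFlow m k X₀ (Ico 0 T) X θ) (hm : 0 < m) (u : ℝ) {t : ℝ}
    (ht : t ∈ Ioo 0 T) : 0 < dx θ u t := by
  have hL : (0 : ℝ) < 2 * m * Real.pi := by positivity
  have htI := Ioo_subset_Ico_self ht
  have hθ := h.smoothAlong_angle
  have hne : ∀ v, dx θ v t ≠ 0 := by
    intro v hv
    have hX := (h.smoothAlong.dx isOpen_Ioo).contDiff_slice ht
    have hn : ContDiff ℝ ∞ fun v => ‖dx X v t‖ := hX.norm ℝ fun v => h.dx_ne_zero v ht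
    have := curvature_eq_of_polar (γ := fun v => X v t) (g := fun v => ‖dx X v t‖)
      (θ := fun v => θ v t) (fun v => by
        have := h.smoothAlong.hasDerivAt_dx ht (x := v)
        rw [show dx X v t = ‖dx X v t‖ • tangentAt (θ v t) from h.angle t htI v] at this
        exact this) (hasDerivAt_of_contDiff hn v) (hθ.hasDerivAt_dx ht)
      (norm_pos_iff.2 (h.dx_ne_zero v ht))
    rw [hv, zero_div] at this
    exact h.curvature_ne_zero t htI v this
  rcases hasDerivWithinAt_forall_lt_or_forall_gt_of_forall_ne (m := 0) convex_univ
    (fun v _ => (hθ.hasDerivAt_dx ht (x := v)).hasDerivWithinAt) (fun v _ => hne v) with hs | hs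
  · exfalso
    have hanti := strictAnti_of_deriv_neg (f := fun v => θ v t) fun v => hs v trivial
    have h1 := hanti hL
    have h2 := h.angle_add 0 htI
    rw [zero_add] at h2
    simp only at h1
    linarith
  · exact hs u trivial

lemma strictMono_angle (h : IsFlow m k X₀ (Ico 0 T) X θ) (hm : 0 < m) {t : ℝ}
    (ht : t ∈ Ico 0 T) : StrictMono fun u => θ u t := by
  rcases eq_or_lt_of_le ht.1 with rfl | h0
  · intro a b hab
    simpa [h.angle_initial] using hab
  · exact strictMono_of_deriv_pos fun u => h.dx_angle_pos hm u ⟨h0, ht.2⟩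

lemma bijective_angle (h : IsFlow m k X₀ (Ico 0 T) X θ) (hm : 0 < m) {t : ℝ}
    (ht : t ∈ Ico 0 T) : Function.Bijective fun u => θ u t :=
  ⟨(h.strictMono_angle hm ht).injective, surjective_of_quasiperiodic
    (show (0 : ℝ) < 2 * m * Real.pi by positivity)
    (h.angle_continuous.comp_continuous (f := fun u : ℝ => (u, t)) (by fun_prop)
      fun u => ⟨trivial, ht⟩) fun u => h.angle_add u ht⟩

end IsFlow

/-- The parameter of a solution as a function of the tangent angle. -/
def paramOf (θ : ℝ → ℝ → ℝ) (φ t : ℝ) : ℝ := Function.invFun (fun u => θ u t) φ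

lemma byAngle_eq (X : ℝ → ℝ → Plane) (θ : ℝ → ℝ → ℝ) (t φ : ℝ) :
    byAngle X θ t φ = X (paramOf θ φ t) t := rfl

lemma byAngle_angle {X : ℝ → ℝ → Plane} {θ : ℝ → ℝ → ℝ} {t : ℝ}
    (h : Function.Injective fun u => θ u t) (u : ℝ) : byAngle X θ t (θ u t) = X u t := by
  rw [byAngle]
  exact congrArg (fun v => X v t) (Function.leftInverse_invFun h u)

namespace IsFlow

variable {m k : ℕ} {X₀ : ℝ → Plane} {T : ℝ} {X : ℝ → ℝ → Plane} {θ : ℝ → ℝ → ℝ}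

lemma angle_paramOf (h : IsFlow m k X₀ (Ico 0 T) X θ) (hm : 0 < m) {t : ℝ}
    (ht : t ∈ Ico 0 T) (φ : ℝ) : θ (paramOf θ φ t) t = φ :=
  Function.rightInverse_invFun (h.bijective_angle hm ht).2 φ

lemma paramOf_add (h : IsFlow m k X₀ (Ico 0 T) X θ) (hm : 0 < m) {t : ℝ}
    (ht : t ∈ Ico 0 T) (φ : ℝ) :
    paramOf θ (φ + 2 * m * Real.pi) t = paramOf θ φ t + 2 * m * Real.pi := by
  apply (h.strictMono_angle hm ht).injective
  simp only
  rw [h.angle_paramOf hm ht, h.angle_add _ ht, h.angle_paramOf hm ht]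

lemma smoothAlong_paramOf (h : IsFlow m k X₀ (Ico 0 T) X θ) (hm : 0 < m) :
    SmoothAlong (Ioo 0 T) (paramOf θ) := by
  intro φ t ht
  have hθ := h.smoothAlong_angle
  refine contDiffAt_fibrewise_inverse (f := fun q => θ q.1 q.2)
    (g := fun q => paramOf θ q.1 q.2) (Ω := univ ×ˢ Ioo 0 T)
    (isOpen_univ.prod isOpen_Ioo) (hθ _ t ht) (h.dx_angle_pos hm _ ht).ne'
    (hθ.hasDerivAt_dx ht) ⟨trivial, ht⟩ (h.angle_paramOf hm (Ioo_subset_Ico_self ht) φ) ?_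
  filter_upwards with q x hx hxq
  apply (h.strictMono_angle hm (Ioo_subset_Ico_self hx.2)).injective
  simp only at hxq ⊢
  rw [hxq, h.angle_paramOf hm (Ioo_subset_Ico_self hx.2)]

lemma continuousOn_paramOf (h : IsFlow m k X₀ (Ico 0 T) X θ) (hm : 0 < m) :
    ContinuousOn (fun q : ℝ × ℝ => paramOf θ q.1 q.2) (univ ×ˢ Ico 0 T) :=
  continuousOn_fibrewise_inverse h.angle_continuous (fun _ ht => h.strictMono_angle hm ht)
    fun _ ht => h.angle_paramOf hm ht

lemma byAngle_zero (h : IsFlow m k X₀ (Ico 0 T) X θ) : byAngle X θ 0 = X₀ := by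
  funext φ
  have e : (fun u => θ u 0) = id := funext h.angle_initial
  have := byAngle_angle (X := X) (θ := θ) (t := 0) (e ▸ Function.injective_id) φ
  rwa [h.angle_initial, h.initial] at this

lemma isLocallyConvexByAngle (h : IsFlow m k X₀ (Ico 0 T) X θ) (hm : 0 < m)
    (h₀ : IsLocallyConvexByAngle m X₀) {t : ℝ} (ht : t ∈ Ico 0 T) :
    IsLocallyConvexByAngle m (byAngle X θ t) := by
  -- Time zero is treated apart, since smoothness of the angle is available only at interior times.
  rcases eq_or_lt_of_le ht.1 with rfl | h0
  · rwa [h.byAngle_zero]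
  have htO : t ∈ Ioo 0 T := ⟨h0, ht.2⟩
  have hU := h.smoothAlong_paramOf hm
  have hX := h.smoothAlong
  have hUt : ∀ φ, HasDerivAt (fun φ => paramOf θ φ t) (dx θ (paramOf θ φ t) t)⁻¹ φ := fun φ =>
    (h.smoothAlong_angle.hasDerivAt_dx htO).of_local_left_inverse
      (hU.contDiff_slice htO).continuous.continuousAt (h.dx_angle_pos hm _ htO).ne'
      (.of_forall fun y => h.angle_paramOf hm ht y)
  have hsm : ContDiff ℝ ∞ (byAngle X θ t) := (hX.contDiff_slice htO).comp (hU.contDiff_slice htO)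
  set g : ℝ → ℝ := fun φ => ‖deriv (byAngle X θ t) φ‖ with hg
  have hder : ∀ φ, HasDerivAt (byAngle X θ t)
      ((dx θ (paramOf θ φ t) t)⁻¹ • dx X (paramOf θ φ t) t) φ := fun φ =>
    (hX.hasDerivAt_dx htO).scomp φ (hUt φ)
  have hpos : ∀ φ, 0 < (dx θ (paramOf θ φ t) t)⁻¹ := fun φ =>
    inv_pos.2 (h.dx_angle_pos hm _ htO)
  have hang : ∀ φ, deriv (byAngle X θ t) φ = g φ • tangentAt φ := by
    intro φ
    have e := h.tangentAt_angle (paramOf θ φ t) ht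
    rw [h.angle_paramOf hm ht] at e
    have hn : ‖dx X (paramOf θ φ t) t‖ ≠ 0 := norm_ne_zero_iff.2 (h.dx_ne_zero _ htO)
    rw [hg]
    simp only
    rw [(hder φ).deriv, e, norm_smul, Real.norm_eq_abs, abs_of_pos (hpos φ), mul_smul,
      smul_inv_smul₀ hn]
  have hne : ∀ φ, deriv (byAngle X θ t) φ ≠ 0 := fun φ => by
    rw [(hder φ).deriv]
    exact smul_ne_zero (hpos φ).ne' (h.dx_ne_zero _ htO)
  have hgpos : ∀ φ, 0 < g φ := fun φ => norm_pos_iff.2 (hne φ)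
  exact
    { smooth := hsm
      closed := fun φ => by
        rw [byAngle_eq, byAngle_eq, h.paramOf_add hm ht, h.closed t ht]
      immersed := hne
      curvature_pos := fun φ => by
        have := curvature_eq_of_polar (γ := byAngle X θ t) (g := g) (θ := id)
          (fun v => by rw [id, ← hang v]; exact hasDerivAt_of_contDiff hsm v)
          (hasDerivAt_of_contDiff ((contDiff_deriv hsm).norm ℝ hne) φ) (hasDerivAt_id φ)
          (hgpos φ)
        rw [this]
        exact one_div_pos.2 (hgpos φ)
      angle := hang }

lemma hasDerivAt (h : IsFlow m k X₀ (Ico 0 T) X θ) (u : ℝ) {t : ℝ} (ht : t ∈ Ioo 0 T) :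
    HasDerivAt (fun s => X u s)
      (speed m k (byAngle X θ t) (θ u t) • normalAt (θ u t)) t :=
  (h.equation t (Ioo_subset_Ico_self ht) u).hasDerivAt (Ico_mem_nhds ht.1 ht.2)

/-- The point with angle `φ` also slides along the curve, but this motion is tangential and
invisible to the product with `N(φ)`. -/
lemma hasDerivAt_support_byAngle (h : IsFlow m k X₀ (Ico 0 T) X θ) (hm : 0 < m) (φ : ℝ) {t : ℝ}
    (ht : t ∈ Ioo 0 T) :
    HasDerivAt (fun s => support (byAngle X θ s) φ) (-speed m k (byAngle X θ t) φ) t := by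
  have htI := Ioo_subset_Ico_self ht
  have h1 := h.smoothAlong.hasDerivAt_comp ht ((h.smoothAlong_paramOf hm).hasDerivAt_dt ht (x := φ))
  have h2 := (h1.inner ℝ (hasDerivAt_const t (normalAt φ))).neg
  refine h2.congr_deriv ?_
  have e := h.angle_paramOf hm htI φ
  have e1 : dx X (paramOf θ φ t) t = ‖dx X (paramOf θ φ t) t‖ • tangentAt φ := by
    have := h.angle t htI (paramOf θ φ t)
    rwa [e] at this
  have e2 : dt X (paramOf θ φ t) t = speed m k (byAngle X θ t) φ • normalAt φ := by
    have := (h.hasDerivAt (paramOf θ φ t) ht).deriv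
    rwa [e] at this
  rw [e2, e1]
  simp [inner_add_left, inner_smul_left]

end IsFlow

/-! ### Uniqueness of the flow -/

/-- The rate of change of the tangent angle along the normal flow of the curves with the support
functions `q · t`. -/
def angleSpeed (q : ℝ → ℝ → ℝ) (x t : ℝ) : ℝ := -dx (dt q) x t / rad (fun y => q y t) x

lemma SmoothAlong.angleSpeed {q : ℝ → ℝ → ℝ} (hq : SmoothAlong univ q)
    (hpos : ∀ x t, 0 < KWidthFlow.rad (fun y => q y t) x) : SmoothAlong univ (KWidthFlow.angleSpeed q) :=
  (((hq.dt isOpen_univ).dx isOpen_univ).neg).div (hq.rad isOpen_univ) fun x t _ => (hpos x t).ne'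

lemma angleSpeed_periodic {q : ℝ → ℝ → ℝ} {L : ℝ}
    (hper : ∀ t, Function.Periodic (fun x => q x t) L) (t : ℝ) :
    Function.Periodic (fun x => angleSpeed q x t) L := by
  intro x
  have h1 : Function.Periodic (fun x => dt q x t) L := fun x =>
    congrArg (fun f => deriv f t) (funext fun s => hper s x)
  simp only [angleSpeed]
  rw [show dx (dt q) (x + L) t = dx (dt q) x t from periodic_deriv h1 x, periodic_rad (hper t) x]

lemma SmoothAlong.inner {J : Set ℝ} {F G : ℝ → ℝ → Plane} (hF : SmoothAlong J F)
    (hG : SmoothAlong J G) : SmoothAlong J fun x t => inner ℝ (F x t) (G x t) :=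
  fun x t ht => (hF x t ht).inner ℝ (hG x t ht)

lemma SmoothAlong.curveOf {J : Set ℝ} (hJ : IsOpen J) {q : ℝ → ℝ → ℝ} (hq : SmoothAlong J q) :
    SmoothAlong J fun x t => KWidthFlow.curveOf (fun y => q y t) x :=
  ((hq.dx hJ).smul (.of_space contDiff_tangentAt)).sub (hq.smul (.of_space contDiff_normalAt))

lemma dt_curveOf {J : Set ℝ} (hJ : IsOpen J) {q : ℝ → ℝ → ℝ} (hq : SmoothAlong J q) (x : ℝ) {t : ℝ}
    (ht : t ∈ J) : dt (fun x t => curveOf (fun y => q y t) x) x t =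
      dx (dt q) x t • tangentAt x - dt q x t • normalAt x := by
  rw [← hq.dt_dx hJ ht]
  exact ((((hq.dx hJ).hasDerivAt_dt ht).smul_const _).sub
    ((hq.hasDerivAt_dt ht).smul_const _)).deriv

/-- Motion along a family of curves given by support functions, with tangent angle `f s`. -/
lemma hasDerivAt_curveOf_comp {J : Set ℝ} (hJ : IsOpen J) {q : ℝ → ℝ → ℝ} (hq : SmoothAlong J q)
    {f : ℝ → ℝ} {f' t : ℝ} (ht : t ∈ J) (hf : HasDerivAt f f' t) :
    HasDerivAt (fun s => curveOf (fun y => q y s) (f s))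
      ((f' * rad (fun y => q y t) (f t) + dx (dt q) (f t) t) • tangentAt (f t) -
        dt q (f t) t • normalAt (f t)) t := by
  refine ((hq.curveOf hJ).hasDerivAt_comp ht hf).congr_deriv ?_
  rw [dt_curveOf hJ hq _ ht, show dx (fun x t => curveOf (fun y => q y t) x) (f t) t =
    rad (fun y => q y t) (f t) • tangentAt (f t) from
    (hasDerivAt_curveOf (hq.contDiff_slice ht) _).deriv, smul_smul, add_smul]
  abel

/-- Uniqueness for a differential equation that holds in the interior of the time interval. -/
lemma ode_unique_of_Ioo {T : ℝ} {v : ℝ → ℝ → ℝ} {K : NNReal}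
    (hv : ∀ t ∈ Ioo 0 T, LipschitzWith K fun x => v x t) {f g : ℝ → ℝ}
    (hf : ContinuousOn f (Ico 0 T)) (hg : ContinuousOn g (Ico 0 T))
    (hf' : ∀ t ∈ Ioo 0 T, HasDerivAt f (v (f t) t) t)
    (hg' : ∀ t ∈ Ioo 0 T, HasDerivAt g (v (g t) t) t) (h0 : f 0 = g 0) {t : ℝ}
    (ht : t ∈ Ico 0 T) : f t = g t := by
  have hexp : ∀ t : ℝ, HasDerivAt (fun t : ℝ => Real.exp (-(2 * K) * t))
      (Real.exp (-(2 * K) * t) * -(2 * K)) t := fun t => by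
    have := ((hasDerivAt_id t).const_mul (-(2 * (K : ℝ)))).exp
    simpa using this
  -- Gronwall's argument: the squared difference times `e^{-2Kt}` does not increase.
  have := le_initial_of_deriv_nonpos
    (f := fun t => (f t - g t) * (f t - g t) * Real.exp (-(2 * K) * t))
    (((hf.sub hg).mul (hf.sub hg)).mul (by fun_prop))
    (fun t ht => (((hf' t ht).sub (hg' t ht)).mul ((hf' t ht).sub (hg' t ht))).mul (hexp t))
    (fun t ht => ?_) ht
  · simp only [h0, sub_self, zero_mul] at this
    have h1 : (f t - g t) * (f t - g t) ≤ 0 := by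
      by_contra hne
      exact absurd this (not_le.2 (mul_pos (not_le.1 hne) (Real.exp_pos _)))
    have h2 : f t - g t = 0 := mul_self_eq_zero.1 (le_antisymm h1 (mul_self_nonneg _))
    linarith
  · have hl := (hv t ht).dist_le_mul (f t) (g t)
    rw [Real.dist_eq, Real.dist_eq] at hl
    have h1 : (f t - g t) * (v (f t) t - v (g t) t) ≤ K * ((f t - g t) * (f t - g t)) := by
      calc _ ≤ |(f t - g t) * (v (f t) t - v (g t) t)| := le_abs_self _
        _ = |f t - g t| * |v (f t) t - v (g t) t| := abs_mul _ _
        _ ≤ |f t - g t| * (K * |f t - g t|) := by gcongr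
        _ = K * (|f t - g t| * |f t - g t|) := by ring
        _ = _ := by rw [abs_mul_abs_self]
    have h2 := Real.exp_pos (-(2 * K) * t)
    simp only [Pi.sub_apply, Pi.mul_apply]
    nlinarith

/-- Any solution is given by the flow of the support functions and the motion of the angles. -/
theorem IsFlow.eq_curveOf {m k : ℕ} (hm : 0 < m) (hk : 0 < k) {X₀ : ℝ → Plane}
    (h₀ : IsLocallyConvexByAngle m X₀) {q ψ : ℝ → ℝ → ℝ}
    (hq : SmoothAlong univ q)
    (hqper : ∀ t, Function.Periodic (fun x => q x t) (2 * m * Real.pi))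
    (hqpos : ∀ x t, 0 < rad (fun y => q y t) x) (hq0 : ∀ x, q x 0 = support X₀ x)
    (hqt : ∀ x t, 0 ≤ t → dt q x t = -speed m k (curveOf fun y => q y t) x)
    (hψ0 : ∀ u, ψ u 0 = u)
    (hψ : ∀ u t, HasDerivAt (fun s => ψ u s) (angleSpeed q (ψ u t) t) t)
    {T : ℝ} {X : ℝ → ℝ → Plane} {θ : ℝ → ℝ → ℝ} (h : IsFlow m k X₀ (Ico 0 T) X θ) {t : ℝ}
    (ht : t ∈ Ico 0 T) (u : ℝ) :
    X u t = curveOf (fun y => q y t) (ψ u t) ∧ θ u t = ψ u t := by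
  have hL : (0 : ℝ) < 2 * m * Real.pi := by positivity
  have hconv : ∀ t ∈ Ico 0 T, IsLocallyConvexByAngle m (byAngle X θ t) := fun t ht =>
    h.isLocallyConvexByAngle hm h₀ ht
  have hcurve : ∀ t ∈ Ico 0 T, curveOf (support (byAngle X θ t)) = byAngle X θ t := fun t ht =>
    curveOf_support (hconv t ht).smooth (hconv t ht).angle
  have hU := h.continuousOn_paramOf hm
  have hsup : ∀ x, ∀ t ∈ Ico 0 T, support (byAngle X θ t) x = q x t := by
    intro x t ht
    refine support_flow_unique hm hk (p := fun x t => support (byAngle X θ t) x)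
      ((SmoothAlong.inner (h.smoothAlong.comp (h.smoothAlong_paramOf hm))
        (.of_space contDiff_normalAt)).neg) hq ?_ (fun t ht => ?_) hqper
        (fun x t ht => rad_support_pos (hconv t ht) x) hqpos (fun x => ?_) (fun x t ht => ?_) hqt ht x
    · exact ((h.smooth.continuousOn.comp (f := fun q : ℝ × ℝ => (paramOf θ q.1 q.2, q.2))
        (hU.prodMk continuousOn_snd) fun q hq => ⟨trivial, hq.2⟩).inner (𝕜 := ℝ)
        (contDiff_normalAt.continuous.comp continuous_fst).continuousOn).neg
    · exact periodic_support (hconv t ht).closed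
    · rw [h.byAngle_zero, hq0]
    · rw [show curveOf (fun y => support (byAngle X θ t) y) = byAngle X θ t from
        hcurve t (Ioo_subset_Ico_self ht)]
      exact (h.hasDerivAt_support_byAngle hm x ht).deriv
  have hX : ∀ t ∈ Ico 0 T, ∀ u, X u t = curveOf (fun y => q y t) (θ u t) := by
    intro t ht u
    have e := hcurve t ht
    rw [show support (byAngle X θ t) = fun y => q y t from funext fun x => hsup x t ht] at e
    rw [e, byAngle_angle (h.bijective_angle hm ht).1]
  -- The velocity is normal, so its tangential component `θ_t ρ + ∂_φ q_t` is zero, which determines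
  -- `θ_t`.
  have hθ' : ∀ t ∈ Ioo 0 T, HasDerivAt (fun s => θ u s) (angleSpeed q (θ u t) t) t := by
    intro t ht
    have h1 := h.smoothAlong_angle.hasDerivAt_dt ht (x := u)
    refine h1.congr_deriv ?_
    have h2 := hasDerivAt_curveOf_comp isOpen_univ hq trivial h1
    have h3 := (h.hasDerivAt u ht).congr_of_eventuallyEq
      (f₁ := fun s => curveOf (fun y => q y s) (θ u s)) (by
        filter_upwards [isOpen_Ioo.mem_nhds ht] with s hs
        exact (hX s (Ioo_subset_Ico_self hs) u).symm)
    have h4 := congrArg (fun v => inner ℝ v (tangentAt (θ u t))) (h2.unique h3)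
    simp only [inner_sub_left, inner_smul_left, inner_tangentAt_self, inner_normalAt_tangentAt,
      mul_zero, mul_one, sub_zero] at h4
    rw [angleSpeed, eq_div_iff (hqpos _ _).ne']
    simp only [conj_trivial] at h4
    linarith
  obtain ⟨K, hK⟩ := exists_lipschitz_on_Icc hL (SmoothAlong.angleSpeed hq hqpos)
    (fun t => angleSpeed_periodic hqper t) T
  have hθ : θ u t = ψ u t := ode_unique_of_Ioo (v := angleSpeed q) (K := K)
    (fun t ht => hK t ⟨by linarith [ht.1, ht.2], ht.2.le⟩)
    (h.angle_continuous.comp (f := fun t : ℝ => (u, t)) (by fun_prop) fun t ht => ⟨trivial, ht⟩)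
    (fun t _ => (hψ u t).continuousAt.continuousWithinAt) hθ' (fun t _ => hψ u t)
    ((h.angle_initial u).trans (hψ0 u).symm) ht
  exact ⟨by rw [hX t ht u, hθ], hθ⟩

/-! ### Circles and symmetric curves -/

lemma tangentAt_ne_zero (φ : ℝ) : tangentAt φ ≠ 0 :=
  norm_ne_zero_iff.1 (by rw [norm_tangentAt]; exact one_ne_zero)

/-- On a circle `γ - c` is orthogonal to `T`, and differentiating `⟨γ - c, T⟩ = 0` gives `⟨γ - c, N⟩
= -ρ`, so `ρ` is the radius. Conversely, for constant `ρ = r` the centre `γ + r N` has derivative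
zero. -/
lemma isMultipleCircle_curveOf_iff {p : ℝ → ℝ} (hp : ContDiff ℝ ∞ p) (hpos : ∀ φ, 0 < rad p φ) :
    IsMultipleCircle (curveOf p) ↔ ∃ r, ∀ φ, rad p φ = r := by
  constructor
  · rintro ⟨c, r, hr, h⟩
    refine ⟨r, fun φ => ?_⟩
    have hd : ∀ φ, HasDerivAt (fun φ => curveOf p φ - c) (rad p φ • tangentAt φ) φ := fun φ =>
      (hasDerivAt_curveOf hp φ).sub_const c
    have h1 : ∀ φ, inner ℝ (curveOf p φ - c) (tangentAt φ) = 0 := by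
      intro φ
      have e : (fun φ => inner ℝ (curveOf p φ - c) (curveOf p φ - c)) = fun _ => r ^ 2 := by
        funext φ
        rw [real_inner_self_eq_norm_sq, ← dist_eq_norm, h φ]
      have := ((hd φ).inner ℝ (hd φ)).deriv
      rw [e, deriv_const, real_inner_comm, inner_smul_left, real_inner_comm] at this
      simp only [conj_trivial] at this
      have h2 : rad p φ * inner ℝ (curveOf p φ - c) (tangentAt φ) = 0 := by linarith
      exact (mul_eq_zero.1 h2).resolve_left (hpos φ).ne'
    have h2 := ((hd φ).inner ℝ (hasDerivAt_tangentAt φ)).deriv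
    rw [funext h1, deriv_const, inner_smul_left, inner_tangentAt_self] at h2
    have h3 := eq_frame (curveOf p φ - c) φ
    rw [h1, zero_smul, zero_add] at h3
    have h4 := h φ
    rw [dist_eq_norm, h3, norm_smul, norm_normalAt, Real.norm_eq_abs, mul_one] at h4
    simp only [conj_trivial, mul_one] at h2
    rw [show inner ℝ (curveOf p φ - c) (normalAt φ) = -rad p φ by linarith, abs_neg,
      abs_of_pos (hpos φ)] at h4
    exact h4
  · rintro ⟨r, h⟩
    have hd : ∀ φ, HasDerivAt (fun φ => curveOf p φ + r • normalAt φ) 0 φ := fun φ => by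
      refine ((hasDerivAt_curveOf hp φ).add ((hasDerivAt_normalAt φ).const_smul r)).congr_deriv ?_
      rw [h φ]; simp
    have hc := is_const_of_deriv_eq_zero (fun φ => (hd φ).differentiableAt) fun φ => (hd φ).deriv
    have hr : 0 < r := h 0 ▸ hpos 0
    refine ⟨curveOf p 0 + r • normalAt 0, r, hr, fun φ => ?_⟩
    rw [← hc φ 0, dist_eq_norm, sub_add_cancel_left, norm_neg, norm_smul, norm_normalAt,
      Real.norm_eq_abs, abs_of_pos hr, mul_one]

lemma rotation_tangentAt (a φ : ℝ) : rotation a (tangentAt φ) = tangentAt (φ + a) := by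
  apply plane_ext
  · simp [rotation, Real.cos_add]; ring
  · simp [rotation, Real.sin_add]; ring

lemma rotation_smul (a r : ℝ) (v : Plane) : rotation a (r • v) = r • rotation a v := by
  apply plane_ext <;> simp [rotation] <;> ring

lemma rotation_sub (a : ℝ) (v w : Plane) : rotation a (v - w) = rotation a v - rotation a w := by
  apply plane_ext <;> simp [rotation] <;> ring

lemma hasDerivAt_rotation {γ : ℝ → Plane} {γ' : Plane} {u : ℝ} (a : ℝ) (h : HasDerivAt γ γ' u) :
    HasDerivAt (fun s => rotation a (γ s)) (rotation a γ') u := by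
  obtain ⟨h0, h1⟩ := hasDerivAt_plane.1 h
  exact hasDerivAt_plane.2 ⟨(h0.const_mul _).sub (h1.const_mul _),
    (h0.const_mul _).add (h1.const_mul _)⟩

lemma rotation_of_cos_eq_one {a : ℝ} (h : Real.cos a = 1) (v : Plane) : rotation a v = v := by
  have hs : Real.sin a = 0 := by
    have := Real.sin_sq_add_cos_sq a
    rw [h] at this
    exact pow_eq_zero_iff (two_ne_zero) |>.1 (by linarith)
  apply plane_ext <;> simp [rotation, h, hs]

/-- The linear map `1 - R_a` has determinant `2 (1 - cos a)`; the witness is given by its inverse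
matrix. -/
lemma exists_sub_rotation_eq {a : ℝ} (h : Real.cos a ≠ 1) (d : Plane) :
    ∃ c : Plane, c - rotation a c = d := by
  have hne : 2 * (1 - Real.cos a) ≠ 0 := mul_ne_zero two_ne_zero (sub_ne_zero.2 h.symm)
  have hs := Real.sin_sq_add_cos_sq a
  refine ⟨!₂[((1 - Real.cos a) * d 0 - Real.sin a * d 1) / (2 * (1 - Real.cos a)),
    (Real.sin a * d 0 + (1 - Real.cos a) * d 1) / (2 * (1 - Real.cos a))], ?_⟩
  apply plane_ext
  · simp only [rotation, PiLp.sub_apply, Matrix.cons_val_zero, Matrix.cons_val_one]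
    field_simp
    linear_combination d 0 * hs
  · simp only [rotation, PiLp.sub_apply, Matrix.cons_val_zero, Matrix.cons_val_one]
    field_simp
    linear_combination d 1 * hs

/-- Differentiation turns symmetry into periodicity of `ρ`. Conversely, if `ρ` is periodic, then
`γ(φ + δ) - R_δ γ(φ)` is a constant `d`, and a centre has to solve `c - R_δ c = d`. -/
lemma isKSymmetric_curveOf_iff {m k : ℕ} (hk : 0 < k) {p : ℝ → ℝ} (hp : ContDiff ℝ ∞ p)
    (hper : Function.Periodic p (2 * m * Real.pi)) :
    IsKSymmetric m k (curveOf p) ↔ Function.Periodic (rad p) (2 * m * Real.pi / k) := by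
  set δ := 2 * m * Real.pi / k with hδ
  have hk' : (k : ℝ) ≠ 0 := by positivity
  have hd : ∀ φ, HasDerivAt (fun φ => curveOf p (φ + δ)) (rad p (φ + δ) • tangentAt (φ + δ)) φ :=
    fun φ => (hasDerivAt_curveOf hp _).comp_add_const φ δ
  constructor
  · rintro ⟨c, hc⟩ φ
    have h1 := ((hd φ).sub_const c).deriv
    rw [funext hc, (hasDerivAt_rotation δ ((hasDerivAt_curveOf hp φ).sub_const c)).deriv,
      rotation_smul, rotation_tangentAt] at h1
    exact (smul_left_injective ℝ (tangentAt_ne_zero (φ + δ)) h1).symm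
  · intro h
    have hE : ∀ φ, HasDerivAt (fun φ => curveOf p (φ + δ) - rotation δ (curveOf p φ)) 0 φ := by
      intro φ
      refine ((hd φ).sub (hasDerivAt_rotation δ (hasDerivAt_curveOf hp φ))).congr_deriv ?_
      rw [rotation_smul, rotation_tangentAt, h φ, sub_self]
    have hc := is_const_of_deriv_eq_zero (fun φ => (hE φ).differentiableAt) fun φ => (hE φ).deriv
    set d := curveOf p (0 + δ) - rotation δ (curveOf p 0) with hdd
    have hc' : ∀ φ, curveOf p (φ + δ) - rotation δ (curveOf p φ) = d := fun φ => hc φ 0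
    -- If the rotation is trivial, no centre can absorb `d`; but then `k` steps translate the closed
    -- curve by `k d`, so `d = 0`.
    by_cases hcos : Real.cos δ = 1
    · have h1 : ∀ φ, curveOf p (φ + δ) = curveOf p φ + d := fun φ => by
        rw [← hc' φ, rotation_of_cos_eq_one hcos]; abel
      have h2 : ∀ n : ℕ, curveOf p (n * δ) = curveOf p 0 + n • d := by
        intro n
        induction n with
        | zero => simp
        | succ n ih =>
          rw [succ_nsmul, ← add_assoc, ← ih, ← h1]
          push_cast; congr 1; ring
      have h3 := h2 k
      have h4 : curveOf p (0 + 2 * m * Real.pi) = curveOf p 0 := by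
        simp only [curveOf, periodic_deriv hper 0, hper 0, tangentAt_periodic m 0,
          normalAt_periodic m 0]
      rw [hδ, mul_div_cancel₀ _ hk', ← zero_add (2 * m * Real.pi), h4, left_eq_add] at h3
      have hd0 : d = 0 := by
        rw [← Nat.cast_smul_eq_nsmul ℝ] at h3
        exact (smul_eq_zero.1 h3).resolve_left hk'
      refine ⟨0, fun φ => ?_⟩
      rw [sub_zero, sub_zero, rotation_of_cos_eq_one hcos]
      exact (h1 φ).trans (by rw [hd0, add_zero])
    · obtain ⟨c, hcd⟩ := exists_sub_rotation_eq hcos d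
      refine ⟨c, fun φ => ?_⟩
      have := (hc' φ).trans hcd.symm
      rw [rotation_sub, sub_eq_sub_iff_add_eq_add] at *
      rw [this]; abel

/-! ### Decay of all derivatives -/

/-- The exponential decay of two functions with all their derivatives passes to the vector field
with these components in the moving frame. -/
lemma exists_iteratedDeriv_frame_le (κ : ℝ) (j : ℕ) : ∀ a b : ℝ → ℝ → ℝ,
    (∀ t, ContDiff ℝ ∞ (a t)) → (∀ t, ContDiff ℝ ∞ (b t)) →
    (∀ i, ∃ D, ∀ x t, 0 ≤ t → |iteratedDeriv i (a t) x| ≤ D * Real.exp (-κ * t)) →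
    (∀ i, ∃ D, ∀ x t, 0 ≤ t → |iteratedDeriv i (b t) x| ≤ D * Real.exp (-κ * t)) →
    ∃ D, ∀ x t, 0 ≤ t → ‖iteratedDeriv j (fun x => a t x • tangentAt x + b t x • normalAt x) x‖ ≤
      D * Real.exp (-κ * t) := by
  induction j with
  | zero =>
    intro a b _ _ ha hb
    obtain ⟨A, hA⟩ := ha 0
    obtain ⟨B, hB⟩ := hb 0
    refine ⟨A + B, fun x t ht => ?_⟩
    have h1 := hA x t ht
    have h2 := hB x t ht
    rw [iteratedDeriv_zero] at h1 h2 ⊢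
    refine (norm_add_le _ _).trans ?_
    rw [norm_smul, norm_smul, norm_tangentAt, norm_normalAt, Real.norm_eq_abs, Real.norm_eq_abs]
    linarith
  | succ j ih =>
    intro a b hac hbc ha hb
    -- Differentiation acts on the frame components by `(a, b) ↦ (a' - b, b' + a)`, which preserves
    -- the decay hypotheses; hence the induction over all pairs.
    have hd : ∀ t, deriv (fun x => a t x • tangentAt x + b t x • normalAt x) = fun x =>
        (deriv (a t) x - b t x) • tangentAt x + (deriv (b t) x + a t x) • normalAt x := by
      intro t
      funext x
      refine ((((hasDerivAt_of_contDiff (hac t) x).smul (hasDerivAt_tangentAt x)).add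
        ((hasDerivAt_of_contDiff (hbc t) x).smul (hasDerivAt_normalAt x))).deriv).trans ?_
      simp only [add_smul, sub_smul, smul_neg]
      abel
    simp only [iteratedDeriv_succ', hd]
    have hle : ∀ i : ℕ, ((i : ℕ∞) : WithTop ℕ∞) ≤ ∞ := fun i => by
      exact_mod_cast le_top
    refine ih (fun t x => deriv (a t) x - b t x) (fun t x => deriv (b t) x + a t x)
      (fun t => (contDiff_deriv (hac t)).sub (hbc t))
      (fun t => (contDiff_deriv (hbc t)).add (hac t)) (fun i => ?_) (fun i => ?_)
    · obtain ⟨A, hA⟩ := ha (i + 1)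
      obtain ⟨B, hB⟩ := hb i
      refine ⟨A + B, fun x t ht => ?_⟩
      have h1 := hA x t ht
      rw [iteratedDeriv_succ'] at h1
      rw [iteratedDeriv_fun_sub ((contDiff_deriv (hac t)).contDiffAt.of_le (hle i))
        ((hbc t).contDiffAt.of_le (hle i))]
      refine (abs_sub _ _).trans ?_
      linarith [hB x t ht]
    · obtain ⟨A, hA⟩ := ha i
      obtain ⟨B, hB⟩ := hb (i + 1)
      refine ⟨B + A, fun x t ht => ?_⟩
      have h1 := hB x t ht
      rw [iteratedDeriv_succ'] at h1
      rw [iteratedDeriv_fun_add ((contDiff_deriv (hbc t)).contDiffAt.of_le (hle i))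
        ((hac t).contDiffAt.of_le (hle i))]
      refine (abs_add_le _ _).trans ?_
      linarith [hA x t ht]

lemma curveOf_sub {p q : ℝ → ℝ} (hp : ContDiff ℝ ∞ p) (hq : ContDiff ℝ ∞ q) (x : ℝ) :
    curveOf (fun x => p x - q x) x = curveOf p x - curveOf q x := by
  have : deriv (fun x => p x - q x) x = deriv p x - deriv q x :=
    ((hasDerivAt_of_contDiff hp x).sub (hasDerivAt_of_contDiff hq x)).deriv
  simp only [curveOf, this, sub_smul]
  abel

/-- Exponential convergence of the support functions gives smooth convergence of the curves. -/
lemma tendstoUniformly_iteratedDeriv_curveOf {κ : ℝ} (hκ : 0 < κ) {q : ℝ → ℝ → ℝ} {p : ℝ → ℝ}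
    (hq : ∀ t, ContDiff ℝ ∞ fun x => q x t) (hp : ContDiff ℝ ∞ p)
    (h : ∀ j, ∃ D, ∀ x t, 0 ≤ t →
      |iteratedDeriv j (fun y => q y t - p y) x| ≤ D * Real.exp (-κ * t)) (j : ℕ) :
    TendstoUniformly (fun t φ => iteratedDeriv j (curveOf fun y => q y t) φ)
      (iteratedDeriv j (curveOf p)) atTop := by
  have hd : ∀ t, ContDiff ℝ ∞ fun y => q y t - p y := fun t => (hq t).sub hp
  obtain ⟨D, hD⟩ := exists_iteratedDeriv_frame_le κ j (fun t => deriv fun y => q y t - p y)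
    (fun t x => -(q x t - p x)) (fun t => contDiff_deriv (hd t)) (fun t => (hd t).neg)
    (fun i => by
      obtain ⟨D, hD⟩ := h (i + 1)
      exact ⟨D, fun x t ht => by rw [← iteratedDeriv_succ']; exact hD x t ht⟩)
    (fun i => by
      obtain ⟨D, hD⟩ := h i
      exact ⟨D, fun x t ht => by rw [iteratedDeriv_fun_neg, abs_neg]; exact hD x t ht⟩)
  have hle : ((j : ℕ∞) : WithTop ℕ∞) ≤ ∞ := by exact_mod_cast le_top
  have hbound : ∀ x t, 0 ≤ t → ‖iteratedDeriv j (curveOf fun y => q y t) x -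
      iteratedDeriv j (curveOf p) x‖ ≤ D * Real.exp (-κ * t) := by
    intro x t ht
    rw [← iteratedDeriv_fun_sub ((contDiff_curveOf (hq t)).contDiffAt.of_le hle)
      ((contDiff_curveOf hp).contDiffAt.of_le hle)]
    simp only [← curveOf_sub (hq t) hp]
    have := hD x t ht
    simp only [neg_smul, ← sub_eq_add_neg] at this
    exact this
  have hlim : Tendsto (fun t => D * Real.exp (-κ * t)) atTop (𝓝 0) := by
    have : Tendsto (fun t : ℝ => -κ * t) atTop atBot :=
      tendsto_id.const_mul_atTop_of_neg (by linarith)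
    simpa using (Real.tendsto_exp_atBot.comp this).const_mul D
  rw [Metric.tendstoUniformly_iff]
  intro ε hε
  filter_upwards [hlim.eventually (gt_mem_nhds hε), eventually_ge_atTop 0] with t h1 h2 x
  rw [dist_comm, dist_eq_norm]
  exact (hbound x t h2).trans_lt h1

/-! ### The limit curve -/

section Limit

variable {m k : ℕ} {p : ℝ → ℝ} {c : ℝ}

lemma rad_sub_mean (hp : ContDiff ℝ ∞ p) (c x : ℝ) :
    rad (fun y => p y - shiftSum m k p y / k - c) x = rad p x - shiftSum m k (rad p) x / k - c := by
  have h := rad_affine (V := fun _ => 0) hp contDiff_const (contDiff_shiftSum (m := m) (k := k) hp)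
    k c x
  have h0 : rad (fun _ => (0 : ℝ)) x = 0 := by simp [rad]
  have e : (fun y => p y + (0 - shiftSum m k p y) / k - c) =
      fun y => p y - shiftSum m k p y / k - c := by
    funext y; ring
  rw [h0, e] at h
  rw [h, shiftSum_rad hp]
  ring

/-- The mean over the shifts is itself invariant under them, so subtracting it removes exactly the
width of `p` and leaves a constant. -/
lemma shiftSum_sub_mean (hk : 0 < k) (hper : Function.Periodic p (2 * m * Real.pi)) (c x : ℝ) :
    shiftSum m k (fun y => p y - shiftSum m k p y / k - c) x = -k * c := by
  have hk' : (k : ℝ) ≠ 0 := by positivity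
  have h : Function.Periodic (fun y => shiftSum m k p y / k + c) (2 * m * Real.pi / k) := fun y => by
    simp only [shiftSum_periodic hk hper y]
  have e : (fun y => p y - shiftSum m k p y / k - c) =
      fun y => p y - (shiftSum m k p y / k + c) := by
    funext y; ring
  rw [e, shiftSum_sub, shiftSum_of_periodic h]
  field_simp
  ring

/-- The radius of curvature of the limit curve is constant if and only if that of the initial curve
is invariant under the shift by `2mπ/k`. -/
lemma exists_rad_sub_mean_eq_iff (hk : 0 < k) (hp : ContDiff ℝ ∞ p)
    (hper : Function.Periodic p (2 * m * Real.pi)) (c : ℝ) :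
    (∃ r, ∀ x, rad (fun y => p y - shiftSum m k p y / k - c) x = r) ↔
      Function.Periodic (rad p) (2 * m * Real.pi / k) := by
  have hk' : (k : ℝ) ≠ 0 := by positivity
  simp only [rad_sub_mean hp]
  constructor
  · rintro ⟨r, h⟩ x
    have h1 := h (x + 2 * m * Real.pi / k)
    have h2 := h x
    -- The subtracted mean is invariant under the shift and cancels between `h1` and `h2`.
    rw [shiftSum_periodic hk (periodic_rad hper) x] at h1
    linarith
  · intro h
    refine ⟨-c, fun x => ?_⟩
    rw [shiftSum_of_periodic h]
    field_simp
    ring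

end Limit

/-! ### Existence of the flow -/

/-- Since `ds = ρ dφ`, the integrand `κ² ds` is `κ dφ`. -/
lemma elasticEnergy_curveOf {m : ℕ} {p : ℝ → ℝ} (hp : ContDiff ℝ ∞ p) (hpos : ∀ x, 0 < rad p x) :
    elasticEnergy m (curveOf p) = ∫ x in (0 : ℝ)..(2 * m * Real.pi), 1 / rad p x := by
  refine intervalIntegral.integral_congr fun x _ => ?_
  rw [curvature_curveOf hp hpos, (hasDerivAt_curveOf hp x).deriv, norm_smul, norm_tangentAt,
    Real.norm_eq_abs, abs_of_pos (hpos x)]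
  have := (hpos x).ne'
  field_simp

section Reparametrized

variable {m : ℕ} {p ψ : ℝ → ℝ}

lemma hasDerivAt_curveOf_reparam (hp : ContDiff ℝ ∞ p) (hψ : ContDiff ℝ ∞ ψ) (u : ℝ) :
    HasDerivAt (fun u => curveOf p (ψ u)) ((deriv ψ u * rad p (ψ u)) • tangentAt (ψ u)) u := by
  rw [mul_smul]
  exact (hasDerivAt_curveOf hp (ψ u)).scomp u (hasDerivAt_of_contDiff hψ u)

lemma norm_deriv_curveOf_reparam (hp : ContDiff ℝ ∞ p) (hψ : ContDiff ℝ ∞ ψ)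
    (hpos : ∀ x, 0 < rad p x) (hψ' : ∀ u, 0 < deriv ψ u) (u : ℝ) :
    ‖deriv (fun u => curveOf p (ψ u)) u‖ = deriv ψ u * rad p (ψ u) := by
  rw [(hasDerivAt_curveOf_reparam hp hψ u).deriv, norm_smul, norm_tangentAt, Real.norm_eq_abs,
    abs_of_pos (mul_pos (hψ' u) (hpos _)), mul_one]

lemma curvature_curveOf_reparam (hp : ContDiff ℝ ∞ p) (hψ : ContDiff ℝ ∞ ψ)
    (hpos : ∀ x, 0 < rad p x) (hψ' : ∀ u, 0 < deriv ψ u) (u : ℝ) :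
    curvature (fun u => curveOf p (ψ u)) u = 1 / rad p (ψ u) := by
  have hg : ContDiff ℝ ∞ fun u => deriv ψ u * rad p (ψ u) :=
    (contDiff_deriv hψ).mul ((contDiff_rad hp).comp hψ)
  rw [curvature_eq_of_polar (hasDerivAt_curveOf_reparam hp hψ) (hasDerivAt_of_contDiff hg u)
    (hasDerivAt_of_contDiff hψ u) (mul_pos (hψ' u) (hpos _))]
  have := (hψ' u).ne'
  have := (hpos (ψ u)).ne'
  field_simp

lemma isLocallyConvex_curveOf_reparam (hp : ContDiff ℝ ∞ p) (hψ : ContDiff ℝ ∞ ψ)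
    (hpos : ∀ x, 0 < rad p x) (hψ' : ∀ u, 0 < deriv ψ u)
    (hper : Function.Periodic p (2 * m * Real.pi))
    (hψper : ∀ u, ψ (u + 2 * m * Real.pi) = ψ u + 2 * m * Real.pi) :
    IsLocallyConvex m fun u => curveOf p (ψ u) where
  smooth := (contDiff_curveOf hp).comp hψ
  closed u := by
    rw [hψper, (isLocallyConvexByAngle_curveOf hp hper hpos).closed]
  immersed u := by
    rw [(hasDerivAt_curveOf_reparam hp hψ u).deriv]
    exact smul_ne_zero (mul_pos (hψ' u) (hpos _)).ne' (tangentAt_ne_zero _)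
  curvature_pos u := by
    rw [curvature_curveOf_reparam hp hψ hpos hψ']
    exact one_div_pos.2 (hpos _)

lemma elasticEnergy_curveOf_reparam (hp : ContDiff ℝ ∞ p) (hψ : ContDiff ℝ ∞ ψ)
    (hpos : ∀ x, 0 < rad p x) (hψ' : ∀ u, 0 < deriv ψ u)
    (hper : Function.Periodic p (2 * m * Real.pi))
    (hψper : ∀ u, ψ (u + 2 * m * Real.pi) = ψ u + 2 * m * Real.pi) :
    elasticEnergy m (fun u => curveOf p (ψ u)) =
      ∫ x in (0 : ℝ)..(2 * m * Real.pi), 1 / rad p x := by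
  have e : elasticEnergy m (fun u => curveOf p (ψ u)) =
      ∫ u in (0 : ℝ)..(2 * m * Real.pi), ((fun x => 1 / rad p x) ∘ ψ) u * deriv ψ u := by
    refine intervalIntegral.integral_congr fun u _ => ?_
    simp only [Function.comp]
    rw [curvature_curveOf_reparam hp hψ hpos hψ', norm_deriv_curveOf_reparam hp hψ hpos hψ']
    have := (hpos (ψ u)).ne'
    field_simp
  have hcont : Continuous fun x => 1 / rad p x :=
    continuous_const.div (contDiff_rad hp).continuous fun x => (hpos x).ne'
  have h1per : Function.Periodic (fun x => 1 / rad p x) (2 * m * Real.pi) := fun x => by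
    simp only [periodic_rad hper x]
  rw [e, intervalIntegral.integral_comp_mul_deriv (fun u _ => hasDerivAt_of_contDiff hψ u)
    (contDiff_deriv hψ).continuous.continuousOn hcont]
  have := hψper 0
  rw [zero_add] at this
  rw [this, h1per.intervalIntegral_add_eq (ψ 0) 0, zero_add]

end Reparametrized

/-- The curves with support functions solving the flow of support functions, with points moving
so that their velocity is normal, solve the flow. -/
theorem isFlow_curveOf {m k : ℕ} {X₀ : ℝ → Plane}
    (h₀ : IsLocallyConvexByAngle m X₀) {q ψ : ℝ → ℝ → ℝ}
    (hq : SmoothAlong univ q)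
    (hqper : ∀ t, Function.Periodic (fun x => q x t) (2 * m * Real.pi))
    (hqpos : ∀ x t, 0 < rad (fun y => q y t) x) (hq0 : ∀ x, q x 0 = support X₀ x)
    (hqt : ∀ x t, 0 ≤ t → dt q x t = -speed m k (curveOf fun y => q y t) x)
    (hψs : SmoothAlong univ ψ) (hψ0 : ∀ u, ψ u 0 = u)
    (hψ : ∀ u t, HasDerivAt (fun s => ψ u s) (angleSpeed q (ψ u t) t) t)
    (hψx : ∀ u t, 0 < dx ψ u t)
    (hψper : ∀ u t, ψ (u + 2 * m * Real.pi) t = ψ u t + 2 * m * Real.pi)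
    (hby : ∀ t, byAngle (fun u t => curveOf (fun y => q y t) (ψ u t)) ψ t =
      curveOf fun y => q y t) :
    IsFlow m k X₀ (Ici 0) (fun u t => curveOf (fun y => q y t) (ψ u t)) ψ := by
  have hqs : ∀ t, ContDiff ℝ ∞ fun x => q x t := fun t => hq.contDiff_slice trivial
  have hψsl : ∀ t, ContDiff ℝ ∞ fun u => ψ u t := fun t => hψs.contDiff_slice trivial
  have hconv : ∀ t, IsLocallyConvex m fun u => curveOf (fun y => q y t) (ψ u t) := fun t =>
    isLocallyConvex_curveOf_reparam (hqs t) (hψsl t) (fun x => hqpos x t) (fun u => hψx u t)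
      (hqper t) fun u => hψper u t
  exact
    { smooth := (SmoothAlong.comp (hq.curveOf isOpen_univ) hψs).contDiff.contDiffOn
      closed := fun t _ => (hconv t).closed
      initial := fun u => by
        rw [hψ0, show (fun y => q y 0) = support X₀ from funext hq0,
          curveOf_support h₀.smooth h₀.angle]
      immersed := fun t _ => (hconv t).immersed
      curvature_ne_zero := fun t _ u => ((hconv t).curvature_pos u).ne'
      angle_continuous := hψs.contDiff.continuous.continuousOn
      angle_initial := hψ0
      angle := fun t _ u => by
        rw [norm_deriv_curveOf_reparam (hqs t) (hψsl t) (fun x => hqpos x t) (fun u => hψx u t),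
          (hasDerivAt_curveOf_reparam (hqs t) (hψsl t) u).deriv]
      equation := fun t ht u => by
        refine HasDerivAt.hasDerivWithinAt ?_
        refine (hasDerivAt_curveOf_comp isOpen_univ hq trivial (hψ u t)).congr_deriv ?_
        -- The choice of `angleSpeed` cancels the tangential component, and `-q_t` is the prescribed
        -- normal speed.
        rw [hby, hqt _ _ ht, angleSpeed, div_mul_cancel₀ _ (hqpos _ _).ne', neg_add_cancel,
          zero_smul, zero_sub, neg_smul, neg_neg] }

end

end KWidthFlow

/-! ### Proof of the main theorem -/

theorem theorem1p1 (m k : ℕ) (hm : 0 < m) (hk : 0 < k) (X₀ : ℝ → KWidthFlow.Plane)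
    (hX₀ : KWidthFlow.IsLocallyConvexByAngle m X₀) :
    ∃ (X : ℝ → ℝ → KWidthFlow.Plane) (θ : ℝ → ℝ → ℝ),
      -- global smooth solution
      KWidthFlow.IsFlow m k X₀ (Set.Ici 0) X θ ∧
      -- uniqueness on every time interval
      (∀ T : ℝ, 0 < T → ∀ (X' : ℝ → ℝ → KWidthFlow.Plane) (θ' : ℝ → ℝ → ℝ),
        KWidthFlow.IsFlow m k X₀ (Set.Ico 0 T) X' θ' →
          ∀ t ∈ Set.Ico 0 T, ∀ u, X' u t = X u t ∧ θ' u t = θ u t) ∧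
      -- local convexity and elastic energy are preserved
      (∀ t : ℝ, 0 ≤ t →
        KWidthFlow.IsLocallyConvex m (fun u => X u t) ∧
        (Function.Bijective fun u => θ u t) ∧
        KWidthFlow.IsLocallyConvexByAngle m (KWidthFlow.byAngle X θ t) ∧
        KWidthFlow.elasticEnergy m (fun u => X u t) = KWidthFlow.elasticEnergy m X₀) ∧
      -- smooth convergence, and the limit
      ∃ Xlim : ℝ → KWidthFlow.Plane,
        KWidthFlow.IsLocallyConvexByAngle m Xlim ∧
        (∀ j : ℕ, TendstoUniformly
          (fun t φ => iteratedDeriv j (KWidthFlow.byAngle X θ t) φ)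
          (iteratedDeriv j Xlim) Filter.atTop) ∧
        KWidthFlow.HasConstantKWidth m k Xlim ∧
        (KWidthFlow.IsMultipleCircle Xlim ↔ KWidthFlow.IsKSymmetric m k X₀) := by
  open KWidthFlow in
  have hL : (0 : ℝ) < 2 * m * Real.pi := by positivity
  have hp₀ := contDiff_support hX₀.smooth
  have hper₀ := periodic_support (m := m) hX₀.closed
  have hpos₀ := rad_support_pos hX₀
  have hX₀' := curveOf_support hX₀.smooth hX₀.angle
  obtain ⟨q, c, hq, hqper, hqpos, hq0, hqE, hqt, hcpos, hconv⟩ :=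
    exists_support_flow hm hk hp₀ hper₀ hpos₀
  obtain ⟨ψ, hψs, hψ0, hψ, hψx, hψper⟩ := exists_smooth_flow hL
    (SmoothAlong.angleSpeed hq hqpos) (fun t => angleSpeed_periodic hqper t)
  have hqs : ∀ t, ContDiff ℝ ∞ fun x => q x t := fun t => hq.contDiff_slice trivial
  have hψsl : ∀ t, ContDiff ℝ ∞ fun u => ψ u t := fun t => hψs.contDiff_slice trivial
  have hbij : ∀ t, Function.Bijective fun u => ψ u t := fun t =>
    ⟨(strictMono_of_deriv_pos fun u => hψx u t).injective,
      surjective_of_quasiperiodic hL (hψsl t).continuous fun u => hψper u t⟩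
  have hby : ∀ t, byAngle (fun u t => curveOf (fun y => q y t) (ψ u t)) ψ t =
      curveOf fun y => q y t := by
    intro t
    funext φ
    obtain ⟨u, rfl⟩ := (hbij t).2 φ
    exact byAngle_angle (hbij t).1 u
  -- The support function of the limit curve: the initial one without its mean over the shifts,
  -- lowered by the limiting level.
  have hlim : ContDiff ℝ ∞ fun y => support X₀ y - shiftSum m k (support X₀) y / k - c :=
    (hp₀.sub ((contDiff_shiftSum hp₀).div_const _)).sub contDiff_const
  have hSper := periodic_of_periodic_div hk (shiftSum_periodic hk hper₀)
  refine ⟨fun u t => curveOf (fun y => q y t) (ψ u t), ψ,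
    isFlow_curveOf hX₀ hq hqper hqpos hq0 hqt hψs hψ0 hψ hψx hψper hby,
    fun T _ X' θ' h t ht u => h.eq_curveOf hm hk hX₀ hq hqper hqpos hq0 hqt hψ0 hψ ht u,
    fun t _ => ⟨isLocallyConvex_curveOf_reparam (hqs t) (hψsl t) (fun x => hqpos x t)
      (fun u => hψx u t) (hqper t) fun u => hψper u t, hbij t, ?_, ?_⟩,
    curveOf fun y => support X₀ y - shiftSum m k (support X₀) y / k - c,
    isLocallyConvexByAngle_curveOf hlim (fun y => ?_) hcpos, fun j => ?_, ⟨-k * c, fun φ => ?_⟩, ?_⟩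
  · rw [hby]
    exact isLocallyConvexByAngle_curveOf (hqs t) (hqper t) fun x => hqpos x t
  · conv_rhs => rw [← hX₀', elasticEnergy_curveOf hp₀ hpos₀]
    rw [elasticEnergy_curveOf_reparam (hqs t) (hψsl t) (fun x => hqpos x t) (fun u => hψx u t)
      (hqper t) fun u => hψper u t, hqE t]
  · simp only [hper₀ y, hSper y]
  · simp only [hby]
    exact tendstoUniformly_iteratedDeriv_curveOf (by exact_mod_cast hk) hqs hlim hconv j
  · rw [kWidth_curveOf, shiftSum_sub_mean hk hper₀]
  · rw [isMultipleCircle_curveOf_iff hlim hcpos, exists_rad_sub_mean_eq_iff hk hp₀ hper₀]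
    conv_rhs => rw [← hX₀', isKSymmetric_curveOf_iff hk hp₀ hper₀]
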